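/- **Theorem (tubular hypersurfaces).** Let $I\subseteq\mathbb R$ be open, let $F:I\to\mathbb R$ be smooth with $F_{yy}\neq 0$ on $I$, and let $M=\{(z,w)\in\mathbb C^2 : z=x+iy,\ w=u+iv,\ y\in I,\ v=F(y)\}$ be the corresponding strictly pseudoconvex tubular hypersurface, with coordinates $(x,y,u)$ and CR structure given by $$\mu=dz=dx+i\,dy,\qquad \lambda=\frac{2}{F_{yy}}\,(du-F_y\,dx).$$ A *lift* of (an open part of) $M$ is a metric $$g=2P^2\big(\mu\bar\mu+\lambda(dr+W\mu+\overline W\bar\mu+H\lambda)\big),\qquad \alpha\beta=\tfrac12(\alpha\otimes\beta+\beta\otimes\alpha),$$ with smooth functions $P$ (real, nowhere zero), $W$ (complex) and $H$ (real) of $(x,y,u,r)$. For open $J\subseteq I$ put $\mathscr M_J=\{(x,y,u,r): y\in J,\ -\pi<r<\pi\}$. A metric $g$ is *shearfree* for a nowhere vanishing null vector field $k$ if $\mathcal L_k g=\rho g+\theta\psi$ with a smooth function $\rho$, a smooth 1-form $\psi$ and $\theta=g(k,\cdot)$. Let $\Lambda$ be an arbitrary real constant. 1. For every $y_0\in I$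 there are $\varepsilon>0$ with $J=(y_0-\varepsilon,y_0+\varepsilon)\subseteq I$ and a lift $g$ on $\mathscr M_J$ which is Lorentzian, shearfree for $k=\partial_r$, at every point of Petrov type II or D, and satisfies $$\operatorname{Ric}(g)=\Lambda g+\Phi\lambda^2$$ for some real function $\Phi$. 2. Put $R=-\frac14(\log|F_{yy}|)_{yy}$. Let $J\subseteq I$ be open, let $q:J\to\mathbb R$ be smooth and nowhere zero, and let $g_q$ be the lift on $\mathscr M_J$ with $$P=\frac{2\sqrt{|F_{yy}|}\;q}{\cos(r/2)},\qquad W=\frac{q'}{q}\,(1+e^{-ir}),$$ $$H=2B(1+\cos r)+\tfrac83\Lambda|F_{yy}|q^2-\frac{F_{yy}\,(\sin 2r+2\sin r)}{64\,q^4},\qquad B=\tfrac83\Lambda|F_{yy}|q^2-\tfrac14\Big(\frac{q'}{q}\Big)'-\tfrac12R.$$ Then $g_q$ is Lorentzian and shearfree for $\partial_r$, and it satisfies $\operatorname{Ric}(g_q)=\Lambda g_q+\Phi\lambda^2$ for some real function $\Phi$ if and only if $$q''+Rq=\tfrac{16}{3}\,\Lambda\,|F_{yy}|\,q^3\quad\text{on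 }J;$$ in that case $g_q$ is of Petrov type II or D at every point. 3. For every $y_0\in I$ and all $q_0\neq0$, $q_1\in\mathbb R$, this ODE has a smooth nowhere vanishing solution on some interval $(y_0-\varepsilon,y_0+\varepsilon)\subseteq I$ with $q(y_0)=q_0$ and $q'(y_0)=q_1$. -/

import Mathlib

open scoped ContDiff
open Set

noncomputable section

namespace Shearfree

/-! ### Tensor calculus on open subsets of `ℝ⁴`, in the coordinates `(x, y, u, r)` -/

/-- Points of `ℝ⁴`; the coordinates `0, 1, 2, 3` are `x, y, u, r`. -/
abbrev Pt := Fin 4 → ℝ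

/-- Components of a covariant 2-tensor at a point. -/
abbrev Mat := Matrix (Fin 4) (Fin 4) ℝ

/-- The partial derivative `∂f/∂xⁱ` at `p`. -/
def pd (i : Fin 4) (f : Pt → ℝ) (p : Pt) : ℝ :=
  deriv (fun t => f (Function.update p i t)) (p i)

/-- Christoffel symbols `Γⁱⱼₖ` of the metric `g`. -/
def christoffel (g : Pt → Mat) (i j k : Fin 4) (p : Pt) : ℝ :=
  (1 / 2) * ∑ l, (g p)⁻¹ i l *
    (pd j (fun x => g x l k) p + pd k (fun x => g x l j) p - pd l (fun x => g x j k) p)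

/-- Riemann tensor `Rⁱⱼₖₗ = ∂ₖ Γⁱₗⱼ - ∂ₗ Γⁱₖⱼ + Γⁱₖₘ Γᵐₗⱼ - Γⁱₗₘ Γᵐₖⱼ`. -/
def riemann (g : Pt → Mat) (i j k l : Fin 4) (p : Pt) : ℝ :=
  pd k (christoffel g i l j) p - pd l (christoffel g i k j) p
    + ∑ m, (christoffel g i k m p * christoffel g m l j p
      - christoffel g i l m p * christoffel g m k j p)

/-- Ricci tensor `Ricⱼₗ = Rⁱⱼᵢₗ`. -/
def ricci (g : Pt → Mat) (j l : Fin 4) (p : Pt) : ℝ := ∑ i, riemann g i j i l p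

/-- Scalar curvature. -/
def scalarCurvature (g : Pt → Mat) (p : Pt) : ℝ :=
  ∑ j, ∑ l, (g p)⁻¹ j l * ricci g j l p

/-- Riemann tensor with all indices down. -/
def riemannLow (g : Pt → Mat) (i j k l : Fin 4) (p : Pt) : ℝ :=
  ∑ m, g p i m * riemann g m j k l p

/-- Weyl tensor `Cᵢⱼₖₗ` in dimension four. -/
def weyl (g : Pt → Mat) (i j k l : Fin 4) (p : Pt) : ℝ :=
  riemannLow g i j k l p
    - (1 / 2) * (g p i k * ricci g j l p - g p i l * ricci g j k p
        - g p j k * ricci g i l p + g p j l * ricci g i k p)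
    + scalarCurvature g p / 6 * (g p i k * g p j l - g p i l * g p j k)

/-- `g` is a smooth metric of signature `(+,+,+,-)` on `U`. -/
structure IsLorentzianMetric (g : Pt → Mat) (U : Set Pt) : Prop where
  smooth : ∀ i j, ContDiffOn ℝ ∞ (fun p => g p i j) U
  symm : ∀ p ∈ U, (g p).IsSymm
  signature : ∀ p ∈ U, ∃ A : Mat, IsUnit A.det ∧
    A.transpose * g p * A = Matrix.diagonal ![1, 1, 1, -1]

/-- Components of the Lie derivative `L_k g` along the vector field `k`. -/
def lieDerivMetric (k : Pt → Fin 4 → ℝ) (g : Pt → Mat) (i j : Fin 4) (p : Pt) : ℝ :=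
  ∑ l, (k p l * pd l (fun x => g x i j) p
    + g p l j * pd i (fun x => k x l) p + g p i l * pd j (fun x => k x l) p)

/-- The 1-form `θ = g(k, ·)`. -/
def flat (g : Pt → Mat) (k : Pt → Fin 4 → ℝ) (p : Pt) (i : Fin 4) : ℝ := ∑ j, g p i j * k p j

/-- The vector field `k` is nowhere vanishing, null, and satisfies `L_k g = ρ g + θ ψ` on `U` with
a function `ρ` and a 1-form `ψ`, where `θ = g(k, ·)` and `θ ψ = (θ ⊗ ψ + ψ ⊗ θ) / 2`. -/
structure IsShearfree (g : Pt → Mat) (U : Set Pt) (k : Pt → Fin 4 → ℝ) : Prop where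
  smooth : ∀ i, ContDiffOn ℝ ∞ (fun p => k p i) U
  ne_zero : ∀ p ∈ U, k p ≠ 0
  null : ∀ p ∈ U, ∑ i, ∑ j, g p i j * k p i * k p j = 0
  lie : ∃ (ρ : Pt → ℝ) (ψ : Pt → Fin 4 → ℝ),
    ContDiffOn ℝ ∞ ρ U ∧ (∀ i, ContDiffOn ℝ ∞ (fun p => ψ p i) U) ∧
    ∀ p ∈ U, ∀ i j, lieDerivMetric k g i j p =
      ρ p * g p i j + (flat g k p i * ψ p j + ψ p i * flat g k p j) / 2

/-- The quasi-Einstein equation `Ric(g) = Λ g + Φ λ²` on `U`, with some real function `Φ`. -/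
def IsQuasiEinstein (g : Pt → Mat) (lam : Pt → Fin 4 → ℝ) (Λ : ℝ) (U : Set Pt) : Prop :=
  ∃ Φ : Pt → ℝ, ∀ p ∈ U, ∀ i j, ricci g i j p = Λ * g p i j + Φ p * (lam p i * lam p j)

/-! ### Petrov types -/

/-- Complex bilinear extension of a real bilinear form. -/
def bilinC (B : Mat) (a b : Fin 4 → ℂ) : ℂ := ∑ i, ∑ j, (B i j : ℂ) * a i * b j

/-- Complex multilinear extension of the Weyl tensor at `p`. -/
def weylC (g : Pt → Mat) (p : Pt) (a b c d : Fin 4 → ℂ) : ℂ :=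
  ∑ i, ∑ j, ∑ k, ∑ l, (weyl g i j k l p : ℂ) * a i * b j * c k * d l

/-- `(k, l, m, m̄)` is a complex null tetrad: `k, l` are real, and the only non-zero products are
`g(k,l) = -1` and `g(m,m̄) = 1`. -/
structure IsNullTetrad (B : Mat) (k l m : Fin 4 → ℂ) : Prop where
  real_k : star k = k
  real_l : star l = l
  kk : bilinC B k k = 0
  ll : bilinC B l l = 0
  kl : bilinC B k l = -1
  km : bilinC B k m = 0
  lm : bilinC B l m = 0
  mm : bilinC B m m = 0
  mmbar : bilinC B m (star m) = 1

/-- Weyl scalars with respect to a null tetrad. -/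
def Psi0 (g : Pt → Mat) (p : Pt) (k m : Fin 4 → ℂ) : ℂ := weylC g p k m k m
/-- See `Psi0`. -/
def Psi1 (g : Pt → Mat) (p : Pt) (k l m : Fin 4 → ℂ) : ℂ := weylC g p k l k m
/-- See `Psi0`. -/
def Psi2 (g : Pt → Mat) (p : Pt) (k l m : Fin 4 → ℂ) : ℂ := weylC g p k m (star m) l
/-- See `Psi0`. -/
def Psi3 (g : Pt → Mat) (p : Pt) (k l m : Fin 4 → ℂ) : ℂ := weylC g p k l (star m) l
/-- See `Psi0`. -/
def Psi4 (g : Pt → Mat) (p : Pt) (l m : Fin 4 → ℂ) : ℂ := weylC g p (star m) l (star m) l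

/-- Petrov type II at `p`: one double and two simple principal null directions. The principal null
directions correspond to the roots (in the projective line) of
`Ψ₀ - 4 Ψ₁ z + 6 Ψ₂ z² - 4 Ψ₃ z³ + Ψ₄ z⁴`. In a tetrad whose `k` is the double one,
`Ψ₀ = Ψ₁ = 0 ≠ Ψ₂`, and the other two, the roots of `6 Ψ₂ - 4 Ψ₃ z + Ψ₄ z²`, are distinct. -/
def IsPetrovTypeII (g : Pt → Mat) (p : Pt) : Prop :=
  ∃ k l m : Fin 4 → ℂ, IsNullTetrad (g p) k l m ∧
    Psi0 g p k m = 0 ∧ Psi1 g p k l m = 0 ∧ Psi2 g p k l m ≠ 0 ∧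
    2 * Psi3 g p k l m ^ 2 ≠ 3 * Psi2 g p k l m * Psi4 g p l m

/-- Petrov type D at `p`: two double principal null directions. As for type II, but the roots of
`6 Ψ₂ - 4 Ψ₃ z + Ψ₄ z²` coincide. -/
def IsPetrovTypeD (g : Pt → Mat) (p : Pt) : Prop :=
  ∃ k l m : Fin 4 → ℂ, IsNullTetrad (g p) k l m ∧
    Psi0 g p k m = 0 ∧ Psi1 g p k l m = 0 ∧ Psi2 g p k l m ≠ 0 ∧
    2 * Psi3 g p k l m ^ 2 = 3 * Psi2 g p k l m * Psi4 g p l m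

/-! ### Lifts of a CR structure -/

/-- The metric `2 P² (μ μ̄ + λ (dr + W μ + W̄ μ̄ + H λ))`, where `α β = (α ⊗ β + β ⊗ α) / 2`. The
forms `mu`, `lam` on the three-dimensional CR manifold are pulled back to `ℝ⁴`. -/
def liftMetric (mu : Pt → Fin 4 → ℂ) (lam : Pt → Fin 4 → ℝ)
    (P : Pt → ℝ) (W : Pt → ℂ) (H : Pt → ℝ) (p : Pt) : Mat :=
  let τ : Fin 4 → ℝ := fun i =>
    (if i = 3 then 1 else 0) + 2 * (W p * mu p i).re + H p * lam p i
  Matrix.of fun i j =>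
    P p ^ 2 * (2 * (mu p i * star (mu p j)).re + (lam p i * τ j + τ i * lam p j))

/-- On `U`, the metric `g` belongs to the family of lifts of the CR structure `(mu, lam)`. -/
def IsLift (mu : Pt → Fin 4 → ℂ) (lam : Pt → Fin 4 → ℝ) (g : Pt → Mat) (U : Set Pt) : Prop :=
  ∃ (P : Pt → ℝ) (W : Pt → ℂ) (H : Pt → ℝ),
    ContDiffOn ℝ ∞ P U ∧ ContDiffOn ℝ ∞ W U ∧ ContDiffOn ℝ ∞ H U ∧
    (∀ p ∈ U, P p ≠ 0) ∧ ∀ p ∈ U, g p = liftMetric mu lam P W H p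

/-- The coordinate vector field `∂/∂r`. -/
def dr : Pt → Fin 4 → ℝ := fun _ => ![0, 0, 0, 1]

/-! ### Tubular hypersurfaces -/

/-- The second derivative `F_yy`. -/
def Fyy (F : ℝ → ℝ) (y : ℝ) : ℝ := deriv (deriv F) y

/-- The hypersurface `v = F(y)` in `ℂ²`, with coordinates `z = x + i y`, `w = u + i v`,
parametrized by `(x, y, u)`; the coordinate `r` is ignored. -/
def tubeEmbedding (F : ℝ → ℝ) (p : Pt) : ℂ × ℂ :=
  ((p 0 : ℂ) + Complex.I * (p 1 : ℂ), (p 2 : ℂ) + Complex.I * (F (p 1) : ℂ))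

/-- The form `μ = dz = dx + i dy`. -/
def tubeMu : Pt → Fin 4 → ℂ := fun _ => ![1, Complex.I, 0, 0]

/-- The form `λ' = J(dv - dF) = du - F_y dx` on the hypersurface. -/
def tubeContact (F : ℝ → ℝ) : Pt → Fin 4 → ℝ := fun p => ![-deriv F (p 1), 0, 1, 0]

/-- The form `λ = (2 / F_yy) λ'`. -/
def tubeLam (F : ℝ → ℝ) : Pt → Fin 4 → ℝ := fun p i => 2 / Fyy F (p 1) * tubeContact F p i

/-- The part of `M × (-π, π)` that lies over `y ∈ J`. -/
def tubeDomain (J : Set ℝ) : Set Pt := {p | p 1 ∈ J ∧ p 3 ∈ Ioo (-Real.pi) Real.pi}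

/-- `R = -(1/4) (log |F_yy|)_yy`. -/
def tubeR (F : ℝ → ℝ) (y : ℝ) : ℝ :=
  -(1 / 4) * deriv (deriv fun t => Real.log |Fyy F t|) y

/-- `q` solves on `J` the equation `q'' + R q = (16/3) Λ |F_yy| q³`. -/
def SolvesTubeODE (F : ℝ → ℝ) (Λ : ℝ) (q : ℝ → ℝ) (J : Set ℝ) : Prop :=
  ∀ y ∈ J, deriv (deriv q) y + tubeR F y * q y = 16 / 3 * Λ * |Fyy F y| * q y ^ 3

/-- The logarithmic derivative `q' / q`. -/
def logD (q : ℝ → ℝ) (y : ℝ) : ℝ := deriv q y / q y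

/-- `P = 2 √|F_yy| q / cos (r/2)`. -/
def tubeP (F q : ℝ → ℝ) (p : Pt) : ℝ :=
  2 * Real.sqrt |Fyy F (p 1)| * q (p 1) / Real.cos (p 3 / 2)

/-- `W = (q'/q) (1 + e^{-ir})`. -/
def tubeW (q : ℝ → ℝ) (p : Pt) : ℂ :=
  (logD q (p 1) : ℂ) * (1 + Complex.exp (-(Complex.I * (p 3 : ℂ))))

/-- `B = (8/3) Λ |F_yy| q² - (q'/q)'/4 - R/2`. -/
def tubeB (F : ℝ → ℝ) (Λ : ℝ) (q : ℝ → ℝ) (y : ℝ) : ℝ :=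
  8 / 3 * Λ * |Fyy F y| * q y ^ 2 - deriv (logD q) y / 4 - tubeR F y / 2

/-- `H = 2 B (1 + cos r) + (8/3) Λ |F_yy| q² - F_yy (sin 2r + 2 sin r) / (64 q⁴)`. -/
def tubeH (F : ℝ → ℝ) (Λ : ℝ) (q : ℝ → ℝ) (p : Pt) : ℝ :=
  2 * tubeB F Λ q (p 1) * (1 + Real.cos (p 3))
    + 8 / 3 * Λ * |Fyy F (p 1)| * q (p 1) ^ 2
    - Fyy F (p 1) * (Real.sin (2 * p 3) + 2 * Real.sin (p 3)) / (64 * q (p 1) ^ 4)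

/-- The lift of the tubular hypersurface `v = F(y)` determined by `Λ` and `q`. -/
def tubeMetric (F : ℝ → ℝ) (Λ : ℝ) (q : ℝ → ℝ) : Pt → Mat :=
  liftMetric tubeMu (tubeLam F) (tubeP F q) (tubeW q) (tubeH F Λ q)

/-- `tubeMu` is the pull-back of `dz` under the embedding, and `tubeContact` is the pull-back of
`X ↦ (dv - dF)(i X)`; so its kernel is the complex tangent space of the hypersurface. -/
theorem tube_forms_eq_pullback (F : ℝ → ℝ) (p : Pt) (hF : DifferentiableAt ℝ F (p 1)) (i : Fin 4) :
    tubeMu p i = (fderiv ℝ (tubeEmbedding F) p (Pi.single i 1)).1 ∧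
    tubeContact F p i = fderiv ℝ (fun Z : ℂ × ℂ => Z.2.im - F Z.1.im) (tubeEmbedding F p)
      (Complex.I • fderiv ℝ (tubeEmbedding F) p (Pi.single i 1)) := by
  have hc : ∀ j : Fin 4, HasFDerivAt (fun x : Pt => ((x j : ℝ) : ℂ))
      (Complex.ofRealCLM.comp (ContinuousLinearMap.proj j : Pt →L[ℝ] ℝ)) p := fun j =>
    (Complex.ofRealCLM.comp (ContinuousLinearMap.proj j : Pt →L[ℝ] ℝ)).hasFDerivAt
  have hy : HasFDerivAt (fun x : Pt => x 1) (ContinuousLinearMap.proj 1 : Pt →L[ℝ] ℝ) p :=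
    (ContinuousLinearMap.proj 1 : Pt →L[ℝ] ℝ).hasFDerivAt
  have hFy : HasFDerivAt (fun x : Pt => ((F (x 1) : ℝ) : ℂ))
      (Complex.ofRealCLM.comp (deriv F (p 1) • (ContinuousLinearMap.proj 1 : Pt →L[ℝ] ℝ))) p :=
    Complex.ofRealCLM.hasFDerivAt.comp p (hF.hasDerivAt.comp_hasFDerivAt p hy)
  have hι := ((hc 0).add ((hc 1).const_mul Complex.I)).prodMk
    ((hc 2).add (hFy.const_mul Complex.I))
  have hι' : fderiv ℝ (tubeEmbedding F) p = _ := hι.fderiv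
  have h1 : HasFDerivAt (fun Z : ℂ × ℂ => Z.1.im)
      (Complex.imCLM.comp (ContinuousLinearMap.fst ℝ ℂ ℂ)) (tubeEmbedding F p) :=
    (Complex.imCLM.comp (ContinuousLinearMap.fst ℝ ℂ ℂ)).hasFDerivAt
  have h2 : HasFDerivAt (fun Z : ℂ × ℂ => Z.2.im)
      (Complex.imCLM.comp (ContinuousLinearMap.snd ℝ ℂ ℂ)) (tubeEmbedding F p) :=
    (Complex.imCLM.comp (ContinuousLinearMap.snd ℝ ℂ ℂ)).hasFDerivAt
  have hp : (tubeEmbedding F p).1.im = p 1 := by simp [tubeEmbedding]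
  have hF' : HasDerivAt F (deriv F (p 1)) (tubeEmbedding F p).1.im := by
    rw [hp]; exact hF.hasDerivAt
  have hρ := h2.sub (HasDerivAt.comp_hasFDerivAt (f := fun Z : ℂ × ℂ => Z.1.im) (tubeEmbedding F p) hF' h1)
  have hρ' : fderiv ℝ (fun Z : ℂ × ℂ => Z.2.im - F Z.1.im) (tubeEmbedding F p) = _ := hρ.fderiv
  rw [hι', hρ']
  fin_cases i <;> simp [tubeMu, tubeContact]

end Shearfree

end

open Shearfree

open scoped ContDiff
open Set

noncomputable section

namespace Shearfree

/-! ### Partial derivatives -/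

/-! The lift depends only on `y` and `r`, so its curvature can be computed by Cartan's method in the
coframe `dx, dy, λ, τ` with `τ = dr + W μ + W̄ μ̄ + H λ`. There the metric is `P²` times a constant
matrix. The connection forms are written down explicitly and recognized as Levi-Civita: they satisfy
the first structure equation (`torsion_conn`), and they preserve the frame metric up to the scaling
`d log P²` (`frameMetric_mul_conn`, `pd_P2`). The bridge to the coordinate definitions is general: a
torsion-free compatible connection is unique (`christoffel_eq_of_compatible`), curvature is
tensorial under a change of frame, and hence Ricci and Weyl are obtained from frame components
(`IsFrame.ricci_eq`, `IsFrame.weylC_frameVec`).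

With `T = tan (r/2)` and `C = cos² (r/2)`, every coefficient is a polynomial in `T` and `C` over
functions of `y`, and `∂/∂r` preserves such polynomials. The one relation `C (1 + T²) = 1`
(`cosSq_mul`) then turns each curvature formula into a polynomial identity. The functions `F` and
`q` enter only through the differential relations collected in `TubeJets`, which do not include the
ODE.

For arbitrary `q`, every frame component of `Ric - Λ g` except the one along `λ²` is a combination
of the ODE defect `ode` and its derivative `ode1`. The component along `λ²` is the free function
`Φ`. So the ODE suffices; conversely the `dx²` component at `r = 0` is a multiple of the defect,
which gives necessity (`isQuasiEinstein_iff`).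

Take a null tetrad whose `k` is `∂/∂r`. If the ODE holds, `Ψ₀` and `Ψ₁` vanish, while `P² Ψ₂ = -(i ν
/ 32) cos (r/2) exp (-3ir/2)` with `ν = F_yy / q⁴`, in which `Λ` has cancelled. This is never zero,
so only types II and D remain; `Ψ₃` and `Ψ₄` merely decide between them and need not be computed
(`petrov`).

Finally the ODE is regular with smooth coefficients, so Picard–Lindelöf and a bootstrap give smooth
solutions near each point, nonzero after shrinking the interval (`exists_solution`). -/

theorem HasFDerivAt.pd_eq {f : Pt → ℝ} {f' : Pt →L[ℝ] ℝ} {p : Pt} (h : HasFDerivAt f f' p)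
    (i : Fin 4) : pd i f p = f' (Pi.single i 1) := by
  have h' : HasFDerivAt f f' (Function.update p i (p i)) := by simpa using h
  exact (h'.comp_hasDerivAt (p i) (hasDerivAt_update p i (p i))).deriv

theorem pd_eq_fderiv {f : Pt → ℝ} {p : Pt} (h : DifferentiableAt ℝ f p) (i : Fin 4) :
    pd i f p = fderiv ℝ f p (Pi.single i 1) :=
  HasFDerivAt.pd_eq h.hasFDerivAt i

/-- Identities between the metric and its frame expressions are available only on the open domain;
this is what permits differentiating them there. -/
theorem pd_congr {f g : Pt → ℝ} {U : Set Pt} (hU : IsOpen U) (h : EqOn f g U) {p : Pt}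
    (hp : p ∈ U) (i : Fin 4) : pd i f p = pd i g p := by
  apply Filter.EventuallyEq.deriv_eq
  have hc : ContinuousAt (fun t => Function.update p i t) (p i) :=
    (hasDerivAt_update p i (p i)).continuousAt
  have : ∀ᶠ t in nhds (p i), Function.update p i t ∈ U :=
    hc.eventually_mem (hU.mem_nhds (by simpa using hp))
  filter_upwards [this] with t ht using h ht

theorem pd_const (i : Fin 4) (r : ℝ) (p : Pt) : pd i (fun _ => r) p = 0 := by simp [pd]

theorem pd_add {f g : Pt → ℝ} {p : Pt} (hf : DifferentiableAt ℝ f p) (hg : DifferentiableAt ℝ g p)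
    (i : Fin 4) : pd i (fun x => f x + g x) p = pd i f p + pd i g p := by
  rw [HasFDerivAt.pd_eq (hf.hasFDerivAt.fun_add hg.hasFDerivAt), pd_eq_fderiv hf, pd_eq_fderiv hg]
  rfl

theorem pd_mul {f g : Pt → ℝ} {p : Pt} (hf : DifferentiableAt ℝ f p) (hg : DifferentiableAt ℝ g p)
    (i : Fin 4) : pd i (fun x => f x * g x) p = pd i f p * g p + f p * pd i g p := by
  rw [HasFDerivAt.pd_eq (hf.hasFDerivAt.fun_mul hg.hasFDerivAt), pd_eq_fderiv hf, pd_eq_fderiv hg]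
  simp
  ring

theorem pd_sum {ι : Type*} {s : Finset ι} {f : ι → Pt → ℝ} {p : Pt}
    (hf : ∀ j ∈ s, DifferentiableAt ℝ (f j) p) (i : Fin 4) :
    pd i (fun x => ∑ j ∈ s, f j x) p = ∑ j ∈ s, pd i (f j) p := by
  rw [HasFDerivAt.pd_eq (HasFDerivAt.fun_sum fun j hj => (hf j hj).hasFDerivAt)]
  simp only [sum_apply]
  exact Finset.sum_congr rfl fun j hj => (pd_eq_fderiv (hf j hj) i).symm

theorem contDiffOn_pd {f : Pt → ℝ} {U : Set Pt} (hU : IsOpen U) (hf : ContDiffOn ℝ ∞ f U)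
    (i : Fin 4) : ContDiffOn ℝ ∞ (pd i f) U := by
  have h := (hf.fderiv_of_isOpen hU (m := ∞) (by simp)).clm_apply
    (contDiffOn_const (c := (Pi.single i 1 : Pt)))
  refine h.congr fun p hp => pd_eq_fderiv ?_ i
  exact (hf.differentiableOn (by simp)).differentiableAt (hU.mem_nhds hp)

/-- Needed so that the second derivatives of the coframe cancel in the curvature. -/
theorem pd_comm {f : Pt → ℝ} {U : Set Pt} (hU : IsOpen U) (hf : ContDiffOn ℝ ∞ f U) {p : Pt}
    (hp : p ∈ U) (i j : Fin 4) : pd i (pd j f) p = pd j (pd i f) p := by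
  have hd : ∀ x ∈ U, DifferentiableAt ℝ f x := fun x hx =>
    (hf.differentiableOn (by simp)).differentiableAt (hU.mem_nhds hx)
  have hd' : DifferentiableAt ℝ (fderiv ℝ f) p :=
    ((hf.fderiv_of_isOpen hU (m := ∞) (by simp)).differentiableOn
      (by simp)).differentiableAt (hU.mem_nhds hp)
  have key : ∀ a b : Fin 4, pd a (pd b f) p =
      fderiv ℝ (fderiv ℝ f) p (Pi.single a 1) (Pi.single b 1) := by
    intro a b
    rw [pd_congr hU (fun x hx => pd_eq_fderiv (hd x hx) b) hp,
      HasFDerivAt.pd_eq (hd'.hasFDerivAt.clm_apply (hasFDerivAt_const (Pi.single b 1 : Pt) p))]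
    simp
  rw [key, key]
  exact (((hf.contDiffAt (hU.mem_nhds hp)).isSymmSndFDerivAt
    (by rw [minSmoothness_of_isRCLikeNormedField]; exact WithTop.coe_le_coe.2 le_top)).eq _ _)

/-! ### Matrix-valued functions -/

/-- The entries of `M` are smooth on `U`. -/
def SmoothMat (M : Pt → Mat) (U : Set Pt) : Prop := ∀ i j, ContDiffOn ℝ ∞ (fun p => M p i j) U

/-- Entrywise partial derivative. -/
def pdM (k : Fin 4) (M : Pt → Mat) (p : Pt) : Mat := Matrix.of fun i j => pd k (fun x => M x i j) p

section pdM

variable {U : Set Pt} {M N : Pt → Mat} {p : Pt}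

theorem SmoothMat.differentiableAt (hM : SmoothMat M U) (hU : IsOpen U) (hp : p ∈ U)
    (i j : Fin 4) : DifferentiableAt ℝ (fun x => M x i j) p :=
  ((hM i j).differentiableOn (by simp)).differentiableAt (hU.mem_nhds hp)

theorem SmoothMat.mul (hM : SmoothMat M U) (hN : SmoothMat N U) :
    SmoothMat (fun x => M x * N x) U := fun i j => by
  simp only [Matrix.mul_apply]
  exact ContDiffOn.sum fun l _ => (hM i l).mul (hN l j)

theorem SmoothMat.add (hM : SmoothMat M U) (hN : SmoothMat N U) :
    SmoothMat (fun x => M x + N x) U := fun i j => (hM i j).add (hN i j)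

theorem SmoothMat.transpose (hM : SmoothMat M U) : SmoothMat (fun x => (M x).transpose) U :=
  fun i j => hM j i

theorem SmoothMat.pdM (hM : SmoothMat M U) (hU : IsOpen U) (k : Fin 4) : SmoothMat (pdM k M) U :=
  fun i j => contDiffOn_pd hU (hM i j) k

theorem pdM_congr (hU : IsOpen U) (h : EqOn M N U) (hp : p ∈ U) (k : Fin 4) :
    pdM k M p = pdM k N p := by
  ext i j
  exact pd_congr (f := fun x => M x i j) (g := fun x => N x i j) hU
    (fun x hx => by beta_reduce; rw [h hx]) hp k

theorem pdM_const (k : Fin 4) (A : Mat) : pdM k (fun _ => A) p = 0 := by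
  ext i j
  exact pd_const k _ p

theorem pdM_add (hM : SmoothMat M U) (hN : SmoothMat N U) (hU : IsOpen U) (hp : p ∈ U)
    (k : Fin 4) : pdM k (fun x => M x + N x) p = pdM k M p + pdM k N p := by
  ext i j
  exact pd_add (hM.differentiableAt hU hp i j) (hN.differentiableAt hU hp i j) k

theorem pdM_mul (hM : SmoothMat M U) (hN : SmoothMat N U) (hU : IsOpen U) (hp : p ∈ U)
    (k : Fin 4) : pdM k (fun x => M x * N x) p = pdM k M p * N p + M p * pdM k N p := by
  ext i j
  simp only [Matrix.add_apply, Matrix.mul_apply, pdM, Matrix.of_apply]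
  rw [pd_sum (f := fun l x => M x i l * N x l j) fun l _ => (hM.differentiableAt hU hp i l).mul
      (hN.differentiableAt hU hp l j),
    ← Finset.sum_add_distrib]
  exact Finset.sum_congr rfl fun l _ =>
    pd_mul (hM.differentiableAt hU hp i l) (hN.differentiableAt hU hp l j) k

theorem pdM_transpose (k : Fin 4) : pdM k (fun x => (M x).transpose) p = (pdM k M p).transpose :=
  rfl

theorem pdM_comm (hM : SmoothMat M U) (hU : IsOpen U) (hp : p ∈ U) (k l : Fin 4) :
    pdM k (pdM l M) p = pdM l (pdM k M) p := by
  ext i j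
  exact pd_comm hU (hM i j) hp k l

end pdM

/-! ### Curvature from matrices of connection forms -/

/-- The Christoffel symbols are characterized by symmetry and compatibility with the metric. -/
theorem christoffel_eq_of_compatible {g : Pt → Mat} {Γ : Fin 4 → Mat} {p : Pt}
    (hdet : IsUnit (g p).det) (hsymm : (g p).IsSymm)
    (htor : ∀ i j k, Γ k i j = Γ j i k)
    (hcomp : ∀ k, pdM k g p = (Γ k).transpose * g p + g p * Γ k) (i j k : Fin 4) :
    christoffel g i j k p = Γ j i k := by
  -- Compatibility says that `∂ₖ g` is twice the symmetric part of `g Γₖ`.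
  have hd : ∀ k i j, pd k (fun x => g x i j) p = (g p * Γ k) i j + (g p * Γ k) j i := by
    intro k i j
    have h := congrFun (congrFun (hcomp k) i) j
    have ht : (Γ k).transpose * g p = (g p * Γ k).transpose := by
      rw [Matrix.transpose_mul, hsymm.eq]
    rw [ht, Matrix.add_apply, Matrix.transpose_apply, add_comm] at h
    exact h
  have hs : ∀ k i j, (g p * Γ k) i j = (g p * Γ j) i k := by
    intro k i j
    simp only [Matrix.mul_apply, htor _ j k]
  -- Koszul's argument: by the symmetry `hs`, all terms of the alternating sum cancel except two
  -- equal ones.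
  have h1 : ∀ l, pd j (fun x => g x l k) p + pd k (fun x => g x l j) p
      - pd l (fun x => g x j k) p = 2 * (g p * Γ j) l k := by
    intro l
    rw [hd, hd, hd, hs j k l, hs k j l, hs k l j]
    ring
  unfold christoffel
  simp only [h1]
  have h2 : (g p)⁻¹ * (g p * Γ j) = Γ j := by
    rw [← Matrix.mul_assoc, Matrix.nonsing_inv_mul _ hdet, Matrix.one_mul]
  rw [← congrFun (congrFun h2 i) k, Matrix.mul_apply, Finset.mul_sum]
  refine Finset.sum_congr rfl fun l _ => ?_
  ring

/-- A moving coframe (the rows of `Θ`) with dual frame (the columns of `E`), a metric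
`g = Θᵀ G Θ`, and matrices `w c` of frame components `(w c)ᵃ_b = ω^a_b (e_c)` of the Levi-Civita
connection forms. -/
structure IsFrame (U : Set Pt) (g Θ E G : Pt → Mat) (w : Fin 4 → Pt → Mat) : Prop where
  isOpen : IsOpen U
  smooth_Θ : SmoothMat Θ U
  smooth_E : SmoothMat E U
  smooth_G : SmoothMat G U
  smooth_w : ∀ c, SmoothMat (w c) U
  dual : ∀ p ∈ U, E p * Θ p = 1
  metric : ∀ p ∈ U, g p = (Θ p).transpose * G p * Θ p
  symm : ∀ p ∈ U, (G p).IsSymm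
  det : ∀ p ∈ U, IsUnit (G p).det
  torsion : ∀ p ∈ U, ∀ a k l, pd k (fun x => Θ x a l) p - pd l (fun x => Θ x a k) p =
    ∑ b, ∑ c, (w c p a b * (Θ p c l * Θ p b k - Θ p c k * Θ p b l))
  compat : ∀ p ∈ U, ∀ k, pdM k G p =
    ∑ c, Θ p c k • (G p * w c p + (w c p).transpose * G p)

/-- Coordinate components of the connection forms with frame components `w`. -/
def connForm (Θ : Pt → Mat) (w : Fin 4 → Pt → Mat) (k : Fin 4) (p : Pt) : Mat :=
  ∑ c, Θ p c k • w c p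

/-- Derivative along the frame vector `e_c`. -/
def frameD (E : Pt → Mat) (c : Fin 4) (M : Pt → Mat) (p : Pt) : Mat := ∑ k, E p k c • pdM k M p

/-- The curvature matrix `R(e_c, e_d)` in the frame. -/
def frameRiem (E : Pt → Mat) (w : Fin 4 → Pt → Mat) (c d : Fin 4) (p : Pt) : Mat :=
  frameD E c (w d) p - frameD E d (w c) p + (w c p * w d p - w d p * w c p)
    - ∑ e, (w c p e d - w d p e c) • w e p

/-- Frame components of the Ricci tensor. -/
def frameRicci (E : Pt → Mat) (w : Fin 4 → Pt → Mat) (p : Pt) : Mat :=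
  Matrix.of fun b d => ∑ a, frameRiem E w a d p a b

namespace IsFrame

variable {U : Set Pt} {g Θ E G : Pt → Mat} {w : Fin 4 → Pt → Mat} {p : Pt}

theorem smooth_connForm (h : IsFrame U g Θ E G w) (k : Fin 4) : SmoothMat (connForm Θ w k) U := by
  intro i j
  simp only [connForm, Matrix.sum_apply, Matrix.smul_apply, smul_eq_mul]
  exact ContDiffOn.sum fun c _ => (h.smooth_Θ c k).mul (h.smooth_w c i j)

theorem dual' (h : IsFrame U g Θ E G w) (hp : p ∈ U) : Θ p * E p = 1 :=
  mul_eq_one_comm.mp (h.dual p hp)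

/-- The matrix with entries `Γⁱₖⱼ`. -/
def christoffelMat (Θ E : Pt → Mat) (w : Fin 4 → Pt → Mat) (k : Fin 4) (p : Pt) : Mat :=
  E p * (pdM k Θ p + connForm Θ w k p * Θ p)

/-- `christoffelMat` is the connection after the change of gauge from the coframe `Θ` to the
coordinate frame. The torsion equation becomes symmetry in the lower indices and `compat` becomes
compatibility with `g`, so uniqueness of the Levi-Civita connection applies. -/
theorem christoffel_eq (h : IsFrame U g Θ E G w) (hp : p ∈ U) (i k j : Fin 4) :
    christoffel g i k j p = christoffelMat Θ E w k p i j := by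
  have hg : g p = (Θ p).transpose * G p * Θ p := h.metric p hp
  have hΘE := h.dual' hp
  have hEΘ := h.dual p hp
  refine christoffel_eq_of_compatible (Γ := fun k => christoffelMat Θ E w k p) ?_ ?_ ?_ ?_ i k j
  · have : IsUnit (Θ p).det := by
      rw [← Matrix.isUnit_iff_isUnit_det]
      exact ⟨⟨Θ p, E p, hΘE, hEΘ⟩, rfl⟩
    rw [hg, Matrix.det_mul, Matrix.det_mul, Matrix.det_transpose]
    exact (this.mul (h.det p hp)).mul this
  · rw [hg, Matrix.IsSymm]
    simp only [Matrix.transpose_mul, Matrix.transpose_transpose, (h.symm p hp).eq,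
      Matrix.mul_assoc]
  · intro i j k
    -- Before multiplication by `E`, symmetry in `j, k` is exactly the torsion equation of the form
    -- with index `a`.
    have hs : ∀ a, (pdM k Θ p + connForm Θ w k p * Θ p) a j =
        (pdM j Θ p + connForm Θ w j p * Θ p) a k := by
      intro a
      have ht := h.torsion p hp a k j
      have e : ∀ k j, (connForm Θ w k p * Θ p) a j =
          ∑ b, ∑ c, w c p a b * (Θ p c k * Θ p b j) := by
        intro k j
        simp only [connForm, Matrix.mul_apply, Matrix.sum_apply, Matrix.smul_apply, smul_eq_mul,
          Finset.sum_mul]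
        refine Finset.sum_congr rfl fun b _ => Finset.sum_congr rfl fun c _ => ?_
        ring
      rw [Matrix.add_apply, Matrix.add_apply, e, e]
      simp only [mul_sub, Finset.sum_sub_distrib] at ht
      simp only [pdM, Matrix.of_apply]
      linarith
    simp only [christoffelMat, Matrix.mul_apply (M := E p)]
    simp only [hs]
  · intro k
    have h1 : pdM k g p = (pdM k Θ p).transpose * G p * Θ p + (Θ p).transpose * pdM k G p * Θ p
        + (Θ p).transpose * G p * pdM k Θ p := by
      rw [pdM_congr h.isOpen h.metric hp,
        pdM_mul (h.smooth_Θ.transpose.mul h.smooth_G) h.smooth_Θ h.isOpen hp,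
        pdM_mul h.smooth_Θ.transpose h.smooth_G h.isOpen hp, pdM_transpose]
      noncomm_ring
    have h2 : pdM k G p = G p * connForm Θ w k p + (connForm Θ w k p).transpose * G p := by
      rw [h.compat p hp]
      simp only [connForm, Matrix.mul_sum, Matrix.transpose_sum, Matrix.sum_mul, smul_add,
        Finset.sum_add_distrib, Matrix.transpose_smul, Matrix.mul_smul, Matrix.smul_mul]
    have h3 : g p * christoffelMat Θ E w k p =
        (Θ p).transpose * G p * (pdM k Θ p + connForm Θ w k p * Θ p) := by
      rw [hg, christoffelMat, Matrix.mul_assoc _ (Θ p), ← Matrix.mul_assoc (Θ p), hΘE,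
        Matrix.one_mul]
    have h4 : (christoffelMat Θ E w k p).transpose * g p =
        (pdM k Θ p + connForm Θ w k p * Θ p).transpose * G p * Θ p := by
      have hgs : g p = (g p).transpose := by
        rw [hg]
        simp only [Matrix.transpose_mul, Matrix.transpose_transpose, (h.symm p hp).eq,
          Matrix.mul_assoc]
      rw [hgs, ← Matrix.transpose_mul, h3]
      simp only [Matrix.transpose_mul, Matrix.transpose_transpose, (h.symm p hp).eq,
        Matrix.mul_assoc]
    rw [h1, h2, h3, h4, Matrix.transpose_add, Matrix.transpose_mul]
    noncomm_ring

/-- Curvature forms in coordinate components. -/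
def curvForm (Θ : Pt → Mat) (w : Fin 4 → Pt → Mat) (k l : Fin 4) (p : Pt) : Mat :=
  pdM k (connForm Θ w l) p - pdM l (connForm Θ w k) p
    + (connForm Θ w k p * connForm Θ w l p - connForm Θ w l p * connForm Θ w k p)

/-- Curvature transforms by conjugation under a change of gauge: the inhomogeneous terms `E dΘ`
cancel once `dE` is expressed through `dΘ` and second derivatives commute. -/
theorem riemann_eq_curvForm (h : IsFrame U g Θ E G w) (hp : p ∈ U) (i j k l : Fin 4) :
    riemann g i j k l p = (E p * curvForm Θ w k l p * Θ p) i j := by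
  have hc : ∀ k l, pdM k (fun x => Matrix.of fun i j => christoffel g i l j x) p
      = pdM k (christoffelMat Θ E w l) p := fun k l =>
    pdM_congr h.isOpen (fun x hx => by ext i j; exact h.christoffel_eq hx i l j) hp k
  have h1 : riemann g i j k l p = (pdM k (christoffelMat Θ E w l) p
      - pdM l (christoffelMat Θ E w k) p
      + (christoffelMat Θ E w k p * christoffelMat Θ E w l p
        - christoffelMat Θ E w l p * christoffelMat Θ E w k p)) i j := by
    rw [← hc, ← hc]
    simp only [riemann, h.christoffel_eq hp, Matrix.add_apply, Matrix.sub_apply, Matrix.mul_apply,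
      Finset.sum_sub_distrib]
    rfl
  rw [h1]
  refine congrFun (congrFun ?_ i) j
  have hΘE := h.dual' hp
  have hEΘ := h.dual p hp
  -- Differentiate `E Θ = 1` and multiply by `E` on the right.
  have hdE : ∀ k, pdM k E p = - (E p * pdM k Θ p * E p) := by
    intro k
    have h0 : pdM k E p * Θ p + E p * pdM k Θ p = 0 := by
      rw [← pdM_mul h.smooth_E h.smooth_Θ h.isOpen hp, pdM_congr h.isOpen h.dual hp, pdM_const]
    have h2 := congrArg (· * E p) h0
    simp only [add_mul, zero_mul, Matrix.mul_assoc, hΘE, Matrix.mul_one] at h2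
    rw [Matrix.mul_assoc]
    exact eq_neg_of_add_eq_zero_left h2
  have hd : ∀ k l, pdM k (christoffelMat Θ E w l) p =
      - (E p * pdM k Θ p * E p) * (pdM l Θ p + connForm Θ w l p * Θ p) +
      E p * (pdM k (pdM l Θ) p + (pdM k (connForm Θ w l) p * Θ p
        + connForm Θ w l p * pdM k Θ p)) := by
    intro k l
    unfold christoffelMat
    rw [pdM_mul h.smooth_E ((h.smooth_Θ.pdM h.isOpen l).add
      ((h.smooth_connForm l).mul h.smooth_Θ)) h.isOpen hp, hdE,
      pdM_add (h.smooth_Θ.pdM h.isOpen l) ((h.smooth_connForm l).mul h.smooth_Θ) h.isOpen hp,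
      pdM_mul (h.smooth_connForm l) h.smooth_Θ h.isOpen hp]
  have hcc : ∀ k l, christoffelMat Θ E w k p * christoffelMat Θ E w l p =
      (E p * pdM k Θ p * E p) * (pdM l Θ p + connForm Θ w l p * Θ p) +
      E p * connForm Θ w k p * (pdM l Θ p + connForm Θ w l p * Θ p) := by
    intro k l
    have : E p * connForm Θ w k p * (pdM l Θ p + connForm Θ w l p * Θ p) =
        E p * connForm Θ w k p * (Θ p * E p) * (pdM l Θ p + connForm Θ w l p * Θ p) := by
      rw [hΘE, Matrix.mul_one]
    rw [this]
    unfold christoffelMat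
    noncomm_ring
  rw [hd, hd, hcc, hcc, pdM_comm h.smooth_Θ h.isOpen hp k l, curvForm]
  noncomm_ring

end IsFrame

namespace IsFrame

variable {U : Set Pt} {g Θ E G : Pt → Mat} {w : Fin 4 → Pt → Mat} {p : Pt}

theorem pdM_eq_frameD (h : IsFrame U g Θ E G w) (hp : p ∈ U) (k : Fin 4) (M : Pt → Mat) :
    pdM k M p = ∑ c, Θ p c k • frameD E c M p := by
  have h1 : ∀ l, ∑ c, E p l c * Θ p c k = if l = k then 1 else 0 := by
    intro l
    rw [← Matrix.mul_apply, h.dual p hp, Matrix.one_apply]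
  simp only [frameD, Finset.smul_sum, smul_smul]
  rw [Finset.sum_comm]
  simp only [mul_comm (Θ p _ k), ← Finset.sum_smul, h1]
  simp

theorem pdM_connForm (h : IsFrame U g Θ E G w) (hp : p ∈ U) (k l : Fin 4) :
    pdM k (connForm Θ w l) p =
      ∑ d, (pd k (fun x => Θ x d l) p • w d p + Θ p d l • ∑ c, Θ p c k • frameD E c (w d) p) := by
  simp only [← h.pdM_eq_frameD hp]
  ext i j
  have : pdM k (connForm Θ w l) p i j = pd k (fun x => ∑ d, Θ x d l * w d x i j) p := by
    simp [pdM, connForm, Matrix.sum_apply]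
  rw [this, pd_sum (f := fun d x => Θ x d l * w d x i j) fun d _ =>
      (h.smooth_Θ.differentiableAt h.isOpen hp d l).mul
      ((h.smooth_w d).differentiableAt h.isOpen hp i j), Matrix.sum_apply]
  refine Finset.sum_congr rfl fun d _ => ?_
  exact pd_mul (h.smooth_Θ.differentiableAt h.isOpen hp d l)
      ((h.smooth_w d).differentiableAt h.isOpen hp i j) k

/-- Expanding `dω` for `ω = ∑ w_c θ^c` produces derivatives of the `w_c` along the frame and terms
`w_e dθ^e`. Torsion-freeness turns the latter into the structure-function term of `frameRiem`, since
`[e_c, e_d] = ∇_c e_d - ∇_d e_c`. -/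
theorem curvForm_eq (h : IsFrame U g Θ E G w) (hp : p ∈ U) (k l : Fin 4) :
    curvForm Θ w k l p = ∑ c, ∑ d, (Θ p c k * Θ p d l) • frameRiem E w c d p := by
  have ht : ∑ d, (pd k (fun x => Θ x d l) p - pd l (fun x => Θ x d k) p) • w d p =
      - ∑ c, ∑ d, (Θ p c k * Θ p d l) • ∑ e, (w c p e d - w d p e c) • w e p := by
    simp only [h.torsion p hp _ k l, Finset.smul_sum, Finset.sum_smul, smul_smul, mul_sub, sub_smul,
      smul_sub, Finset.sum_sub_distrib, neg_sub]
    congr 1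
    · rw [Finset.sum_comm' (t' := Finset.univ) (s' := fun _ => Finset.univ) (by simp)]
      refine Finset.sum_congr rfl fun b _ => ?_
      rw [Finset.sum_comm]
      refine Finset.sum_congr rfl fun c _ => Finset.sum_congr rfl fun e _ => ?_
      congr 1; ring
    · rw [Finset.sum_congr rfl fun _ _ => Finset.sum_comm, Finset.sum_comm]
      refine Finset.sum_congr rfl fun b _ => ?_
      rw [Finset.sum_comm]
      refine Finset.sum_congr rfl fun c _ => Finset.sum_congr rfl fun e _ => ?_
      congr 1; ring
  have hm : ∀ k l, connForm Θ w k p * connForm Θ w l p =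
      ∑ c, ∑ d, (Θ p c k * Θ p d l) • (w c p * w d p) := by
    intro k l
    simp only [connForm, Finset.sum_mul_sum, smul_mul_smul_comm]
  have hm' : connForm Θ w l p * connForm Θ w k p =
      ∑ c, ∑ d, (Θ p c k * Θ p d l) • (w d p * w c p) := by
    rw [hm, Finset.sum_comm]
    simp only [mul_comm (Θ p _ l)]
  have hd : ∑ d, Θ p d l • ∑ c, Θ p c k • frameD E c (w d) p =
      ∑ c, ∑ d, (Θ p c k * Θ p d l) • frameD E c (w d) p := by
    rw [Finset.sum_comm]
    simp only [Finset.smul_sum, smul_smul, mul_comm (Θ p _ l)]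
  have hd' : ∑ d, Θ p d k • ∑ c, Θ p c l • frameD E c (w d) p =
      ∑ c, ∑ d, (Θ p c k * Θ p d l) • frameD E d (w c) p := by
    simp only [Finset.smul_sum, smul_smul]
  have hs : ∑ c, ∑ d, (Θ p c k * Θ p d l) • frameRiem E w c d p =
      ∑ c, ∑ d, (Θ p c k * Θ p d l) • frameD E c (w d) p
      - ∑ c, ∑ d, (Θ p c k * Θ p d l) • frameD E d (w c) p
      + (∑ c, ∑ d, (Θ p c k * Θ p d l) • (w c p * w d p)
      - ∑ c, ∑ d, (Θ p c k * Θ p d l) • (w d p * w c p))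
      - ∑ c, ∑ d, (Θ p c k * Θ p d l) • ∑ e, (w c p e d - w d p e c) • w e p := by
    simp only [frameRiem, smul_sub, smul_add, Finset.sum_sub_distrib, Finset.sum_add_distrib]
  rw [hs, sub_eq_add_neg _ (∑ c, ∑ d, (Θ p c k * Θ p d l) • ∑ e, _), ← ht, ← hd, ← hd', ← hm, ← hm',
    curvForm, h.pdM_connForm hp, h.pdM_connForm hp]
  simp only [sub_smul, Finset.sum_add_distrib, Finset.sum_sub_distrib]
  abel

theorem riemann_eq (h : IsFrame U g Θ E G w) (hp : p ∈ U) (i j k l : Fin 4) :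
    riemann g i j k l p =
      ∑ c, ∑ d, Θ p c k * Θ p d l * (E p * frameRiem E w c d p * Θ p) i j := by
  rw [h.riemann_eq_curvForm hp, h.curvForm_eq hp]
  simp only [Matrix.mul_sum, Matrix.sum_mul, Matrix.mul_smul, Matrix.smul_mul, Matrix.sum_apply,
    Matrix.smul_apply, smul_eq_mul]

/-- In coordinates, the Ricci tensor is `Θᵀ (frameRicci) Θ`. -/
theorem ricci_eq (h : IsFrame U g Θ E G w) (hp : p ∈ U) (j l : Fin 4) :
    ricci g j l p = ((Θ p).transpose * frameRicci E w p * Θ p) j l := by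
  have h1 : ∀ c a, ∑ i, Θ p c i * E p i a = if c = a then 1 else 0 := by
    intro c a
    rw [← Matrix.mul_apply, h.dual' hp, Matrix.one_apply]
  have h2 : ∀ c d, ∑ i, Θ p c i * (E p * frameRiem E w c d p * Θ p) i j =
      (frameRiem E w c d p * Θ p) c j := by
    intro c d
    rw [← Matrix.mul_apply, ← Matrix.mul_assoc, ← Matrix.mul_assoc, h.dual' hp, Matrix.one_mul]
  simp only [ricci, h.riemann_eq hp]
  have h3 : ∀ c, ∑ i, ∑ d, Θ p c i * Θ p d l * (E p * frameRiem E w c d p * Θ p) i j =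
      ∑ d, Θ p d l * (frameRiem E w c d p * Θ p) c j := by
    intro c
    rw [Finset.sum_comm]
    refine Finset.sum_congr rfl fun d _ => ?_
    rw [← h2, Finset.mul_sum]
    exact Finset.sum_congr rfl fun i _ => by ring
  rw [Finset.sum_comm, Finset.sum_congr rfl fun c _ => h3 c]
  simp only [Matrix.mul_apply, Matrix.transpose_apply, frameRicci, Matrix.of_apply,
    Finset.mul_sum, Finset.sum_mul]
  rw [Finset.sum_comm]
  refine Finset.sum_congr rfl fun d _ => ?_
  rw [Finset.sum_comm]
  refine Finset.sum_congr rfl fun b _ => Finset.sum_congr rfl fun c _ => ?_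
  ring

end IsFrame

/-! ### Curvature contracted with frame vectors -/

/-- The vector with frame components `α`. -/
def frameVec (E : Mat) (α : Fin 4 → ℂ) : Fin 4 → ℂ := (E.map Complex.ofReal).mulVec α

theorem star_frameVec (E : Mat) (α : Fin 4 → ℂ) : star (frameVec E α) = frameVec E (star α) := by
  ext i
  simp [frameVec, Matrix.mulVec, dotProduct]

theorem bilinC_eq_dotProduct (B : Mat) (a b : Fin 4 → ℂ) :
    bilinC B a b = dotProduct a ((B.map Complex.ofReal).mulVec b) := by
  simp only [bilinC, dotProduct, Matrix.mulVec, Matrix.map_apply, Finset.mul_sum]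
  exact Finset.sum_congr rfl fun i _ => Finset.sum_congr rfl fun j _ => by ring

theorem map_ofReal_mul_eq_one {Θ E : Mat} (h : Θ * E = 1) :
    Θ.map Complex.ofReal * E.map Complex.ofReal = 1 := by
  have := congrArg (fun A : Mat => A.map Complex.ofRealHom) h
  simp only [Matrix.map_mul] at this
  exact this.trans (Matrix.map_one _ Complex.ofReal_zero Complex.ofReal_one)

theorem bilinC_frameVec {Θ E : Mat} (h : Θ * E = 1) (M : Mat) (α β : Fin 4 → ℂ) :
    bilinC (Θ.transpose * M * Θ) (frameVec E α) (frameVec E β) = bilinC M α β := by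
  have h1 := map_ofReal_mul_eq_one h
  have h2 : ((Θ.transpose * M * Θ).map Complex.ofReal) =
      (Θ.map Complex.ofReal).transpose * M.map Complex.ofReal * Θ.map Complex.ofReal := by
    have := Matrix.map_mul (L := Θ.transpose * M) (M := Θ) (f := Complex.ofRealHom)
    have h' := Matrix.map_mul (L := Θ.transpose) (M := M) (f := Complex.ofRealHom)
    rw [h'] at this
    exact this
  rw [bilinC_eq_dotProduct, bilinC_eq_dotProduct, h2, frameVec, frameVec, Matrix.mulVec_mulVec,
    Matrix.mul_assoc, h1, Matrix.mul_one, Matrix.dotProduct_mulVec, Matrix.vecMul_mulVec,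
    ← Matrix.mul_assoc, ← Matrix.transpose_mul, h1, Matrix.transpose_one, Matrix.one_mul,
    ← Matrix.dotProduct_mulVec]

theorem sum_mul_frameVec {Θ E : Mat} (h : Θ * E = 1) (α : Fin 4 → ℂ) (c : Fin 4) :
    ∑ k, (Θ c k : ℂ) * frameVec E α k = α c := by
  have h1 := map_ofReal_mul_eq_one h
  have : (Θ.map Complex.ofReal).mulVec (frameVec E α) = α := by
    rw [frameVec, Matrix.mulVec_mulVec, h1, Matrix.one_mulVec]
  exact congrFun this c

theorem bilinC_smul_single_add (Λ Φ : ℝ) (G : Mat) (i j : Fin 4) (α β : Fin 4 → ℂ) :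
    bilinC (Λ • G + Matrix.single i j Φ) α β = Λ * bilinC G α β + Φ * (α i * β j) := by
  simp only [bilinC, Matrix.add_apply, Matrix.smul_apply, smul_eq_mul, Complex.ofReal_add,
    Complex.ofReal_mul, add_mul, Finset.sum_add_distrib, Finset.mul_sum]
  congr 1
  · exact Finset.sum_congr rfl fun i _ => Finset.sum_congr rfl fun j _ => by ring
  · rw [Finset.sum_eq_single i, Finset.sum_eq_single j]
    · simp; ring
    · intro b _ hb; simp [hb.symm]
    · simp
    · intro b _ hb; simp [hb.symm]
    · simp

/-- The Weyl tensor in terms of the Riemann, Ricci and metric tensors, contracted with vectors. -/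
theorem weylC_eq (g : Pt → Mat) (p : Pt) (a b c d : Fin 4 → ℂ) :
    weylC g p a b c d =
      ∑ i, ∑ j, ∑ k, ∑ l, (riemannLow g i j k l p : ℂ) * a i * b j * c k * d l
      - (1 / 2) * (bilinC (g p) a c * bilinC (Matrix.of fun i j => ricci g i j p) b d
        - bilinC (g p) a d * bilinC (Matrix.of fun i j => ricci g i j p) b c
        - bilinC (g p) b c * bilinC (Matrix.of fun i j => ricci g i j p) a d
        + bilinC (g p) b d * bilinC (Matrix.of fun i j => ricci g i j p) a c)
      + scalarCurvature g p / 6 * (bilinC (g p) a c * bilinC (g p) b d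
        - bilinC (g p) a d * bilinC (g p) b c) := by
  have key : ∀ (A B : Mat) (a b c d : Fin 4 → ℂ), bilinC A a c * bilinC B b d =
      ∑ i, ∑ j, ∑ k, ∑ l, (A i k : ℂ) * a i * c k * ((B j l : ℂ) * b j * d l) := by
    intro A B a b c d
    rw [bilinC, bilinC, Finset.sum_mul_sum]
    exact Finset.sum_congr rfl fun i _ => Finset.sum_congr rfl fun j _ => Finset.sum_mul_sum _ _ _ _
  have key' : ∀ (A B : Mat) (a b c d : Fin 4 → ℂ), bilinC A a d * bilinC B b c =
      ∑ i, ∑ j, ∑ k, ∑ l, (A i l : ℂ) * a i * d l * ((B j k : ℂ) * b j * c k) := by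
    intro A B a b c d
    rw [key]
    exact Finset.sum_congr rfl fun i _ => Finset.sum_congr rfl fun j _ => Finset.sum_comm
  have key2 : ∀ (A B : Mat), bilinC A b d * bilinC B a c =
      ∑ i, ∑ j, ∑ k, ∑ l, (B i k : ℂ) * a i * c k * ((A j l : ℂ) * b j * d l) := by
    intro A B
    rw [mul_comm, key]
  have key3 : ∀ (A B : Mat), bilinC A b c * bilinC B a d =
      ∑ i, ∑ j, ∑ k, ∑ l, (B i l : ℂ) * a i * d l * ((A j k : ℂ) * b j * c k) := by
    intro A B
    rw [mul_comm, key']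
  rw [key, key2, key3, key', key, key']
  simp only [← Finset.sum_sub_distrib, ← Finset.sum_add_distrib, Finset.mul_sum, weylC]
  refine Finset.sum_congr rfl fun i _ => Finset.sum_congr rfl fun j _ =>
    Finset.sum_congr rfl fun k _ => Finset.sum_congr rfl fun l _ => ?_
  simp only [weyl, Matrix.of_apply]
  push_cast
  ring

namespace IsFrame

variable {U : Set Pt} {g Θ E G : Pt → Mat} {w : Fin 4 → Pt → Mat} {p : Pt}

/-- Lowering the first index in the frame amounts to multiplying by `G`, because `g E = Θᵀ G`. -/
theorem riemannLow_eq (h : IsFrame U g Θ E G w) (hp : p ∈ U) (i j k l : Fin 4) :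
    riemannLow g i j k l p = ∑ c, ∑ d, Θ p c k * Θ p d l *
      ((Θ p).transpose * (G p * frameRiem E w c d p) * Θ p) i j := by
  have h1 : ∀ c d, ∑ m, g p i m * (E p * frameRiem E w c d p * Θ p) m j =
      ((Θ p).transpose * (G p * frameRiem E w c d p) * Θ p) i j := by
    intro c d
    rw [← Matrix.mul_apply, h.metric p hp]
    simp only [Matrix.mul_assoc]
    rw [← Matrix.mul_assoc (Θ p) (E p), h.dual' hp, Matrix.one_mul]
  simp only [riemannLow, h.riemann_eq hp, ← h1, Finset.mul_sum]
  rw [Finset.sum_comm]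
  refine Finset.sum_congr rfl fun c _ => ?_
  rw [Finset.sum_comm]
  exact Finset.sum_congr rfl fun d _ => Finset.sum_congr rfl fun m _ => by ring

theorem scalarCurvature_eq (h : IsFrame U g Θ E G w) (hp : p ∈ U) :
    scalarCurvature g p = ((G p)⁻¹ * (frameRicci E w p).transpose).trace := by
  have hinv : (g p)⁻¹ = E p * (G p)⁻¹ * (E p).transpose := by
    apply Matrix.inv_eq_right_inv
    have h1 : (Θ p).transpose * (E p).transpose = 1 := by
      rw [← Matrix.transpose_mul, h.dual p hp, Matrix.transpose_one]
    calc g p * (E p * (G p)⁻¹ * (E p).transpose)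
        = (Θ p).transpose * (G p * ((Θ p * E p) * (G p)⁻¹)) * (E p).transpose := by
          rw [h.metric p hp]; simp only [Matrix.mul_assoc]
      _ = 1 := by
          rw [h.dual' hp, Matrix.one_mul, Matrix.mul_nonsing_inv _ (h.det p hp), Matrix.mul_one, h1]
  have h2 : scalarCurvature g p =
      ((g p)⁻¹ * ((Θ p).transpose * frameRicci E w p * Θ p).transpose).trace := by
    simp only [scalarCurvature, h.ricci_eq hp, Matrix.trace, Matrix.diag, Matrix.mul_apply,
      Matrix.transpose_apply (_ * _)]
  have h3 : (E p).transpose * (Θ p).transpose = 1 := by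
    rw [← Matrix.transpose_mul, h.dual' hp, Matrix.transpose_one]
  rw [h2, hinv]
  simp only [Matrix.transpose_mul, Matrix.transpose_transpose]
  calc _ = (E p * ((G p)⁻¹ * (((E p).transpose * (Θ p).transpose)
        * ((frameRicci E w p).transpose * Θ p)))).trace := by simp only [Matrix.mul_assoc]
    _ = _ := by
      rw [h3, Matrix.one_mul, Matrix.trace_mul_comm]
      simp only [Matrix.mul_assoc, h.dual' hp, Matrix.mul_one]

/-- The Weyl tensor contracted with vectors given by their frame components. -/
theorem weylC_frameVec (h : IsFrame U g Θ E G w) (hp : p ∈ U) (α β γ δ : Fin 4 → ℂ) :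
    weylC g p (frameVec (E p) α) (frameVec (E p) β) (frameVec (E p) γ) (frameVec (E p) δ) =
      ∑ c, ∑ d, γ c * δ d * bilinC (G p * frameRiem E w c d p) α β
      - (1 / 2) * (bilinC (G p) α γ * bilinC (frameRicci E w p) β δ
        - bilinC (G p) α δ * bilinC (frameRicci E w p) β γ
        - bilinC (G p) β γ * bilinC (frameRicci E w p) α δ
        + bilinC (G p) β δ * bilinC (frameRicci E w p) α γ)
      + scalarCurvature g p / 6 * (bilinC (G p) α γ * bilinC (G p) β δ
        - bilinC (G p) α δ * bilinC (G p) β γ) := by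
  have hΘE := h.dual' hp
  have hr : (Matrix.of fun i j => ricci g i j p) = (Θ p).transpose * frameRicci E w p * Θ p := by
    ext i j
    exact h.ricci_eq hp i j
  have hR : ∀ a b c d : Fin 4 → ℂ,
      ∑ i, ∑ j, ∑ k, ∑ l, (riemannLow g i j k l p : ℂ) * a i * b j * c k * d l =
      ∑ e, ∑ f, (∑ k, (Θ p e k : ℂ) * c k) * (∑ l, (Θ p f l : ℂ) * d l) *
        bilinC ((Θ p).transpose * (G p * frameRiem E w e f p) * Θ p) a b := by
    intro a b c d
    have h1 : ∀ e f, (∑ k, (Θ p e k : ℂ) * c k) * (∑ l, (Θ p f l : ℂ) * d l) *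
        bilinC ((Θ p).transpose * (G p * frameRiem E w e f p) * Θ p) a b =
        ∑ i, ∑ j, ∑ k, ∑ l, ((Θ p e k * Θ p f l *
        ((Θ p).transpose * (G p * frameRiem E w e f p) * Θ p) i j : ℝ) : ℂ)
          * a i * b j * c k * d l := by
      intro e f
      rw [mul_comm, bilinC, Finset.sum_mul]
      refine Finset.sum_congr rfl fun i _ => ?_
      rw [Finset.sum_mul]
      refine Finset.sum_congr rfl fun j _ => ?_
      rw [Finset.sum_mul_sum, Finset.mul_sum]
      refine Finset.sum_congr rfl fun k _ => ?_
      rw [Finset.mul_sum]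
      refine Finset.sum_congr rfl fun l _ => ?_
      push_cast
      ring
    rw [Finset.sum_congr rfl fun e _ => Finset.sum_congr rfl fun f _ => h1 e f]
    simp only [h.riemannLow_eq hp, Complex.ofReal_sum, Finset.sum_mul]
    -- The two frame summations are pulled past the four coordinate summations, one at a time.
    have comm6 : ∀ X : Fin 4 → Fin 4 → Fin 4 → Fin 4 → Fin 4 → Fin 4 → ℂ,
        ∑ i, ∑ j, ∑ k, ∑ l, ∑ e, ∑ f, X i j k l e f =
        ∑ e, ∑ f, ∑ i, ∑ j, ∑ k, ∑ l, X i j k l e f := by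
      intro X
      have c3 : ∀ Y : Fin 4 → Fin 4 → Fin 4 → ℂ, ∑ k, ∑ l, ∑ e, Y k l e =
          ∑ e, ∑ k, ∑ l, Y k l e := fun Y =>
        (Finset.sum_congr rfl fun _ _ => Finset.sum_comm).trans Finset.sum_comm
      have c4 : ∀ Y : Fin 4 → Fin 4 → Fin 4 → Fin 4 → ℂ, ∑ j, ∑ k, ∑ l, ∑ e, Y j k l e =
          ∑ e, ∑ j, ∑ k, ∑ l, Y j k l e := fun Y =>
        (Finset.sum_congr rfl fun _ _ => c3 _).trans Finset.sum_comm
      have c5 : ∀ Y : Fin 4 → Fin 4 → Fin 4 → Fin 4 → Fin 4 → ℂ,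
          ∑ i, ∑ j, ∑ k, ∑ l, ∑ e, Y i j k l e = ∑ e, ∑ i, ∑ j, ∑ k, ∑ l, Y i j k l e := fun Y =>
        (Finset.sum_congr rfl fun _ _ => c4 _).trans Finset.sum_comm
      rw [c5 fun i j k l e => ∑ f, X i j k l e f]
      exact Finset.sum_congr rfl fun e _ => c5 _
    exact comm6 _
  rw [weylC_eq, hr, h.metric p hp, hR]
  simp only [bilinC_frameVec hΘE, sum_mul_frameVec hΘE]

end IsFrame

/-! ### Functions of the coordinates `y` and `r` -/

/-- `f` has a derivative at `p`, with partial derivatives `(0, a, 0, b)`. -/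
def HasPD (f : Pt → ℝ) (a b : ℝ) (p : Pt) : Prop :=
  HasFDerivAt f (a • (ContinuousLinearMap.proj 1 : Pt →L[ℝ] ℝ)
    + b • (ContinuousLinearMap.proj 3 : Pt →L[ℝ] ℝ)) p

theorem hasPD_const (r : ℝ) (p : Pt) : HasPD (fun _ => r) 0 0 p := by
  simpa [HasPD] using hasFDerivAt_const r p

theorem hasPD_y {φ : ℝ → ℝ} {φ' : ℝ} {p : Pt} (h : HasDerivAt φ φ' (p 1)) :
    HasPD (fun x => φ (x 1)) φ' 0 p := by
  have := h.comp_hasFDerivAt p (ContinuousLinearMap.proj 1 : Pt →L[ℝ] ℝ).hasFDerivAt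
  exact HasFDerivAt.congr_fderiv this (by simp)

theorem hasPD_r {φ : ℝ → ℝ} {φ' : ℝ} {p : Pt} (h : HasDerivAt φ φ' (p 3)) :
    HasPD (fun x => φ (x 3)) 0 φ' p := by
  have := h.comp_hasFDerivAt p (ContinuousLinearMap.proj 3 : Pt →L[ℝ] ℝ).hasFDerivAt
  exact HasFDerivAt.congr_fderiv this (by simp)

namespace HasPD

variable {f g : Pt → ℝ} {a b a' b' : ℝ} {p : Pt}

theorem congr (h : HasPD f a b p) (ha : a' = a) (hb : b' = b) : HasPD f a' b' p := by
  rwa [ha, hb]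

theorem add (hf : HasPD f a b p) (hg : HasPD g a' b' p) :
    HasPD (fun x => f x + g x) (a + a') (b + b') p := by
  refine HasFDerivAt.congr_fderiv (HasFDerivAt.fun_add hf hg) (ContinuousLinearMap.ext fun v => ?_)
  simp
  ring

theorem sub (hf : HasPD f a b p) (hg : HasPD g a' b' p) :
    HasPD (fun x => f x - g x) (a - a') (b - b') p := by
  refine HasFDerivAt.congr_fderiv (HasFDerivAt.fun_sub hf hg) (ContinuousLinearMap.ext fun v => ?_)
  simp
  ring

theorem neg (hf : HasPD f a b p) : HasPD (fun x => -f x) (-a) (-b) p := by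
  refine HasFDerivAt.congr_fderiv (HasFDerivAt.fun_neg hf) (ContinuousLinearMap.ext fun v => ?_)
  simp
  ring

theorem mul (hf : HasPD f a b p) (hg : HasPD g a' b' p) :
    HasPD (fun x => f x * g x) (a * g p + f p * a') (b * g p + f p * b') p := by
  refine HasFDerivAt.congr_fderiv (HasFDerivAt.fun_mul hf hg) (ContinuousLinearMap.ext fun v => ?_)
  simp
  ring

theorem div_const (hf : HasPD f a b p) (r : ℝ) : HasPD (fun x => f x / r) (a / r) (b / r) p := by
  simp only [div_eq_mul_inv]
  exact (hf.mul (hasPD_const r⁻¹ p)).congr (by ring) (by ring)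

theorem pow (hf : HasPD f a b p) (n : ℕ) :
    HasPD (fun x => f x ^ n) (n * f p ^ (n - 1) * a) (n * f p ^ (n - 1) * b) p := by
  refine HasFDerivAt.congr_fderiv (HasFDerivAt.pow hf n) (ContinuousLinearMap.ext fun v => ?_)
  simp
  ring

theorem pd_x (h : HasPD f a b p) : pd 0 f p = 0 := by simp [HasFDerivAt.pd_eq h]
theorem pd_y (h : HasPD f a b p) : pd 1 f p = a := by simp [HasFDerivAt.pd_eq h]
theorem pd_u (h : HasPD f a b p) : pd 2 f p = 0 := by simp [HasFDerivAt.pd_eq h]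
theorem pd_r (h : HasPD f a b p) : pd 3 f p = b := by simp [HasFDerivAt.pd_eq h]

end HasPD

/-- `tan (r / 2)` -/
def tanHalf (p : Pt) : ℝ := Real.tan (p 3 / 2)

/-- `cos² (r / 2)` -/
def cosSq (p : Pt) : ℝ := Real.cos (p 3 / 2) ^ 2

section

variable {p : Pt}

/-- The only relation between `cosSq` and `tanHalf` used in the curvature computation, in the form
`… = 0` so that every later trigonometric identity is a polynomial identity plus a multiple of it.
-/
theorem cosSq_mul (hc : Real.cos (p 3 / 2) ≠ 0) : cosSq p * (1 + tanHalf p ^ 2) - 1 = 0 := by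
  rw [cosSq, tanHalf, Real.tan_eq_sin_div_cos]
  have := Real.sin_sq_add_cos_sq (p 3 / 2)
  field_simp
  linarith

theorem hasPD_tanHalf (hc : Real.cos (p 3 / 2) ≠ 0) :
    HasPD tanHalf 0 (1 / 2 * (1 + tanHalf p ^ 2)) p := by
  have h : HasDerivAt (fun r : ℝ => Real.tan (r / 2)) _ (p 3) :=
    (Real.hasDerivAt_tan hc).comp (h := fun r => r / 2) (p 3) ((hasDerivAt_id' (p 3)).div_const 2)
  refine (hasPD_r h).congr rfl ?_
  rw [tanHalf, Real.tan_eq_sin_div_cos]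
  have := Real.sin_sq_add_cos_sq (p 3 / 2)
  field_simp
  linarith

theorem hasPD_cosSq (_hc : Real.cos (p 3 / 2) ≠ 0) : HasPD cosSq 0 (-(cosSq p * tanHalf p)) p := by
  have h : HasDerivAt (fun r : ℝ => Real.cos (r / 2) ^ 2) _ (p 3) :=
    ((Real.hasDerivAt_cos _).comp (p 3) ((hasDerivAt_id' (p 3)).div_const 2)).pow 2
  refine (hasPD_r h).congr rfl ?_
  rw [tanHalf, cosSq, Real.tan_eq_sin_div_cos]
  field_simp
  simp
  ring

theorem isOpen_tubeDomain {J : Set ℝ} (hJ : IsOpen J) : IsOpen (tubeDomain J) :=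
  (hJ.preimage (continuous_apply 1)).inter (isOpen_Ioo.preimage (continuous_apply 3))

theorem cos_half_pos {J : Set ℝ} (hp : p ∈ tubeDomain J) : 0 < Real.cos (p 3 / 2) :=
  Real.cos_pos_of_mem_Ioo ⟨by linarith [hp.2.1], by linarith [hp.2.2]⟩

theorem contDiffOn_tanHalf (J : Set ℝ) : ContDiffOn ℝ ∞ tanHalf (tubeDomain J) := fun p hp =>
  ((Real.contDiffAt_tan.2 (cos_half_pos hp).ne').comp p (by fun_prop)).contDiffWithinAt

theorem contDiff_cosSq : ContDiff ℝ ∞ cosSq := by unfold cosSq; fun_prop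

theorem contDiffOn_comp_y {J : Set ℝ} {φ : ℝ → ℝ} (h : ContDiffOn ℝ ∞ φ J) :
    ContDiffOn ℝ ∞ (fun p : Pt => φ (p 1)) (tubeDomain J) :=
  h.comp (by fun_prop) fun _ hp => hp.1

end

/-- Functions of `y` that determine the lift: `f = F_y`, `L = 2 / F_yy`, `π = |F_yy| q²`,
`ν = F_yy / q⁴`, the logarithmic derivatives `m` of `F_yy` and `l` of `q`, and derivatives of the
latter two. -/
structure TubeJets where
  /-- The range of `y`. -/
  J : Set ℝ
  /-- The cosmological constant. -/
  Λ : ℝ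
  /-- `F_y` -/
  f : ℝ → ℝ
  /-- `2 / F_yy` -/
  L : ℝ → ℝ
  /-- `|F_yy| q²` -/
  π : ℝ → ℝ
  /-- `F_yy / q⁴` -/
  ν : ℝ → ℝ
  /-- The logarithmic derivative of `F_yy`. -/
  m : ℝ → ℝ
  /-- The derivative of `m`. -/
  m1 : ℝ → ℝ
  /-- The derivative of `m1`. -/
  m2 : ℝ → ℝ
  /-- The logarithmic derivative of `q`. -/
  l : ℝ → ℝ
  /-- The derivative of `l`. -/
  l1 : ℝ → ℝ
  /-- The derivative of `l1`. -/
  l2 : ℝ → ℝ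
  isOpen_J : IsOpen J
  smooth_f : ContDiffOn ℝ ∞ f J
  smooth_L : ContDiffOn ℝ ∞ L J
  smooth_π : ContDiffOn ℝ ∞ π J
  smooth_ν : ContDiffOn ℝ ∞ ν J
  smooth_m : ContDiffOn ℝ ∞ m J
  smooth_m1 : ContDiffOn ℝ ∞ m1 J
  smooth_m2 : ContDiffOn ℝ ∞ m2 J
  smooth_l : ContDiffOn ℝ ∞ l J
  smooth_l1 : ContDiffOn ℝ ∞ l1 J
  smooth_l2 : ContDiffOn ℝ ∞ l2 J
  L_ne : ∀ y ∈ J, L y ≠ 0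
  π_pos : ∀ y ∈ J, 0 < π y
  ν_ne : ∀ y ∈ J, ν y ≠ 0
  deriv_f : ∀ y ∈ J, HasDerivAt f (2 / L y) y
  deriv_L : ∀ y ∈ J, HasDerivAt L (-(m y * L y)) y
  deriv_π : ∀ y ∈ J, HasDerivAt π ((m y + 2 * l y) * π y) y
  deriv_ν : ∀ y ∈ J, HasDerivAt ν ((m y - 4 * l y) * ν y) y
  deriv_m : ∀ y ∈ J, HasDerivAt m (m1 y) y
  deriv_m1 : ∀ y ∈ J, HasDerivAt m1 (m2 y) y
  deriv_l : ∀ y ∈ J, HasDerivAt l (l1 y) y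
  deriv_l1 : ∀ y ∈ J, HasDerivAt l1 (l2 y) y

/-! ### Coefficients of the metric and of the connection, with their partial derivatives -/

namespace TubeJets

variable (D : TubeJets)

/-- `Λ |F_yy| q²` -/
def k (y : ℝ) : ℝ := D.Λ * D.π y

/-- `Re W` -/
def a (p : Pt) : ℝ :=
  2 * D.l (p 1) * cosSq p

/-- `Im W` -/
def b (p : Pt) : ℝ :=
  (-2) * D.l (p 1) * cosSq p * tanHalf p

/-- A component of the connection forms. -/
def e (p : Pt) : ℝ :=
  2 * D.l (p 1) * cosSq p + D.m (p 1) / 2 - D.l (p 1)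

/-- The function `H`. -/
def H (p : Pt) : ℝ :=
  (32 / 3 * D.k (p 1) - D.l1 (p 1) + D.m1 (p 1) / 2) * cosSq p + 8 / 3 * D.k (p 1) - D.ν (p 1) / 8
    * cosSq p ^ 2 * tanHalf p

/-- A component of the connection forms. -/
def X (p : Pt) : ℝ :=
  (-16) / 3 * D.k (p 1) * cosSq p * tanHalf p - 4 / 3 * D.k (p 1) * tanHalf p + D.ν (p 1) / 16 *
    (cosSq p - cosSq p ^ 2) + (D.l1 (p 1) / 2 - D.m1 (p 1) / 4) * cosSq p * tanHalf p

/-- A component of the connection forms. -/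
def Y (p : Pt) : ℝ :=
  (-16) / 3 * D.k (p 1) * cosSq p - 4 / 3 * D.k (p 1) + D.ν (p 1) / 16 * cosSq p ^ 2 * tanHalf p +
    (2 * D.l (p 1) ^ 2 + 3 / 2 * D.l1 (p 1) - D.m1 (p 1) / 4) * cosSq p

/-- A component of the connection forms. -/
def Z0 (p : Pt) : ℝ :=
  16 / 3 * D.k (p 1) * D.l (p 1) * cosSq p * tanHalf p + D.ν (p 1) * D.l (p 1) * (cosSq p ^ 2 / 8 -
    cosSq p ^ 3 / 4)

/-- A component of the connection forms. -/
def Z1 (p : Pt) : ℝ :=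
  (-80) / 3 * D.k (p 1) * D.l (p 1) * cosSq p - D.ν (p 1) * D.l (p 1) / 4 * cosSq p ^ 3 * tanHalf p
    + (D.m (p 1) * D.m1 (p 1) / 4 - D.m (p 1) * D.l1 (p 1) / 2 - D.m1 (p 1) * D.l (p 1) / 2 - D.m2
    (p 1) / 4 + D.l (p 1) * D.l1 (p 1) + D.l2 (p 1) / 2) * cosSq p

/-- A component of the connection forms. -/
def S (p : Pt) : ℝ :=
  (-8) / 3 * D.k (p 1) * tanHalf p + D.ν (p 1) * (cosSq p ^ 2 / 8 - cosSq p / 16)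

/-- A component of the connection forms. -/
def Q (p : Pt) : ℝ :=
  (-32) / 3 * D.k (p 1) * cosSq p * tanHalf p + D.ν (p 1) * (3 / 16 * cosSq p - cosSq p ^ 2 / 4) +
    (D.l1 (p 1) - D.m1 (p 1) / 2) * cosSq p * tanHalf p

/-- The square of the conformal factor `P`. -/
def P2 (p : Pt) : ℝ :=
  4 * D.π (p 1) * (1 + tanHalf p ^ 2)

section derivatives

variable {D} {p : Pt}

theorem deriv_k (hp : p 1 ∈ D.J) : HasDerivAt D.k ((D.m (p 1) + 2 * D.l (p 1)) * D.k (p 1))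
    (p 1) := by
  have := (D.deriv_π _ hp).const_mul D.Λ
  refine this.congr_deriv ?_
  simp only [k]
  ring

/-- The derivatives of `m2` and `l2` occur only in the `y`-derivative of `Z1`, which enters none of
the curvature components evaluated later; mere differentiability suffices. -/
theorem deriv_m2 (hp : p 1 ∈ D.J) : HasDerivAt D.m2 (deriv D.m2 (p 1)) (p 1) :=
  ((D.smooth_m2.differentiableOn (by simp)).differentiableAt (D.isOpen_J.mem_nhds hp)).hasDerivAt

theorem deriv_l2 (hp : p 1 ∈ D.J) : HasDerivAt D.l2 (deriv D.l2 (p 1)) (p 1) :=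
  ((D.smooth_l2.differentiableOn (by simp)).differentiableAt (D.isOpen_J.mem_nhds hp)).hasDerivAt

theorem hasPD_a (hp : p 1 ∈ D.J) (hc : Real.cos (p 3 / 2) ≠ 0) : HasPD D.a
    (2 * D.l1 (p 1) * cosSq p)
    (-2 * D.l (p 1) * cosSq p * tanHalf p) p := by
  have hl := hasPD_y (D.deriv_l _ hp)
  have hC := hasPD_cosSq hc
  refine HasPD.congr
    (((hasPD_const (2) p).mul hl).mul hC)
    ?_ ?_
  · ring
  · ring

theorem hasPD_b (hp : p 1 ∈ D.J) (hc : Real.cos (p 3 / 2) ≠ 0) : HasPD D.b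
    (-2 * D.l1 (p 1) * cosSq p * tanHalf p)
    (-2 * D.l (p 1) * cosSq p + D.l (p 1)) p := by
  have hl := hasPD_y (D.deriv_l _ hp)
  have hC := hasPD_cosSq hc
  have hT := hasPD_tanHalf hc
  refine HasPD.congr
    ((((hasPD_const (-2) p).mul hl).mul hC).mul hT)
    ?_ ?_
  · ring
  -- The `r`-derivative of `tanHalf` contributes a factor `1 + tanHalf²`, which is absorbed against
  -- `cosSq`. The coefficient is the corresponding cofactor; the other derivatives below are
  -- normalized in the same way.
  · linear_combination (-D.l (p 1)) * cosSq_mul hc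

theorem hasPD_e (hp : p 1 ∈ D.J) (hc : Real.cos (p 3 / 2) ≠ 0) : HasPD D.e
    (1 / 2 * D.m1 (p 1) + 2 * D.l1 (p 1) * cosSq p - D.l1 (p 1))
    (-2 * D.l (p 1) * cosSq p * tanHalf p) p := by
  have hm := hasPD_y (D.deriv_m _ hp)
  have hl := hasPD_y (D.deriv_l _ hp)
  have hC := hasPD_cosSq hc
  refine HasPD.congr
    (((((hasPD_const (2) p).mul hl).mul hC).add (hm.div_const 2)).sub hl)
    ?_ ?_
  · ring
  · ring

theorem hasPD_H (hp : p 1 ∈ D.J) (hc : Real.cos (p 3 / 2) ≠ 0) : HasPD D.H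
    (32 / 3 * D.k (p 1) * D.m (p 1) * cosSq p + 8 / 3 * D.k (p 1) * D.m (p 1) + 64 / 3 * D.k (p 1)
      * D.l (p 1) * cosSq p + 16 / 3 * D.k (p 1) * D.l (p 1) - 1 / 8 * D.ν (p 1) * D.m (p 1) *
      cosSq p ^ 2 * tanHalf p + 1 / 2 * D.ν (p 1) * D.l (p 1) * cosSq p ^ 2 * tanHalf p + 1 / 2 *
      D.m2 (p 1) * cosSq p - D.l2 (p 1) * cosSq p)
    (-32 / 3 * D.k (p 1) * cosSq p * tanHalf p - 1 / 4 * D.ν (p 1) * cosSq p ^ 2 + 3 / 16 * D.ν (p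
      1) * cosSq p - 1 / 2 * D.m1 (p 1) * cosSq p * tanHalf p + D.l1 (p 1) * cosSq p * tanHalf p) p
      := by
  have hk := hasPD_y (deriv_k hp)
  have hnu := hasPD_y (D.deriv_ν _ hp)
  have hm1 := hasPD_y (D.deriv_m1 _ hp)
  have hl1 := hasPD_y (D.deriv_l1 _ hp)
  have hC := hasPD_cosSq hc
  have hT := hasPD_tanHalf hc
  refine HasPD.congr
    (((((((hasPD_const (32/3) p).mul hk).sub hl1).add (hm1.div_const 2)).mul hC).add ((hasPD_const
      (8/3) p).mul hk)).sub (((hnu.div_const 8).mul (hC.pow 2)).mul hT))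
    ?_ ?_
  · ring
  · linear_combination (-3 / 16 * D.ν (p 1) * cosSq p) * cosSq_mul hc

theorem hasPD_X (hp : p 1 ∈ D.J) (hc : Real.cos (p 3 / 2) ≠ 0) : HasPD D.X
    (-16 / 3 * D.k (p 1) * D.m (p 1) * cosSq p * tanHalf p - 4 / 3 * D.k (p 1) * D.m (p 1) *
      tanHalf p - 32 / 3 * D.k (p 1) * D.l (p 1) * cosSq p * tanHalf p - 8 / 3 * D.k (p 1) * D.l (p
      1) * tanHalf p - 1 / 16 * D.ν (p 1) * D.m (p 1) * cosSq p ^ 2 + 1 / 16 * D.ν (p 1) * D.m (p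
      1) * cosSq p + 1 / 4 * D.ν (p 1) * D.l (p 1) * cosSq p ^ 2 - 1 / 4 * D.ν (p 1) * D.l (p 1) *
      cosSq p - 1 / 4 * D.m2 (p 1) * cosSq p * tanHalf p + 1 / 2 * D.l2 (p 1) * cosSq p * tanHalf
      p)
    (-16 / 3 * D.k (p 1) * cosSq p - 2 / 3 * D.k (p 1) * tanHalf p ^ 2 + 2 * D.k (p 1) + 1 / 8 *
      D.ν (p 1) * cosSq p ^ 2 * tanHalf p - 1 / 16 * D.ν (p 1) * cosSq p * tanHalf p - 1 / 4 * D.m1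
      (p 1) * cosSq p + 1 / 8 * D.m1 (p 1) + 1 / 2 * D.l1 (p 1) * cosSq p - 1 / 4 * D.l1 (p 1)) p
      := by
  have hk := hasPD_y (deriv_k hp)
  have hnu := hasPD_y (D.deriv_ν _ hp)
  have hm1 := hasPD_y (D.deriv_m1 _ hp)
  have hl1 := hasPD_y (D.deriv_l1 _ hp)
  have hC := hasPD_cosSq hc
  have hT := hasPD_tanHalf hc
  refine HasPD.congr
    (((((((hasPD_const (-16/3) p).mul hk).mul hC).mul hT).sub (((hasPD_const (4/3) p).mul hk).mul
      hT)).add ((hnu.div_const 16).mul (hC.sub (hC.pow 2)))).add ((((hl1.div_const 2).sub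
      (hm1.div_const 4)).mul hC).mul hT))
    ?_ ?_
  · ring
  · linear_combination (-8 / 3 * D.k (p 1) - 1 / 8 * D.m1 (p 1) + 1 / 4 * D.l1 (p 1)) * cosSq_mul
      hc

theorem hasPD_Y (hp : p 1 ∈ D.J) (hc : Real.cos (p 3 / 2) ≠ 0) : HasPD D.Y
    (-16 / 3 * D.k (p 1) * D.m (p 1) * cosSq p - 4 / 3 * D.k (p 1) * D.m (p 1) - 32 / 3 * D.k (p 1)
      * D.l (p 1) * cosSq p - 8 / 3 * D.k (p 1) * D.l (p 1) + 1 / 16 * D.ν (p 1) * D.m (p 1) *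
      cosSq p ^ 2 * tanHalf p - 1 / 4 * D.ν (p 1) * D.l (p 1) * cosSq p ^ 2 * tanHalf p - 1 / 4 *
      D.m2 (p 1) * cosSq p + 4 * D.l (p 1) * D.l1 (p 1) * cosSq p + 3 / 2 * D.l2 (p 1) * cosSq p)
    (16 / 3 * D.k (p 1) * cosSq p * tanHalf p + 1 / 8 * D.ν (p 1) * cosSq p ^ 2 - 3 / 32 * D.ν (p
      1) * cosSq p + 1 / 4 * D.m1 (p 1) * cosSq p * tanHalf p - 2 * D.l (p 1) ^ 2 * cosSq p *
      tanHalf p - 3 / 2 * D.l1 (p 1) * cosSq p * tanHalf p) p := by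
  have hk := hasPD_y (deriv_k hp)
  have hnu := hasPD_y (D.deriv_ν _ hp)
  have hm1 := hasPD_y (D.deriv_m1 _ hp)
  have hl := hasPD_y (D.deriv_l _ hp)
  have hl1 := hasPD_y (D.deriv_l1 _ hp)
  have hC := hasPD_cosSq hc
  have hT := hasPD_tanHalf hc
  refine HasPD.congr
    ((((((hasPD_const (-16/3) p).mul hk).mul hC).sub ((hasPD_const (4/3) p).mul hk)).add
      (((hnu.div_const 16).mul (hC.pow 2)).mul hT)).add (((((hasPD_const (2) p).mul (hl.pow 2)).add
      ((hasPD_const (3/2) p).mul hl1)).sub (hm1.div_const 4)).mul hC))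
    ?_ ?_
  · ring
  · linear_combination (3 / 32 * D.ν (p 1) * cosSq p) * cosSq_mul hc

theorem hasPD_Z0 (hp : p 1 ∈ D.J) (hc : Real.cos (p 3 / 2) ≠ 0) : HasPD D.Z0
    (16 / 3 * D.k (p 1) * D.m (p 1) * D.l (p 1) * cosSq p * tanHalf p + 32 / 3 * D.k (p 1) * D.l (p
      1) ^ 2 * cosSq p * tanHalf p + 16 / 3 * D.k (p 1) * D.l1 (p 1) * cosSq p * tanHalf p - 1 / 4
      * D.ν (p 1) * D.m (p 1) * D.l (p 1) * cosSq p ^ 3 + 1 / 8 * D.ν (p 1) * D.m (p 1) * D.l (p 1)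
      * cosSq p ^ 2 + D.ν (p 1) * D.l (p 1) ^ 2 * cosSq p ^ 3 - 1 / 2 * D.ν (p 1) * D.l (p 1) ^ 2 *
      cosSq p ^ 2 - 1 / 4 * D.ν (p 1) * D.l1 (p 1) * cosSq p ^ 3 + 1 / 8 * D.ν (p 1) * D.l1 (p 1) *
      cosSq p ^ 2)
    (16 / 3 * D.k (p 1) * D.l (p 1) * cosSq p - 8 / 3 * D.k (p 1) * D.l (p 1) + 3 / 4 * D.ν (p 1) *
      D.l (p 1) * cosSq p ^ 3 * tanHalf p - 1 / 4 * D.ν (p 1) * D.l (p 1) * cosSq p ^ 2 * tanHalf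
      p) p := by
  have hk := hasPD_y (deriv_k hp)
  have hnu := hasPD_y (D.deriv_ν _ hp)
  have hl := hasPD_y (D.deriv_l _ hp)
  have hC := hasPD_cosSq hc
  have hT := hasPD_tanHalf hc
  refine HasPD.congr
    ((((((hasPD_const (16/3) p).mul hk).mul hl).mul hC).mul hT).add ((hnu.mul hl).mul (((hC.pow
      2).div_const 8).sub ((hC.pow 3).div_const 4))))
    ?_ ?_
  · ring
  · linear_combination (8 / 3 * D.k (p 1) * D.l (p 1)) * cosSq_mul hc

theorem hasPD_Z1 (hp : p 1 ∈ D.J) (hc : Real.cos (p 3 / 2) ≠ 0) : HasPD D.Z1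
    (-80 / 3 * D.k (p 1) * D.m (p 1) * D.l (p 1) * cosSq p - 160 / 3 * D.k (p 1) * D.l (p 1) ^ 2 *
      cosSq p - 80 / 3 * D.k (p 1) * D.l1 (p 1) * cosSq p - 1 / 4 * D.ν (p 1) * D.m (p 1) * D.l (p
      1) * cosSq p ^ 3 * tanHalf p + D.ν (p 1) * D.l (p 1) ^ 2 * cosSq p ^ 3 * tanHalf p - 1 / 4 *
      D.ν (p 1) * D.l1 (p 1) * cosSq p ^ 3 * tanHalf p + 1 / 4 * D.m (p 1) * D.m2 (p 1) * cosSq p -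
      1 / 2 * D.m (p 1) * D.l2 (p 1) * cosSq p + 1 / 4 * D.m1 (p 1) ^ 2 * cosSq p - D.m1 (p 1) *
      D.l1 (p 1) * cosSq p - 1 / 2 * D.m2 (p 1) * D.l (p 1) * cosSq p - 1 / 4 * deriv D.m2 (p 1) *
      cosSq p + D.l (p 1) * D.l2 (p 1) * cosSq p + D.l1 (p 1) ^ 2 * cosSq p + 1 / 2 * deriv D.l2 (p
      1) * cosSq p)
    (80 / 3 * D.k (p 1) * D.l (p 1) * cosSq p * tanHalf p - 3 / 4 * D.ν (p 1) * D.l (p 1) * cosSq p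
      ^ 3 + 5 / 8 * D.ν (p 1) * D.l (p 1) * cosSq p ^ 2 - 1 / 4 * D.m (p 1) * D.m1 (p 1) * cosSq p
      * tanHalf p + 1 / 2 * D.m (p 1) * D.l1 (p 1) * cosSq p * tanHalf p + 1 / 2 * D.m1 (p 1) * D.l
      (p 1) * cosSq p * tanHalf p + 1 / 4 * D.m2 (p 1) * cosSq p * tanHalf p - D.l (p 1) * D.l1 (p
      1) * cosSq p * tanHalf p - 1 / 2 * D.l2 (p 1) * cosSq p * tanHalf p) p := by
  have hk := hasPD_y (deriv_k hp)
  have hnu := hasPD_y (D.deriv_ν _ hp)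
  have hm := hasPD_y (D.deriv_m _ hp)
  have hm1 := hasPD_y (D.deriv_m1 _ hp)
  have hm2 := hasPD_y (deriv_m2 hp)
  have hl := hasPD_y (D.deriv_l _ hp)
  have hl1 := hasPD_y (D.deriv_l1 _ hp)
  have hl2 := hasPD_y (deriv_l2 hp)
  have hC := hasPD_cosSq hc
  have hT := hasPD_tanHalf hc
  refine HasPD.congr
    ((((((hasPD_const (-80/3) p).mul hk).mul hl).mul hC).sub ((((hnu.mul hl).div_const 4).mul
      (hC.pow 3)).mul hT)).add ((((((((hm.mul hm1).div_const 4).sub ((hm.mul hl1).div_const 2)).sub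
      ((hm1.mul hl).div_const 2)).sub (hm2.div_const 4)).add (hl.mul hl1)).add (hl2.div_const
      2)).mul hC))
    ?_ ?_
  · ring
  · linear_combination (-5 / 8 * D.ν (p 1) * D.l (p 1) * cosSq p ^ 2) * cosSq_mul hc

theorem hasPD_S (hp : p 1 ∈ D.J) (hc : Real.cos (p 3 / 2) ≠ 0) : HasPD D.S
    (-8 / 3 * D.k (p 1) * D.m (p 1) * tanHalf p - 16 / 3 * D.k (p 1) * D.l (p 1) * tanHalf p + 1 /
      8 * D.ν (p 1) * D.m (p 1) * cosSq p ^ 2 - 1 / 16 * D.ν (p 1) * D.m (p 1) * cosSq p - 1 / 2 *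
      D.ν (p 1) * D.l (p 1) * cosSq p ^ 2 + 1 / 4 * D.ν (p 1) * D.l (p 1) * cosSq p)
    (-4 / 3 * D.k (p 1) * tanHalf p ^ 2 - 4 / 3 * D.k (p 1) - 1 / 4 * D.ν (p 1) * cosSq p ^ 2 *
      tanHalf p + 1 / 16 * D.ν (p 1) * cosSq p * tanHalf p) p := by
  have hk := hasPD_y (deriv_k hp)
  have hnu := hasPD_y (D.deriv_ν _ hp)
  have hC := hasPD_cosSq hc
  have hT := hasPD_tanHalf hc
  refine HasPD.congr
    ((((hasPD_const (-8/3) p).mul hk).mul hT).add (hnu.mul (((hC.pow 2).div_const 8).sub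
      (hC.div_const 16))))
    ?_ ?_
  · ring
  · ring

theorem hasPD_Q (hp : p 1 ∈ D.J) (hc : Real.cos (p 3 / 2) ≠ 0) : HasPD D.Q
    (-32 / 3 * D.k (p 1) * D.m (p 1) * cosSq p * tanHalf p - 64 / 3 * D.k (p 1) * D.l (p 1) * cosSq
      p * tanHalf p - 1 / 4 * D.ν (p 1) * D.m (p 1) * cosSq p ^ 2 + 3 / 16 * D.ν (p 1) * D.m (p 1)
      * cosSq p + D.ν (p 1) * D.l (p 1) * cosSq p ^ 2 - 3 / 4 * D.ν (p 1) * D.l (p 1) * cosSq p - 1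
      / 2 * D.m2 (p 1) * cosSq p * tanHalf p + D.l2 (p 1) * cosSq p * tanHalf p)
    (-32 / 3 * D.k (p 1) * cosSq p + 16 / 3 * D.k (p 1) + 1 / 2 * D.ν (p 1) * cosSq p ^ 2 * tanHalf
      p - 3 / 16 * D.ν (p 1) * cosSq p * tanHalf p - 1 / 2 * D.m1 (p 1) * cosSq p + 1 / 4 * D.m1 (p
      1) + D.l1 (p 1) * cosSq p - 1 / 2 * D.l1 (p 1)) p := by
  have hk := hasPD_y (deriv_k hp)
  have hnu := hasPD_y (D.deriv_ν _ hp)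
  have hm1 := hasPD_y (D.deriv_m1 _ hp)
  have hl1 := hasPD_y (D.deriv_l1 _ hp)
  have hC := hasPD_cosSq hc
  have hT := hasPD_tanHalf hc
  refine HasPD.congr
    ((((((hasPD_const (-32/3) p).mul hk).mul hC).mul hT).add (hnu.mul (((hasPD_const (3/16) p).mul
      hC).sub ((hC.pow 2).div_const 4)))).add (((hl1.sub (hm1.div_const 2)).mul hC).mul hT))
    ?_ ?_
  · ring
  · linear_combination (-16 / 3 * D.k (p 1) - 1 / 4 * D.m1 (p 1) + 1 / 2 * D.l1 (p 1)) * cosSq_mul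
      hc

/-- As `P²` is proportional to `1 / cos² (r/2)`, its logarithmic `r`-derivative is exactly `tan
(r/2)`, the expansion `ρ` of the shearfree field. -/
theorem hasPD_P2 (hp : p 1 ∈ D.J) (hc : Real.cos (p 3 / 2) ≠ 0) : HasPD D.P2
    ((D.m (p 1) + 2 * D.l (p 1)) * D.P2 p) (tanHalf p * D.P2 p) p := by
  have hπ := hasPD_y (D.deriv_π _ hp)
  have hT := hasPD_tanHalf hc
  refine HasPD.congr (((hasPD_const 4 p).mul hπ).mul ((hasPD_const 1 p).add (hT.pow 2))) ?_ ?_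
  · simp only [P2]; ring
  · simp only [P2]; ring

end derivatives

end TubeJets

/-! ### The coframe, its connection forms and the first structure equation -/

namespace TubeJets

variable (D : TubeJets)

/-- The coframe `dx, dy, λ, dr + W μ + W̄ μ̄ + H λ`. -/
def coframe (p : Pt) : Mat :=
  !![1, 0, 0, 0;
    0, 1, 0, 0;
    -(D.L (p 1) * D.f (p 1)), 0, D.L (p 1), 0;
    2 * D.a p + D.H p * -(D.L (p 1) * D.f (p 1)), -(2 * D.b p), D.H p * D.L (p 1), 1]

/-- The frame dual to `coframe`. -/
def frame (p : Pt) : Mat :=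
  !![1, 0, 0, 0;
    0, 1, 0, 0;
    D.f (p 1), 0, (D.L (p 1))⁻¹, 0;
    -(2 * D.a p), 2 * D.b p, -D.H p, 1]

/-- The metric in the frame. -/
def frameMetric (p : Pt) : Mat :=
  !![2 * D.P2 p, 0, 0, 0;
    0, 2 * D.P2 p, 0, 0;
    0, 0, 0, D.P2 p;
    0, 0, D.P2 p, 0]

/-- The connection forms contracted with the frame vector of index `0`. -/
def conn0 (p : Pt) : Mat :=
  !![D.b p, D.e p, D.X p, tanHalf p / 2;
    -D.e p, D.b p, -D.Y p, 1 / 2;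
    -tanHalf p, -1, 0, 0;
    -(2 * D.X p), 2 * D.Y p, 0, 2 * D.b p]

/-- The connection forms contracted with the frame vector of index `1`. -/
def conn1 (p : Pt) : Mat :=
  !![D.e p, -D.b p, D.Y p, -1 / 2;
    D.b p, D.e p, D.X p, tanHalf p / 2;
    1, -tanHalf p, D.m (p 1), 0;
    -(2 * D.Y p), -(2 * D.X p), 0, 2 * D.e p - D.m (p 1)]

/-- The connection forms contracted with the frame vector of index `2`. -/
def conn2 (p : Pt) : Mat :=
  !![D.X p, D.Y p, D.Z0 p, 0;
    -D.Y p, D.X p, D.Z1 p, 0;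
    0, 0, D.S p, 0;
    -(2 * D.Z0 p), -(2 * D.Z1 p), 0, D.Q p]

/-- The connection forms contracted with the frame vector of index `3`. -/
def conn3 (p : Pt) : Mat :=
  !![tanHalf p / 2, -1 / 2, 0, 0;
    1 / 2, tanHalf p / 2, 0, 0;
    0, 0, 0, 0;
    0, 0, 0, tanHalf p]

/-- Frame components of the connection forms. -/
def conn : Fin 4 → Pt → Mat := ![D.conn0, D.conn1, D.conn2, conn3]

theorem conn_zero : D.conn 0 = D.conn0 := rfl
theorem conn_one : D.conn 1 = D.conn1 := rfl
theorem conn_two : D.conn 2 = D.conn2 := rfl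
theorem conn_three : D.conn 3 = conn3 := rfl

/-- The metric `2 P² (μ μ̄ + λ (dr + W μ + W̄ μ̄ + H λ))`. -/
def metric (p : Pt) : Mat := (D.coframe p).transpose * D.frameMetric p * D.coframe p

variable {D} {p : Pt}

theorem smooth_comp_k : ContDiffOn ℝ ∞ (fun p : Pt => D.k (p 1)) (tubeDomain D.J) :=
  contDiffOn_const.mul (contDiffOn_comp_y D.smooth_π)

theorem smooth_fields :
    ContDiffOn ℝ ∞ D.a (tubeDomain D.J) ∧ ContDiffOn ℝ ∞ D.b (tubeDomain D.J) ∧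
    ContDiffOn ℝ ∞ D.e (tubeDomain D.J) ∧ ContDiffOn ℝ ∞ D.H (tubeDomain D.J) ∧
    ContDiffOn ℝ ∞ D.X (tubeDomain D.J) ∧ ContDiffOn ℝ ∞ D.Y (tubeDomain D.J) ∧
    ContDiffOn ℝ ∞ D.Z0 (tubeDomain D.J) ∧ ContDiffOn ℝ ∞ D.Z1 (tubeDomain D.J) ∧
    ContDiffOn ℝ ∞ D.S (tubeDomain D.J) ∧ ContDiffOn ℝ ∞ D.Q (tubeDomain D.J) ∧
    ContDiffOn ℝ ∞ D.P2 (tubeDomain D.J) := by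
  have hT := contDiffOn_tanHalf D.J
  have hC : ContDiffOn ℝ ∞ cosSq (tubeDomain D.J) := contDiff_cosSq.contDiffOn
  have hk := smooth_comp_k (D := D)
  have hπ := contDiffOn_comp_y D.smooth_π
  have hν := contDiffOn_comp_y D.smooth_ν
  have hm := contDiffOn_comp_y D.smooth_m
  have hm1 := contDiffOn_comp_y D.smooth_m1
  have hm2 := contDiffOn_comp_y D.smooth_m2
  have hl := contDiffOn_comp_y D.smooth_l
  have hl1 := contDiffOn_comp_y D.smooth_l1
  have hl2 := contDiffOn_comp_y D.smooth_l2
  refine ⟨?_, ?_, ?_, ?_, ?_, ?_, ?_, ?_, ?_, ?_, ?_⟩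
  · unfold a; fun_prop
  · unfold b; fun_prop
  · unfold e; fun_prop
  · unfold H; fun_prop
  · unfold X; fun_prop
  · unfold Y; fun_prop
  · unfold Z0; fun_prop
  · unfold Z1; fun_prop
  · unfold S; fun_prop
  · unfold Q; fun_prop
  · unfold P2; fun_prop

theorem smooth_coframe : SmoothMat D.coframe (tubeDomain D.J) := by
  obtain ⟨ha, hb, he, hH, hX, hY, hZ0, hZ1, hS, hQ, hP⟩ := smooth_fields (D := D)
  have hL := contDiffOn_comp_y D.smooth_L
  have hf := contDiffOn_comp_y D.smooth_f
  intro i j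
  fin_cases i <;> fin_cases j <;> simp [coframe] <;> fun_prop

theorem smooth_frame : SmoothMat D.frame (tubeDomain D.J) := by
  obtain ⟨ha, hb, he, hH, hX, hY, hZ0, hZ1, hS, hQ, hP⟩ := smooth_fields (D := D)
  have hL : ContDiffOn ℝ ∞ (fun p : Pt => (D.L (p 1))⁻¹) (tubeDomain D.J) :=
    (contDiffOn_comp_y D.smooth_L).inv fun p hp => D.L_ne _ hp.1
  have hf := contDiffOn_comp_y D.smooth_f
  intro i j
  fin_cases i <;> fin_cases j <;> simp [frame] <;> fun_prop

theorem smooth_frameMetric : SmoothMat D.frameMetric (tubeDomain D.J) := by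
  obtain ⟨ha, hb, he, hH, hX, hY, hZ0, hZ1, hS, hQ, hP⟩ := smooth_fields (D := D)
  intro i j
  fin_cases i <;> fin_cases j <;> simp [frameMetric] <;> fun_prop

theorem smooth_conn (c : Fin 4) : SmoothMat (D.conn c) (tubeDomain D.J) := by
  obtain ⟨ha, hb, he, hH, hX, hY, hZ0, hZ1, hS, hQ, hP⟩ := smooth_fields (D := D)
  have hT := contDiffOn_tanHalf D.J
  have hm := contDiffOn_comp_y D.smooth_m
  have h0 : SmoothMat D.conn0 (tubeDomain D.J) := by
    intro i j
    fin_cases i <;> fin_cases j <;> simp [conn0] <;> fun_prop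
  have h1 : SmoothMat D.conn1 (tubeDomain D.J) := by
    intro i j
    fin_cases i <;> fin_cases j <;> simp [conn1] <;> fun_prop
  have h2 : SmoothMat D.conn2 (tubeDomain D.J) := by
    intro i j
    fin_cases i <;> fin_cases j <;> simp [conn2] <;> fun_prop
  have h3 : SmoothMat conn3 (tubeDomain D.J) := by
    intro i j
    fin_cases i <;> fin_cases j <;> simp [conn3] <;> fun_prop
  fin_cases c
  exacts [h0, h1, h2, h3]

theorem frame_mul_coframe (hp : p 1 ∈ D.J) : D.frame p * D.coframe p = 1 := by
  have hL := D.L_ne _ hp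
  ext i j
  fin_cases i <;> fin_cases j <;>
    simp [frame, coframe, Matrix.mul_apply, Fin.sum_univ_four, hL]
  ring

theorem P2_pos (hp : p 1 ∈ D.J) : 0 < D.P2 p := by
  have := D.π_pos _ hp
  unfold P2
  positivity

theorem det_frameMetric : (D.frameMetric p).det = -(4 * D.P2 p ^ 4) := by
  simp [frameMetric, Matrix.det_succ_row_zero, Fin.sum_univ_succ, Fin.succAbove]
  ring

end TubeJets

/-- Both sides of a torsion equation are components of a 2-form, so six of the sixteen index pairs
suffice. -/
theorem eq_of_antisymm {A B : Fin 4 → Fin 4 → ℝ} (hA : ∀ k l, A k l = -A l k)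
    (hB : ∀ k l, B k l = -B l k) (h01 : A 0 1 = B 0 1) (h02 : A 0 2 = B 0 2) (h03 : A 0 3 = B 0 3)
    (h12 : A 1 2 = B 1 2) (h13 : A 1 3 = B 1 3) (h23 : A 2 3 = B 2 3) (k l : Fin 4) :
    A k l = B k l := by
  have h0 : ∀ k, A k k = B k k := fun k => by linarith [hA k k, hB k k]
  have hs : ∀ {k l}, A k l = B k l → A l k = B l k := fun {k l} h => by rw [hA, hB, h]
  fin_cases k <;> fin_cases l <;> first | exact h0 _ | assumption | (apply hs; assumption)

namespace TubeJets

variable {D : TubeJets} {p : Pt}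

/-- Cartan's first structure equation, one coframe form at a time. For the closed forms `dx` and
`dy` the connection terms cancel among themselves; for `λ` the derivatives of `L` and `F_y` enter;
only for `τ` are the derivatives of `a`, `b`, `H` and the relation `cosSq_mul` needed. -/
theorem torsion_conn (hp : p 1 ∈ D.J) (hc : Real.cos (p 3 / 2) ≠ 0) (i k l : Fin 4) :
    pd k (fun x => D.coframe x i l) p - pd l (fun x => D.coframe x i k) p =
      ∑ b, ∑ c, (D.conn c p i b *
        (D.coframe p c l * D.coframe p b k - D.coframe p c k * D.coframe p b l)) := by
  have hL := D.L_ne _ hp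
  have h20 : HasPD (fun x => D.coframe x 2 0) (D.m (p 1) * D.L (p 1) * D.f (p 1) - 2) 0 p :=
    ((hasPD_y (D.deriv_L _ hp)).mul (hasPD_y (D.deriv_f _ hp))).neg.congr
      (by field_simp; ring) (by ring)
  have h22 : HasPD (fun x => D.coframe x 2 2) (-(D.m (p 1) * D.L (p 1))) 0 p :=
    hasPD_y (D.deriv_L _ hp)
  have h30 : HasPD (fun x => D.coframe x 3 0) _ _ p :=
    ((hasPD_const 2 p).mul (hasPD_a hp hc)).add ((hasPD_H hp hc).mul h20)
  have h31 : HasPD (fun x => D.coframe x 3 1) _ _ p :=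
    ((hasPD_const 2 p).mul (hasPD_b hp hc)).neg
  have h32 : HasPD (fun x => D.coframe x 3 2) _ _ p := (hasPD_H hp hc).mul h22
  have hcs := cosSq_mul hc
  have hA : ∀ a k l, pd k (fun x => D.coframe x a l) p - pd l (fun x => D.coframe x a k) p =
      -(pd l (fun x => D.coframe x a k) p - pd k (fun x => D.coframe x a l) p) :=
    fun a k l => by ring
  have hB : ∀ a k l, ∑ b, ∑ c, (D.conn c p a b *
        (D.coframe p c l * D.coframe p b k - D.coframe p c k * D.coframe p b l)) =
      -∑ b, ∑ c, (D.conn c p a b *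
        (D.coframe p c k * D.coframe p b l - D.coframe p c l * D.coframe p b k)) := by
    intro a k l
    simp only [← Finset.sum_neg_distrib]
    exact Finset.sum_congr rfl fun b _ => Finset.sum_congr rfl fun c _ => by ring
  have hz : ∀ i : Fin 4, pd i (fun x => D.coframe x 0 0) p = 0 ∧
      pd i (fun x => D.coframe x 0 1) p = 0 ∧ pd i (fun x => D.coframe x 0 2) p = 0 ∧
      pd i (fun x => D.coframe x 0 3) p = 0 ∧ pd i (fun x => D.coframe x 1 0) p = 0 ∧
      pd i (fun x => D.coframe x 1 1) p = 0 ∧ pd i (fun x => D.coframe x 1 2) p = 0 ∧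
      pd i (fun x => D.coframe x 1 3) p = 0 ∧ pd i (fun x => D.coframe x 2 1) p = 0 ∧
      pd i (fun x => D.coframe x 2 3) p = 0 ∧ pd i (fun x => D.coframe x 3 3) p = 0 := fun i =>
    ⟨pd_const i 1 p, pd_const i 0 p, pd_const i 0 p, pd_const i 0 p, pd_const i 0 p,
      pd_const i 1 p, pd_const i 0 p, pd_const i 0 p, pd_const i 0 p, pd_const i 0 p,
      pd_const i 1 p⟩
  have r0 : ∀ k l, pd k (fun x => D.coframe x 0 l) p - pd l (fun x => D.coframe x 0 k) p =
      ∑ b, ∑ c, (D.conn c p 0 b *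
        (D.coframe p c l * D.coframe p b k - D.coframe p c k * D.coframe p b l)) := by
    refine eq_of_antisymm (hA 0) (hB 0) ?_ ?_ ?_ ?_ ?_ ?_
    all_goals simp only [hz, Fin.sum_univ_four, conn_zero, conn_one, conn_two, conn_three]
    all_goals simp [conn0, conn1, conn2, conn3, coframe]
    all_goals try ring
  have r1 : ∀ k l, pd k (fun x => D.coframe x 1 l) p - pd l (fun x => D.coframe x 1 k) p =
      ∑ b, ∑ c, (D.conn c p 1 b *
        (D.coframe p c l * D.coframe p b k - D.coframe p c k * D.coframe p b l)) := by
    refine eq_of_antisymm (hA 1) (hB 1) ?_ ?_ ?_ ?_ ?_ ?_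
    all_goals simp only [hz, Fin.sum_univ_four, conn_zero, conn_one, conn_two, conn_three]
    all_goals simp [conn0, conn1, conn2, conn3, coframe]
    all_goals try ring
  have r2 : ∀ k l, pd k (fun x => D.coframe x 2 l) p - pd l (fun x => D.coframe x 2 k) p =
      ∑ b, ∑ c, (D.conn c p 2 b *
        (D.coframe p c l * D.coframe p b k - D.coframe p c k * D.coframe p b l)) := by
    refine eq_of_antisymm (hA 2) (hB 2) ?_ ?_ ?_ ?_ ?_ ?_
    all_goals simp only [hz, h20.pd_y, h20.pd_u, h20.pd_r, h22.pd_x, h22.pd_y, h22.pd_r,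
        Fin.sum_univ_four, conn_zero, conn_one, conn_two, conn_three]
    all_goals simp [conn0, conn1, conn2, conn3, coframe]
    all_goals first | ring1 | exact Or.inr (by ring1)
  have r3 : ∀ k l, pd k (fun x => D.coframe x 3 l) p - pd l (fun x => D.coframe x 3 k) p =
      ∑ b, ∑ c, (D.conn c p 3 b *
        (D.coframe p c l * D.coframe p b k - D.coframe p c k * D.coframe p b l)) := by
    refine eq_of_antisymm (hA 3) (hB 3) ?_ ?_ ?_ ?_ ?_ ?_
    all_goals
      simp only [hz, h30.pd_y, h30.pd_u, h30.pd_r, h31.pd_x, h31.pd_u, h31.pd_r,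
        h32.pd_x, h32.pd_y, h32.pd_r, Fin.sum_univ_four, conn_zero, conn_one,
        conn_two, conn_three]
      simp [conn0, conn1, conn2, conn3, coframe, a, b, e, H, X, Y, Z0, Z1, S, Q]
    · linear_combination (128 / 3 * D.k (p 1) * D.l (p 1) * D.L (p 1) * D.f (p 1) * cosSq p + 2
        * D.m1 (p 1) * D.l (p 1) * D.L (p 1) * D.f (p 1) * cosSq p - 16 * D.l (p 1) ^ 2 * cosSq p
            - 4 * D.l (p 1) * D.l1 (p 1) * D.L (p 1) * D.f (p 1) * cosSq p) * hcs
    · linear_combination (1 / 2 * D.ν (p 1) * D.l (p 1) * D.L (p 1) * cosSq p ^ 2) * hcs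
    · ring
    · linear_combination (128 / 3 * D.k (p 1) * D.l (p 1) * D.L (p 1) * cosSq p + 2 * D.m1 (p 1)
        * D.l (p 1) * D.L (p 1) * cosSq p - 4 * D.l (p 1) * D.l1 (p 1) * D.L (p 1) * cosSq p) * hcs
    · ring
    · exact Or.inl (by ring1)
  fin_cases i
  exacts [r0 k l, r1 k l, r2 k l, r3 k l]

end TubeJets

/-! ### Compatibility with the metric -/

namespace TubeJets

variable {D : TubeJets} {p : Pt}

/-- The frame metric is a function times a constant matrix `η`, so each `w c` must be an
infinitesimal similitude of `η`: a skew part plus a scaling. The vector on the right lists twice the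
scaling weights. -/
theorem frameMetric_mul_conn (c : Fin 4) :
    D.frameMetric p * D.conn c p + (D.conn c p).transpose * D.frameMetric p =
      ![2 * D.b p, 2 * D.e p, 2 * D.X p, tanHalf p] c • D.frameMetric p := by
  have h0 : D.frameMetric p * D.conn0 p + (D.conn0 p).transpose * D.frameMetric p =
      (2 * D.b p) • D.frameMetric p := by
    ext i j
    fin_cases i <;> fin_cases j <;>
      simp [frameMetric, conn0, Matrix.mul_apply, Fin.sum_univ_four] <;> ring1
  have h1 : D.frameMetric p * D.conn1 p + (D.conn1 p).transpose * D.frameMetric p =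
      (2 * D.e p) • D.frameMetric p := by
    ext i j
    fin_cases i <;> fin_cases j <;>
      simp [frameMetric, conn1, Matrix.mul_apply, Fin.sum_univ_four] <;> ring1
  -- The entries `S` and `Q` scale the null pair `λ, τ`; their sum has to be twice the weight `X`.
  have hSQ : D.Q p = 2 * D.X p - D.S p := by
    unfold Q X S
    ring
  have h2 : D.frameMetric p * D.conn2 p + (D.conn2 p).transpose * D.frameMetric p =
      (2 * D.X p) • D.frameMetric p := by
    ext i j
    fin_cases i <;> fin_cases j <;>
      simp [frameMetric, conn2, Matrix.mul_apply, Fin.sum_univ_four, hSQ] <;> ring1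
  have h3 : D.frameMetric p * conn3 p + (conn3 p).transpose * D.frameMetric p =
      tanHalf p • D.frameMetric p := by
    ext i j
    fin_cases i <;> fin_cases j <;>
      simp [frameMetric, conn3, Matrix.mul_apply, Fin.sum_univ_four] <;> ring1
  fin_cases c
  exacts [h0, h1, h2, h3]

theorem pdM_frameMetric (hp : p 1 ∈ D.J) (hc : Real.cos (p 3 / 2) ≠ 0) (k : Fin 4) :
    pdM k D.frameMetric p = (pd k D.P2 p / D.P2 p) • D.frameMetric p := by
  have hP := (P2_pos hp).ne'
  have h2 : pd k (fun x => 2 * D.P2 x) p = 2 * pd k D.P2 p := by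
    rw [pd_mul (by fun_prop) (hasPD_P2 hp hc).differentiableAt, pd_const]
    ring
  have h0 : pd k (fun _ => (0 : ℝ)) p = 0 := pd_const k 0 p
  ext i j
  fin_cases i <;> fin_cases j <;>
    simp [pdM, frameMetric, h2, h0] <;> field_simp

/-- Expands `d log P²` in the coframe. Its components are the weights of `frameMetric_mul_conn`,
which is precisely compatibility with the metric. -/
theorem pd_P2 (hp : p 1 ∈ D.J) (hc : Real.cos (p 3 / 2) ≠ 0) (k : Fin 4) :
    pd k D.P2 p = (∑ c, D.coframe p c k * ![2 * D.b p, 2 * D.e p, 2 * D.X p, tanHalf p] c)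
      * D.P2 p := by
  have h := hasPD_P2 hp hc
  have hcs := cosSq_mul hc
  have h0 : pd 0 D.P2 p = (∑ c, D.coframe p c 0
      * ![2 * D.b p, 2 * D.e p, 2 * D.X p, tanHalf p] c) * D.P2 p := by
    rw [h.pd_x]
    simp [Fin.sum_univ_four, coframe, a, b, H, X, P2, -zero_eq_mul]
    linear_combination (-1 / 2 * D.ν (p 1) * D.π (p 1) * D.L (p 1) * D.f (p 1) * cosSq p
        * tanHalf p ^ 2 - 1 / 2 * D.ν (p 1) * D.π (p 1) * D.L (p 1) * D.f (p 1) * cosSq p) * hcs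
  have h1 : pd 1 D.P2 p = (∑ c, D.coframe p c 1
      * ![2 * D.b p, 2 * D.e p, 2 * D.X p, tanHalf p] c) * D.P2 p := by
    rw [h.pd_y]
    simp [Fin.sum_univ_four, coframe, b, e, P2, -mul_eq_mul_right_iff]
    linear_combination (-16 * D.π (p 1) * D.l (p 1) * tanHalf p ^ 2 - 16 * D.π (p 1) * D.l (p 1))
        * hcs
  have h2 : pd 2 D.P2 p = (∑ c, D.coframe p c 2
      * ![2 * D.b p, 2 * D.e p, 2 * D.X p, tanHalf p] c) * D.P2 p := by
    rw [h.pd_u]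
    simp [Fin.sum_univ_four, coframe, H, X, P2, -zero_eq_mul]
    linear_combination (1 / 2 * D.ν (p 1) * D.π (p 1) * D.L (p 1) * cosSq p * tanHalf p ^ 2
        + 1 / 2 * D.ν (p 1) * D.π (p 1) * D.L (p 1) * cosSq p) * hcs
  have h3 : pd 3 D.P2 p = (∑ c, D.coframe p c 3
      * ![2 * D.b p, 2 * D.e p, 2 * D.X p, tanHalf p] c) * D.P2 p := by
    rw [h.pd_r]
    simp [Fin.sum_univ_four, coframe]
  fin_cases k
  exacts [h0, h1, h2, h3]

/-- Any `g` agreeing with `D.metric` on the domain is allowed, because the half-angle form of the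
actual lift is valid only where `cos (r/2)` is nonzero. -/
theorem isFrame {D : TubeJets} {g : Pt → Mat} (hg : EqOn g D.metric (tubeDomain D.J)) :
    IsFrame (tubeDomain D.J) g D.coframe D.frame D.frameMetric D.conn where
  isOpen := isOpen_tubeDomain D.isOpen_J
  smooth_Θ := smooth_coframe
  smooth_E := smooth_frame
  smooth_G := smooth_frameMetric
  smooth_w := smooth_conn
  dual _ hp := frame_mul_coframe hp.1
  metric _ hp := hg hp
  symm p _ := by
    ext i j
    fin_cases i <;> fin_cases j <;> simp [frameMetric]
  det p hp := by
    rw [det_frameMetric, isUnit_iff_ne_zero]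
    have := P2_pos (D := D) hp.1
    have : 0 < 4 * D.P2 p ^ 4 := by positivity
    linarith
  torsion _ hp := torsion_conn hp.1 (cos_half_pos hp).ne'
  compat p hp k := by
    have hP := (P2_pos (D := D) hp.1).ne'
    simp only [frameMetric_mul_conn, smul_smul, ← Finset.sum_smul]
    rw [pdM_frameMetric hp.1 (cos_half_pos hp).ne', pd_P2 hp.1 (cos_half_pos hp).ne',
      mul_div_cancel_right₀ _ hP]

end TubeJets

/-! ### Derivatives of the connection forms along the frame -/

namespace TubeJets

variable {D : TubeJets} {p : Pt}

theorem pd_neg {f : Pt → ℝ} (k : Fin 4) : pd k (fun x => -f x) p = -pd k f p := by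
  simp only [pd]
  exact deriv.fun_neg

theorem pd_const_mul {f : Pt → ℝ} (r : ℝ) (k : Fin 4) :
    pd k (fun x => r * f x) p = r * pd k f p := by
  simp only [pd]
  exact deriv_const_mul_field r

theorem pd_div_const {f : Pt → ℝ} (r : ℝ) (k : Fin 4) :
    pd k (fun x => f x / r) p = pd k f p / r := by
  simp only [pd]
  exact deriv_div_const _

theorem pdM_conn0 (k : Fin 4) : pdM k D.conn0 p =
    !![pd k D.b p, pd k D.e p, pd k D.X p, pd k tanHalf p / 2;
      -pd k D.e p, pd k D.b p, -pd k D.Y p, 0;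
      -pd k tanHalf p, 0, 0, 0;
      -(2 * pd k D.X p), 2 * pd k D.Y p, 0, 2 * pd k D.b p] := by
  ext i j
  fin_cases i <;> fin_cases j
  all_goals simp only [pdM, conn0]
  exacts [rfl, rfl, rfl, pd_div_const 2 k, pd_neg k, rfl, pd_neg k, pd_const k _ p, pd_neg k,
    pd_const k _ p, pd_const k _ p, pd_const k _ p, (pd_neg k).trans (congrArg _
        (pd_const_mul 2 k)),
    pd_const_mul 2 k, pd_const k _ p, pd_const_mul 2 k]

theorem pdM_conn1 (hp : p 1 ∈ D.J) (hc : Real.cos (p 3 / 2) ≠ 0) (k : Fin 4) : pdM k D.conn1 p =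
    !![pd k D.e p, -pd k D.b p, pd k D.Y p, 0;
      pd k D.b p, pd k D.e p, pd k D.X p, pd k tanHalf p / 2;
      0, -pd k tanHalf p, pd k (fun x => D.m (x 1)) p, 0;
      -(2 * pd k D.Y p), -(2 * pd k D.X p), 0,
        2 * pd k D.e p - pd k (fun x => D.m (x 1)) p] := by
  have hm := hasPD_y (D.deriv_m _ hp)
  have he : pd k (fun x => 2 * D.e x - D.m (x 1)) p
      = 2 * pd k D.e p - pd k (fun x => D.m (x 1)) p := by
    have he' := (hasPD_e hp hc).differentiableAt
    have h : (fun x => 2 * D.e x - D.m (x 1)) = fun x => 2 * D.e x + -D.m (x 1) := by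
      funext x
      ring
    rw [h, pd_add (g := fun x => -D.m (x 1)) (he'.const_mul 2) hm.differentiableAt.neg,
        pd_const_mul, pd_neg]
    ring
  ext i j
  fin_cases i <;> fin_cases j
  all_goals simp only [pdM, conn1]
  exacts [rfl, pd_neg k, rfl, pd_const k _ p, rfl, rfl, rfl, pd_div_const 2 k, pd_const k _ p,
    pd_neg k, rfl, pd_const k _ p, (pd_neg k).trans (congrArg _ (pd_const_mul 2 k)),
    (pd_neg k).trans (congrArg _ (pd_const_mul 2 k)), pd_const k _ p, he]

theorem pdM_conn2 (k : Fin 4) : pdM k D.conn2 p =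
    !![pd k D.X p, pd k D.Y p, pd k D.Z0 p, 0;
      -pd k D.Y p, pd k D.X p, pd k D.Z1 p, 0;
      0, 0, pd k D.S p, 0;
      -(2 * pd k D.Z0 p), -(2 * pd k D.Z1 p), 0, pd k D.Q p] := by
  ext i j
  fin_cases i <;> fin_cases j
  all_goals simp only [pdM, conn2]
  exacts [rfl, rfl, rfl, pd_const k _ p, pd_neg k, rfl, rfl, pd_const k _ p, pd_const k _ p,
    pd_const k _ p, rfl, pd_const k _ p, (pd_neg k).trans (congrArg _ (pd_const_mul 2 k)),
    (pd_neg k).trans (congrArg _ (pd_const_mul 2 k)), pd_const k _ p, rfl]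

theorem pdM_conn3 (k : Fin 4) : pdM k conn3 p =
    !![pd k tanHalf p / 2, 0, 0, 0;
      0, pd k tanHalf p / 2, 0, 0;
      0, 0, 0, 0;
      0, 0, 0, pd k tanHalf p] := by
  ext i j
  fin_cases i <;> fin_cases j
  all_goals simp only [pdM, conn3]
  exacts [pd_div_const 2 k, pd_const k _ p, pd_const k _ p, pd_const k _ p, pd_const k _ p,
    pd_div_const 2 k, pd_const k _ p, pd_const k _ p, pd_const k _ p, pd_const k _ p,
    pd_const k _ p, pd_const k _ p, pd_const k _ p, pd_const k _ p, pd_const k _ p, rfl]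

/-- The derivative of a function along a frame vector. -/
def dirD (D : TubeJets) (c : Fin 4) (φ : Pt → ℝ) (p : Pt) : ℝ := ∑ k, D.frame p k c * pd k φ p

/-- The frame vectors are `∂x + F_y ∂u - 2a ∂r`, `∂y + 2b ∂r`, `L⁻¹ ∂u - H ∂r` and `∂r`; on
functions of `y` and `r` alone the `∂x` and `∂u` parts drop out. -/
theorem _root_.Shearfree.HasPD.dirD_zero {φ : Pt → ℝ} {y r : ℝ} (h : HasPD φ y r p) :
    D.dirD 0 φ p = -(2 * D.a p * r) := by
  simp [dirD, Fin.sum_univ_four, frame, h.pd_x, h.pd_y, h.pd_u, h.pd_r]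

theorem _root_.Shearfree.HasPD.dirD_one {φ : Pt → ℝ} {y r : ℝ} (h : HasPD φ y r p) :
    D.dirD 1 φ p = y + 2 * D.b p * r := by
  simp [dirD, Fin.sum_univ_four, frame, h.pd_x, h.pd_y, h.pd_u, h.pd_r]

theorem _root_.Shearfree.HasPD.dirD_two {φ : Pt → ℝ} {y r : ℝ} (h : HasPD φ y r p) :
    D.dirD 2 φ p = -(D.H p * r) := by
  simp [dirD, Fin.sum_univ_four, frame, h.pd_x, h.pd_y, h.pd_u, h.pd_r]

theorem _root_.Shearfree.HasPD.dirD_three {φ : Pt → ℝ} {y r : ℝ} (h : HasPD φ y r p) :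
    D.dirD 3 φ p = r := by
  simp [dirD, Fin.sum_univ_four, frame, h.pd_x, h.pd_y, h.pd_u, h.pd_r]

theorem frameD_conn0 (c : Fin 4) : frameD D.frame c D.conn0 p =
    !![D.dirD c D.b p, D.dirD c D.e p, D.dirD c D.X p, D.dirD c tanHalf p / 2;
      -D.dirD c D.e p, D.dirD c D.b p, -D.dirD c D.Y p, 0;
      -D.dirD c tanHalf p, 0, 0, 0;
      -(2 * D.dirD c D.X p), 2 * D.dirD c D.Y p, 0, 2 * D.dirD c D.b p] := by
  ext i j
  fin_cases i <;> fin_cases j <;>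
    simp [frameD, pdM_conn0, dirD, Fin.sum_univ_four] <;> ring1

theorem frameD_conn1 (hp : p 1 ∈ D.J) (hc : Real.cos (p 3 / 2) ≠ 0) (c : Fin 4) :
    frameD D.frame c D.conn1 p =
    !![D.dirD c D.e p, -D.dirD c D.b p, D.dirD c D.Y p, 0;
      D.dirD c D.b p, D.dirD c D.e p, D.dirD c D.X p, D.dirD c tanHalf p / 2;
      0, -D.dirD c tanHalf p, D.dirD c (fun x => D.m (x 1)) p, 0;
      -(2 * D.dirD c D.Y p), -(2 * D.dirD c D.X p), 0,
        2 * D.dirD c D.e p - D.dirD c (fun x => D.m (x 1)) p] := by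
  ext i j
  fin_cases i <;> fin_cases j <;>
    simp [frameD, pdM_conn1 hp hc, dirD, Fin.sum_univ_four] <;> ring1

theorem frameD_conn2 (c : Fin 4) : frameD D.frame c D.conn2 p =
    !![D.dirD c D.X p, D.dirD c D.Y p, D.dirD c D.Z0 p, 0;
      -D.dirD c D.Y p, D.dirD c D.X p, D.dirD c D.Z1 p, 0;
      0, 0, D.dirD c D.S p, 0;
      -(2 * D.dirD c D.Z0 p), -(2 * D.dirD c D.Z1 p), 0, D.dirD c D.Q p] := by
  ext i j
  fin_cases i <;> fin_cases j <;>
    simp [frameD, pdM_conn2, dirD, Fin.sum_univ_four] <;> ring1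

theorem frameD_conn3 (c : Fin 4) : frameD D.frame c conn3 p =
    !![D.dirD c tanHalf p / 2, 0, 0, 0;
      0, D.dirD c tanHalf p / 2, 0, 0;
      0, 0, 0, 0;
      0, 0, 0, D.dirD c tanHalf p] := by
  ext i j
  fin_cases i <;> fin_cases j <;>
    simp [frameD, pdM_conn3, dirD, Fin.sum_univ_four] <;> ring1

/-- The left-hand side minus the right-hand side of the equation for `q`, divided by `q`. -/
def ode (D : TubeJets) (y : ℝ) : ℝ := D.l1 y + D.l y ^ 2 - D.m1 y / 4 - 16 / 3 * D.k y

/-- The derivative of `ode`. -/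
def ode1 (D : TubeJets) (y : ℝ) : ℝ :=
  D.l2 y + 2 * D.l y * D.l1 y - D.m2 y / 4 - 16 / 3 * ((D.m y + 2 * D.l y) * D.k y)

end TubeJets

/-! ### Frame components of the Ricci tensor, without assuming the ODE -/

namespace TubeJets

variable {D : TubeJets} {p : Pt}

/-- The first summand is `Λ` times the frame metric, the second a multiple of the ODE defect; the
remaining components have the same structure. In each proof the curvature is expanded, the few
directional derivatives that occur are inserted, and the difference is a multiple of `cosSq_mul`.
Transposed components are computed separately rather than by symmetry. -/
theorem frameRicci_0_0 (hp : p 1 ∈ D.J) (hc : Real.cos (p 3 / 2) ≠ 0) :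
    frameRicci D.frame D.conn p 0 0 = 8 * D.k (p 1) * (1 + tanHalf p ^ 2) + 4 * cosSq p * D.ode
        (p 1) := by
  have hcs := cosSq_mul hc
  simp only [frameRicci, frameRiem, Matrix.of_apply, Fin.sum_univ_four, Matrix.add_apply,
      Matrix.sub_apply, Matrix.mul_apply, Matrix.smul_apply, conn_zero, conn_one, conn_two,
      conn_three, frameD_conn0, frameD_conn1 hp hc, frameD_conn2, frameD_conn3]
  simp only [(hasPD_b hp hc).dirD_zero, (hasPD_e hp hc).dirD_one, (hasPD_tanHalf hc).dirD_two,
      (hasPD_X hp hc).dirD_three, conn0, conn1, conn2, conn3, Matrix.of_apply, Matrix.cons_val]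
  simp only [smul_eq_mul, a, b, e, H, X, Y, Z0, S, ode]
  linear_combination (16 * D.k (p 1) - 1 / 16 * D.ν (p 1) * cosSq p * tanHalf p + 3 / 4 * D.m1
      (p 1) - 8 * D.l (p 1) ^ 2 * cosSq p - 3 / 2 * D.l1 (p 1)) * hcs

theorem frameRicci_0_1 (hp : p 1 ∈ D.J) (hc : Real.cos (p 3 / 2) ≠ 0) :
    frameRicci D.frame D.conn p 0 1 = 0 := by
  have hcs := cosSq_mul hc
  simp only [frameRicci, frameRiem, Matrix.of_apply, Fin.sum_univ_four, Matrix.add_apply,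
      Matrix.sub_apply, Matrix.mul_apply, Matrix.smul_apply, conn_zero, conn_one, conn_two,
      conn_three, frameD_conn0, frameD_conn1 hp hc, frameD_conn2, frameD_conn3]
  simp only [(hasPD_e hp hc).dirD_zero, (hasPD_b hp hc).dirD_one, (hasPD_Y hp hc).dirD_three,
      conn0, conn1, conn2, conn3, Matrix.of_apply, Matrix.cons_val]
  simp only [smul_eq_mul, a, b, e, X, Y, Z0, Z1, S]
  linear_combination (-1 / 4 * D.ν (p 1) * cosSq p) * hcs

theorem frameRicci_0_2 (hp : p 1 ∈ D.J) (hc : Real.cos (p 3 / 2) ≠ 0) :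
    frameRicci D.frame D.conn p 0 2 = 8 * cosSq p ^ 2 * D.l (p 1) * D.ode (p 1) - 2 * cosSq p *
        (D.ode1 (p 1) - D.m (p 1) * D.ode (p 1) + 4 * D.l (p 1) * D.ode (p 1)) := by
  have hcs := cosSq_mul hc
  simp only [frameRicci, frameRiem, Matrix.of_apply, Fin.sum_univ_four, Matrix.add_apply,
      Matrix.sub_apply, Matrix.mul_apply, Matrix.smul_apply, conn_zero, conn_one, conn_two,
      conn_three, frameD_conn0, frameD_conn1 hp hc, frameD_conn2, frameD_conn3]
  simp only [(hasPD_X hp hc).dirD_zero, (hasPD_Y hp hc).dirD_one, (hasPD_b hp hc).dirD_two,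
      (hasPD_Z0 hp hc).dirD_three, conn0, conn1, conn2, conn3, Matrix.of_apply, Matrix.cons_val]
  simp only [smul_eq_mul, a, b, e, H, X, Y, Z0, Z1, S, Q, ode, ode1]
  linear_combination (64 / 3 * D.k (p 1) * D.l (p 1) * cosSq p - 40 / 3 * D.k (p 1) * D.l (p 1) +
      D.m1 (p 1) * D.l (p 1) * cosSq p - 8 * D.l (p 1) ^ 3 * cosSq p - 6 * D.l (p 1) * D.l1 (p 1) *
      cosSq p) * hcs

theorem frameRicci_0_3 (hp : p 1 ∈ D.J) (hc : Real.cos (p 3 / 2) ≠ 0) :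
    frameRicci D.frame D.conn p 0 3 = 0 := by
  have hcs := cosSq_mul hc
  simp only [frameRicci, frameRiem, Matrix.of_apply, Fin.sum_univ_four, Matrix.add_apply,
      Matrix.sub_apply, Matrix.mul_apply, Matrix.smul_apply, conn_zero, conn_one, conn_two,
      conn_three, frameD_conn0, frameD_conn1 hp hc, frameD_conn2, frameD_conn3]
  simp only [(hasPD_tanHalf hc).dirD_zero, (hasPD_b hp hc).dirD_three, conn0, conn1, conn2, conn3,
      Matrix.of_apply, Matrix.cons_val]
  simp only [smul_eq_mul, a, b, e, X, Y, Z0, S, Q]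
  linear_combination (D.l (p 1)) * hcs

theorem frameRicci_1_0 (hp : p 1 ∈ D.J) (hc : Real.cos (p 3 / 2) ≠ 0) :
    frameRicci D.frame D.conn p 1 0 = 0 := by
  have hcs := cosSq_mul hc
  simp only [frameRicci, frameRiem, Matrix.of_apply, Fin.sum_univ_four, Matrix.add_apply,
      Matrix.sub_apply, Matrix.mul_apply, Matrix.smul_apply, conn_zero, conn_one, conn_two,
      conn_three, frameD_conn0, frameD_conn1 hp hc, frameD_conn2, frameD_conn3]
  simp only [(hasPD_e hp hc).dirD_zero, (hasPD_b hp hc).dirD_one, (hasPD_Y hp hc).dirD_three,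
      conn0, conn1, conn2, conn3, Matrix.of_apply, Matrix.cons_val]
  simp only [smul_eq_mul, a, b, e, X, Y, Z0, Z1, S]
  linear_combination (1 / 4 * D.ν (p 1) * cosSq p) * hcs

theorem frameRicci_1_1 (hp : p 1 ∈ D.J) (hc : Real.cos (p 3 / 2) ≠ 0) :
    frameRicci D.frame D.conn p 1 1 = 8 * D.k (p 1) * (1 + tanHalf p ^ 2) + 4 * cosSq p * D.ode
        (p 1) := by
  have hcs := cosSq_mul hc
  simp only [frameRicci, frameRiem, Matrix.of_apply, Fin.sum_univ_four, Matrix.add_apply,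
      Matrix.sub_apply, Matrix.mul_apply, Matrix.smul_apply, conn_zero, conn_one, conn_two,
      conn_three, frameD_conn0, frameD_conn1 hp hc, frameD_conn2, frameD_conn3]
  simp only [(hasPD_b hp hc).dirD_zero, (hasPD_e hp hc).dirD_one, (hasPD_tanHalf hc).dirD_two,
      (hasPD_X hp hc).dirD_three, conn0, conn1, conn2, conn3, Matrix.of_apply, Matrix.cons_val]
  simp only [smul_eq_mul, a, b, e, H, X, Y, Z1, S, ode]
  linear_combination (16 * D.k (p 1) - 1 / 16 * D.ν (p 1) * cosSq p * tanHalf p + 3 / 4 * D.m1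
      (p 1) - 8 * D.l (p 1) ^ 2 * cosSq p - 3 / 2 * D.l1 (p 1)) * hcs

theorem frameRicci_1_2 (hp : p 1 ∈ D.J) (hc : Real.cos (p 3 / 2) ≠ 0) :
    frameRicci D.frame D.conn p 1 2 = 8 * cosSq p ^ 2 * tanHalf p * D.l (p 1) * D.ode (p 1) := by
  have hcs := cosSq_mul hc
  simp only [frameRicci, frameRiem, Matrix.of_apply, Fin.sum_univ_four, Matrix.add_apply,
      Matrix.sub_apply, Matrix.mul_apply, Matrix.smul_apply, conn_zero, conn_one, conn_two,
      conn_three, frameD_conn0, frameD_conn1 hp hc, frameD_conn2, frameD_conn3]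
  simp only [(hasPD_Y hp hc).dirD_zero, (hasPD_X hp hc).dirD_one, (hasPD_e hp hc).dirD_two,
      (hasPD_Z1 hp hc).dirD_three, conn0, conn1, conn2, conn3, Matrix.of_apply, Matrix.cons_val]
  simp only [smul_eq_mul, a, b, e, H, X, Y, Z0, Z1, S, Q, ode]
  linear_combination (8 / 3 * D.k (p 1) * D.l (p 1) * tanHalf p + 3 / 4 * D.ν (p 1) * D.l (p 1) *
      cosSq p ^ 2 + 1 / 4 * D.ν (p 1) * D.l (p 1) * cosSq p) * hcs

theorem frameRicci_1_3 (hp : p 1 ∈ D.J) (hc : Real.cos (p 3 / 2) ≠ 0) :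
    frameRicci D.frame D.conn p 1 3 = 0 := by
  have hcs := cosSq_mul hc
  simp only [frameRicci, frameRiem, Matrix.of_apply, Fin.sum_univ_four, Matrix.add_apply,
      Matrix.sub_apply, Matrix.mul_apply, Matrix.smul_apply, conn_zero, conn_one, conn_two,
      conn_three, frameD_conn0, frameD_conn1 hp hc, frameD_conn2, frameD_conn3]
  simp only [(hasPD_tanHalf hc).dirD_one, (hasPD_e hp hc).dirD_three, conn0, conn1, conn2, conn3,
      Matrix.of_apply, Matrix.cons_val]
  simp only [smul_eq_mul, b, e, X, Y, Z1, S, Q]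
  linear_combination (-D.l (p 1) * tanHalf p) * hcs

theorem frameRicci_2_0 (hp : p 1 ∈ D.J) (hc : Real.cos (p 3 / 2) ≠ 0) :
    frameRicci D.frame D.conn p 2 0 = 8 * cosSq p ^ 2 * D.l (p 1) * D.ode (p 1) - 2 * cosSq p *
        (D.ode1 (p 1) - D.m (p 1) * D.ode (p 1) + 4 * D.l (p 1) * D.ode (p 1)) := by
  have hcs := cosSq_mul hc
  simp only [frameRicci, frameRiem, Matrix.of_apply, Fin.sum_univ_four, Matrix.add_apply,
      Matrix.sub_apply, Matrix.mul_apply, Matrix.smul_apply, conn_zero, conn_one, conn_two,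
      conn_three, frameD_conn0, frameD_conn1 hp hc, frameD_conn2, frameD_conn3]
  simp only [(hasPD_S hp hc).dirD_zero, (hasPD_X hp hc).dirD_zero, (hasPD_Y hp hc).dirD_one, conn0,
      conn1, conn2, conn3, Matrix.of_apply, Matrix.cons_val]
  simp only [smul_eq_mul, a, b, e, X, Y, Z0, Z1, S, ode, ode1]
  linear_combination (64 / 3 * D.k (p 1) * D.l (p 1) * cosSq p - 8 / 3 * D.k (p 1) * D.l (p 1) +
      D.m1 (p 1) * D.l (p 1) * cosSq p - 8 * D.l (p 1) ^ 3 * cosSq p - 6 * D.l (p 1) * D.l1 (p 1) *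
      cosSq p) * hcs

theorem frameRicci_2_1 (hp : p 1 ∈ D.J) (hc : Real.cos (p 3 / 2) ≠ 0) :
    frameRicci D.frame D.conn p 2 1 = 8 * cosSq p ^ 2 * tanHalf p * D.l (p 1) * D.ode (p 1) := by
  have hcs := cosSq_mul hc
  simp only [frameRicci, frameRiem, Matrix.of_apply, Fin.sum_univ_four, Matrix.add_apply,
      Matrix.sub_apply, Matrix.mul_apply, Matrix.smul_apply, conn_zero, conn_one, conn_two,
      conn_three, frameD_conn0, frameD_conn1 hp hc, frameD_conn2, frameD_conn3]
  simp only [(hasPD_Y hp hc).dirD_zero, (hasPD_S hp hc).dirD_one, (hasPD_X hp hc).dirD_one,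
      (hasPD_y (D.deriv_m _ hp)).dirD_two, conn0, conn1, conn2, conn3, Matrix.of_apply,
      Matrix.cons_val]
  simp only [smul_eq_mul, a, b, e, H, X, Y, Z0, Z1, S, ode]
  linear_combination (-8 * D.k (p 1) * D.l (p 1) * tanHalf p - 3 / 4 * D.ν (p 1) * D.l (p 1) *
      cosSq p ^ 2) * hcs

theorem frameRicci_2_3 (hp : p 1 ∈ D.J) (hc : Real.cos (p 3 / 2) ≠ 0) :
    frameRicci D.frame D.conn p 2 3 = 4 * D.k (p 1) * (1 + tanHalf p ^ 2) - 2 * cosSq p * D.ode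
        (p 1) := by
  have hcs := cosSq_mul hc
  simp only [frameRicci, frameRiem, Matrix.of_apply, Fin.sum_univ_four, Matrix.add_apply,
      Matrix.sub_apply, Matrix.mul_apply, Matrix.smul_apply, conn_zero, conn_one, conn_two,
      conn_three, frameD_conn0, frameD_conn1 hp hc, frameD_conn2, frameD_conn3]
  simp only [(hasPD_S hp hc).dirD_three, (hasPD_X hp hc).dirD_three, conn0, conn1, conn2, conn3,
      Matrix.of_apply, Matrix.cons_val]
  simp only [smul_eq_mul, b, e, X, Y, Z0, Z1, S, Q, ode]
  linear_combination (16 / 3 * D.k (p 1) + 1 / 4 * D.m1 (p 1) - 1 / 2 * D.l1 (p 1)) * hcs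

theorem frameRicci_3_0 (hp : p 1 ∈ D.J) (hc : Real.cos (p 3 / 2) ≠ 0) :
    frameRicci D.frame D.conn p 3 0 = 0 := by
  have hcs := cosSq_mul hc
  simp only [frameRicci, frameRiem, Matrix.of_apply, Fin.sum_univ_four, Matrix.add_apply,
      Matrix.sub_apply, Matrix.mul_apply, Matrix.smul_apply, conn_zero, conn_one, conn_two,
      conn_three, frameD_conn0, frameD_conn1 hp hc, frameD_conn2, frameD_conn3]
  simp only [(hasPD_tanHalf hc).dirD_zero, (hasPD_b hp hc).dirD_three, conn0, conn1, conn2, conn3,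
      Matrix.of_apply, Matrix.cons_val]
  simp only [smul_eq_mul, a, b, e, X, Y, Z0, S, Q]
  linear_combination (-3 * D.l (p 1)) * hcs

theorem frameRicci_3_1 (hp : p 1 ∈ D.J) (hc : Real.cos (p 3 / 2) ≠ 0) :
    frameRicci D.frame D.conn p 3 1 = 0 := by
  have hcs := cosSq_mul hc
  simp only [frameRicci, frameRiem, Matrix.of_apply, Fin.sum_univ_four, Matrix.add_apply,
      Matrix.sub_apply, Matrix.mul_apply, Matrix.smul_apply, conn_zero, conn_one, conn_two,
      conn_three, frameD_conn0, frameD_conn1 hp hc, frameD_conn2, frameD_conn3]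
  simp only [(hasPD_tanHalf hc).dirD_one, (hasPD_e hp hc).dirD_three, (hasPD_y (D.deriv_m _
      hp)).dirD_three, conn0, conn1, conn2, conn3, Matrix.of_apply, Matrix.cons_val]
  simp only [smul_eq_mul, b, e, X, Y, Z1, S, Q]
  linear_combination (3 * D.l (p 1) * tanHalf p) * hcs

theorem frameRicci_3_2 (hp : p 1 ∈ D.J) (hc : Real.cos (p 3 / 2) ≠ 0) :
    frameRicci D.frame D.conn p 3 2 = 4 * D.k (p 1) * (1 + tanHalf p ^ 2) - 2 * cosSq p * D.ode
        (p 1) := by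
  have hcs := cosSq_mul hc
  simp only [frameRicci, frameRiem, Matrix.of_apply, Fin.sum_univ_four, Matrix.add_apply,
      Matrix.sub_apply, Matrix.mul_apply, Matrix.smul_apply, conn_zero, conn_one, conn_two,
      conn_three, frameD_conn0, frameD_conn1 hp hc, frameD_conn2, frameD_conn3]
  simp only [(hasPD_tanHalf hc).dirD_two, (hasPD_Q hp hc).dirD_three, conn0, conn1, conn2, conn3,
      Matrix.of_apply, Matrix.cons_val]
  simp only [smul_eq_mul, b, e, H, X, Y, Z0, Z1, S, Q, ode]
  linear_combination (-16 / 3 * D.k (p 1) - 1 / 8 * D.ν (p 1) * cosSq p * tanHalf p - 1 / 4 * D.m1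
      (p 1) + 1 / 2 * D.l1 (p 1)) * hcs

theorem frameRicci_3_3 (hp : p 1 ∈ D.J) (hc : Real.cos (p 3 / 2) ≠ 0) :
    frameRicci D.frame D.conn p 3 3 = 0 := by
  have hcs := cosSq_mul hc
  simp only [frameRicci, frameRiem, Matrix.of_apply, Fin.sum_univ_four, Matrix.add_apply,
      Matrix.sub_apply, Matrix.mul_apply, Matrix.smul_apply, conn_zero, conn_one, conn_two,
      conn_three, frameD_conn0, frameD_conn1 hp hc, frameD_conn2, frameD_conn3]
  simp only [(hasPD_tanHalf hc).dirD_three, conn0, conn1, conn2, conn3, Matrix.of_apply,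
      Matrix.cons_val]
  simp only [smul_eq_mul, b, e, X, S, Q]
  linear_combination (0) * hcs

end TubeJets

/-! ### Curvature components for the Weyl scalars, and the field equation -/

namespace TubeJets

variable {D : TubeJets} {p : Pt}

/-- Lowering an index with the frame metric pairs `k = e_3` with row `2`, so only row `2` of the
curvature matrices is relevant to `Ψ₀`, `Ψ₁`, `Ψ₂`. This entry and the next five are those entering
`Ψ₀` and `Ψ₁`; they vanish whether or not the ODE holds. -/
theorem frameRiem_3_0_2_0 (hc : Real.cos (p 3 / 2) ≠ 0) :
    frameRiem D.frame D.conn 3 0 p 2 0 = 0 := by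
  have hcs := cosSq_mul hc
  simp only [frameRiem, Fin.sum_univ_four, Matrix.add_apply, Matrix.sub_apply, Matrix.mul_apply,
      Matrix.smul_apply, conn_zero, conn_one, conn_two, conn_three, frameD_conn0, frameD_conn3]
  simp only [(hasPD_tanHalf hc).dirD_three, conn0, conn1, conn2, conn3, Matrix.of_apply,
      Matrix.cons_val]
  simp only [smul_eq_mul, b, e, X]
  linear_combination (0) * hcs

theorem frameRiem_3_0_2_1 (hc : Real.cos (p 3 / 2) ≠ 0) :
    frameRiem D.frame D.conn 3 0 p 2 1 = 0 := by
  have hcs := cosSq_mul hc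
  simp only [frameRiem, Fin.sum_univ_four, Matrix.add_apply, Matrix.sub_apply, Matrix.mul_apply,
      Matrix.smul_apply, conn_zero, conn_one, conn_two, conn_three, frameD_conn0, frameD_conn3]
  simp only [conn0, conn1, conn2, conn3, Matrix.of_apply, Matrix.cons_val]
  simp only [smul_eq_mul, b, e, Y]
  linear_combination (0) * hcs

theorem frameRiem_3_1_2_0 (hp : p 1 ∈ D.J) (hc : Real.cos (p 3 / 2) ≠ 0) :
    frameRiem D.frame D.conn 3 1 p 2 0 = 0 := by
  have hcs := cosSq_mul hc
  simp only [frameRiem, Fin.sum_univ_four, Matrix.add_apply, Matrix.sub_apply, Matrix.mul_apply,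
      Matrix.smul_apply, conn_zero, conn_one, conn_two, conn_three, frameD_conn1 hp
      hc, frameD_conn3]
  simp only [conn0, conn1, conn2, conn3, Matrix.of_apply, Matrix.cons_val]
  simp only [smul_eq_mul, b, e, Y]
  linear_combination (0) * hcs

theorem frameRiem_3_1_2_1 (hp : p 1 ∈ D.J) (hc : Real.cos (p 3 / 2) ≠ 0) :
    frameRiem D.frame D.conn 3 1 p 2 1 = 0 := by
  have hcs := cosSq_mul hc
  simp only [frameRiem, Fin.sum_univ_four, Matrix.add_apply, Matrix.sub_apply, Matrix.mul_apply,
      Matrix.smul_apply, conn_zero, conn_one, conn_two, conn_three, frameD_conn1 hp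
      hc, frameD_conn3]
  simp only [(hasPD_tanHalf hc).dirD_three, conn0, conn1, conn2, conn3, Matrix.of_apply,
      Matrix.cons_val]
  simp only [smul_eq_mul, b, e, X]
  linear_combination (0) * hcs

theorem frameRiem_3_0_2_2 (hc : Real.cos (p 3 / 2) ≠ 0) :
    frameRiem D.frame D.conn 3 0 p 2 2 = 0 := by
  have hcs := cosSq_mul hc
  simp only [frameRiem, Fin.sum_univ_four, Matrix.add_apply, Matrix.sub_apply, Matrix.mul_apply,
      Matrix.smul_apply, conn_zero, conn_one, conn_two, conn_three, frameD_conn0, frameD_conn3]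
  simp only [conn0, conn1, conn2, conn3, Matrix.of_apply, Matrix.cons_val]
  simp only [smul_eq_mul, b, X, Y, S]
  linear_combination (0) * hcs

theorem frameRiem_3_1_2_2 (hp : p 1 ∈ D.J) (hc : Real.cos (p 3 / 2) ≠ 0) :
    frameRiem D.frame D.conn 3 1 p 2 2 = 0 := by
  have hcs := cosSq_mul hc
  simp only [frameRiem, Fin.sum_univ_four, Matrix.add_apply, Matrix.sub_apply, Matrix.mul_apply,
      Matrix.smul_apply, conn_zero, conn_one, conn_two, conn_three, frameD_conn1 hp
      hc, frameD_conn3]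
  simp only [(hasPD_y (D.deriv_m _ hp)).dirD_three, conn0, conn1, conn2, conn3, Matrix.of_apply,
      Matrix.cons_val]
  simp only [smul_eq_mul, e, X, Y, S]
  linear_combination (0) * hcs

/-- This and the next three entries are what `Ψ₂` needs. They form a block that commutes with
rotations of the `e_0, e_1` plane, so contraction with `m` and `m̄` sees a single complex number. -/
theorem frameRiem_0_2_2_0 (hc : Real.cos (p 3 / 2) ≠ 0) :
    frameRiem D.frame D.conn 0 2 p 2 0 = -(8 / 3) * D.k (p 1) * (1 + tanHalf p ^ 2) + D.ν (p 1) *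
        cosSq p * tanHalf p * (4 * cosSq p - 1) / 16 + 2 * cosSq p * D.ode (p 1) := by
  have hcs := cosSq_mul hc
  simp only [frameRiem, Fin.sum_univ_four, Matrix.add_apply, Matrix.sub_apply, Matrix.mul_apply,
      Matrix.smul_apply, conn_zero, conn_one, conn_two, conn_three, frameD_conn0, frameD_conn2]
  simp only [(hasPD_tanHalf hc).dirD_two, conn0, conn1, conn2, conn3, Matrix.of_apply,
      Matrix.cons_val]
  simp only [smul_eq_mul, b, e, H, X, Y, Z0, S, ode]
  linear_combination (1 / 16 * D.ν (p 1) * cosSq p * tanHalf p) * hcs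

theorem frameRiem_1_2_2_1 (hp : p 1 ∈ D.J) (hc : Real.cos (p 3 / 2) ≠ 0) :
    frameRiem D.frame D.conn 1 2 p 2 1 = -(8 / 3) * D.k (p 1) * (1 + tanHalf p ^ 2) + D.ν (p 1) *
        cosSq p * tanHalf p * (4 * cosSq p - 1) / 16 + 2 * cosSq p * D.ode (p 1) := by
  have hcs := cosSq_mul hc
  simp only [frameRiem, Fin.sum_univ_four, Matrix.add_apply, Matrix.sub_apply, Matrix.mul_apply,
      Matrix.smul_apply, conn_zero, conn_one, conn_two, conn_three, frameD_conn1 hp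
      hc, frameD_conn2]
  simp only [(hasPD_tanHalf hc).dirD_two, conn0, conn1, conn2, conn3, Matrix.of_apply,
      Matrix.cons_val]
  simp only [smul_eq_mul, b, e, H, X, Y, Z1, S, ode]
  linear_combination (1 / 16 * D.ν (p 1) * cosSq p * tanHalf p) * hcs

theorem frameRiem_1_2_2_0 (hp : p 1 ∈ D.J) (hc : Real.cos (p 3 / 2) ≠ 0) :
    frameRiem D.frame D.conn 1 2 p 2 0 = D.ν (p 1) * cosSq p * (3 - 4 * cosSq p) / 16 + 2 * cosSq p
        * tanHalf p * D.ode (p 1) := by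
  have hcs := cosSq_mul hc
  simp only [frameRiem, Fin.sum_univ_four, Matrix.add_apply, Matrix.sub_apply, Matrix.mul_apply,
      Matrix.smul_apply, conn_zero, conn_one, conn_two, conn_three, frameD_conn1 hp
      hc, frameD_conn2]
  simp only [conn0, conn1, conn2, conn3, Matrix.of_apply, Matrix.cons_val]
  simp only [smul_eq_mul, b, e, X, Y, Z0, Z1, S, ode]
  linear_combination (1 / 16 * D.ν (p 1) * cosSq p) * hcs

theorem frameRiem_0_2_2_1 (hc : Real.cos (p 3 / 2) ≠ 0) :
    frameRiem D.frame D.conn 0 2 p 2 1 = -(D.ν (p 1) * cosSq p * (3 - 4 * cosSq p) / 16 + 2 * cosSq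
        p * tanHalf p * D.ode (p 1)) := by
  have hcs := cosSq_mul hc
  simp only [frameRiem, Fin.sum_univ_four, Matrix.add_apply, Matrix.sub_apply, Matrix.mul_apply,
      Matrix.smul_apply, conn_zero, conn_one, conn_two, conn_three, frameD_conn0, frameD_conn2]
  simp only [conn0, conn1, conn2, conn3, Matrix.of_apply, Matrix.cons_val]
  simp only [smul_eq_mul, b, e, X, Y, Z0, Z1, S, ode]
  linear_combination (-1 / 16 * D.ν (p 1) * cosSq p) * hcs

/-- The `(2,2)` entry stays unevaluated: the coframe form with index `2` is `λ`, so this entry is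
the free function `Φ` of the field equation. -/
theorem frameRicci_eq (hp : p 1 ∈ D.J) (hc : Real.cos (p 3 / 2) ≠ 0) (h : D.ode (p 1) = 0)
    (h1 : D.ode1 (p 1) = 0) :
    frameRicci D.frame D.conn p = D.Λ • D.frameMetric p
      + Matrix.single 2 2 (frameRicci D.frame D.conn p 2 2) := by
  ext i j
  fin_cases i <;> fin_cases j <;>
    simp [frameRicci_0_0 hp hc, frameRicci_0_1 hp hc, frameRicci_0_2 hp hc, frameRicci_0_3 hp hc,
      frameRicci_1_0 hp hc, frameRicci_1_1 hp hc, frameRicci_1_2 hp hc, frameRicci_1_3 hp hc,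
      frameRicci_2_0 hp hc, frameRicci_2_1 hp hc, frameRicci_2_3 hp hc, frameRicci_3_0 hp hc,
      frameRicci_3_1 hp hc, frameRicci_3_2 hp hc, frameRicci_3_3 hp hc, h, h1, frameMetric, P2,
          k] <;>
    ring

theorem transpose_mul_single_mul (Θ : Mat) (c : Fin 4) (r : ℝ) (i j : Fin 4) :
    (Θ.transpose * Matrix.single c c r * Θ) i j = r * (Θ c i * Θ c j) := by
  simp only [Matrix.mul_apply, Matrix.single_apply, Matrix.transpose_apply]
  rw [Finset.sum_eq_single c, Finset.sum_eq_single c]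
  · simp; ring
  · intro b _ hb; simp [hb.symm]
  · simp
  · intro b _ hb; simp [hb.symm]
  · simp

theorem deriv_ode {y : ℝ} (hy : y ∈ D.J) : HasDerivAt D.ode (D.ode1 y) y := by
  have hk : HasDerivAt D.k ((D.m y + 2 * D.l y) * D.k y) y := deriv_k (p := fun _ => y) hy
  have h := (((D.deriv_l1 y hy).add ((D.deriv_l y hy).pow 2)).sub
    ((D.deriv_m1 y hy).div_const 4)).sub (hk.const_mul (16 / 3))
  refine h.congr_deriv ?_
  simp only [ode1]
  ring

/-- Some Ricci components contain the derivative of the defect; it vanishes as well because the ODE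
is imposed on an open set. -/
theorem ode1_eq_zero (h : ∀ y ∈ D.J, D.ode y = 0) {y : ℝ} (hy : y ∈ D.J) : D.ode1 y = 0 := by
  have h0 : D.ode =ᶠ[nhds y] fun _ => 0 := by
    filter_upwards [D.isOpen_J.mem_nhds hy] with t ht using h t ht
  exact (deriv_ode hy).unique ((hasDerivAt_const y (0 : ℝ)).congr_of_eventuallyEq h0)

/-- The field equation for the lift is equivalent to the equation for `q`. -/
theorem isQuasiEinstein_iff {g : Pt → Mat} {lam : Pt → Fin 4 → ℝ}
    (hg : EqOn g D.metric (tubeDomain D.J))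
    (hlam : ∀ p ∈ tubeDomain D.J, lam p = D.coframe p 2) :
    IsQuasiEinstein g lam D.Λ (tubeDomain D.J) ↔ ∀ y ∈ D.J, D.ode y = 0 := by
  have hF := isFrame hg
  constructor
  · rintro ⟨Φ, hΦ⟩ y hy
    -- At `r = 0` one has `cosSq = 1` and `tanHalf = 0`, so the `(0,0)` component there reads off `4
    -- * ode y`; no other component is needed.
    let p : Pt := ![0, y, 0, 0]
    have hp : p ∈ tubeDomain D.J := ⟨hy, by simp [p, Real.pi_pos]⟩
    have hc := (cos_half_pos hp).ne'
    have h1 : (D.coframe p).transpose * frameRicci D.frame D.conn p * D.coframe p =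
        (D.coframe p).transpose * (D.Λ • D.frameMetric p + Matrix.single 2 2 (Φ p))
          * D.coframe p := by
      ext i j
      rw [← hF.ricci_eq hp, hΦ p hp, hg hp, hlam p hp, Matrix.mul_add, Matrix.add_mul,
          Matrix.add_apply,
        transpose_mul_single_mul, Matrix.mul_smul, Matrix.smul_mul]
      rfl
    -- The coframe is invertible, so the coordinate equation can be conjugated back to the frame.
    have h2 : frameRicci D.frame D.conn p = D.Λ • D.frameMetric p + Matrix.single 2 2 (Φ p) := by
      have hΘE := hF.dual' hp
      have hEΘ : (D.frame p).transpose * (D.coframe p).transpose = 1 := by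
        rw [← Matrix.transpose_mul, hΘE, Matrix.transpose_one]
      have h3 := congrArg (fun M => (D.frame p).transpose * M * D.frame p) h1
      simp only [Matrix.mul_assoc, hΘE, Matrix.mul_one] at h3
      simpa only [← Matrix.mul_assoc, hEΘ, Matrix.one_mul] using h3
    have h3 := congrFun (congrFun h2 0) 0
    rw [frameRicci_0_0 hy hc] at h3
    have hC : cosSq p = 1 := by simp [cosSq, p]
    have hT : tanHalf p = 0 := by simp [tanHalf, p]
    simp [hC, hT, frameMetric, P2, k] at h3
    have hy' : p 1 = y := rfl
    rw [hy'] at h3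
    linarith
  · intro h
    refine ⟨fun p => frameRicci D.frame D.conn p 2 2, fun p hp i j => ?_⟩
    rw [hF.ricci_eq hp, frameRicci_eq hp.1 (cos_half_pos hp).ne' (h _ hp.1) (ode1_eq_zero h hp.1),
      Matrix.mul_add, Matrix.add_mul, Matrix.add_apply, transpose_mul_single_mul, Matrix.mul_smul,
      Matrix.smul_mul, hg hp, hlam p hp]
    simp [metric, frameMetric]

end TubeJets

/-! ### The null tetrad, the Weyl scalars and the Petrov type -/

namespace TubeJets

variable {D : TubeJets} {p : Pt}

theorem bilinC_frameMetric (α β : Fin 4 → ℂ) :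
    bilinC (D.frameMetric p) α β =
      D.P2 p * (2 * (α 0 * β 0) + 2 * (α 1 * β 1) + α 2 * β 3 + α 3 * β 2) := by
  simp [bilinC, Fin.sum_univ_four, frameMetric]
  ring

/-- The vector is `nullK`; this is the reason why only row `2` of the curvature matters below. -/
theorem bilinC_frameMetric_mul (M : Mat) (β : Fin 4 → ℂ) :
    bilinC (D.frameMetric p * M) ![0, 0, 0, 1] β =
      D.P2 p * (M 2 0 * β 0 + M 2 1 * β 1 + M 2 2 * β 2 + M 2 3 * β 3) := by
  simp [bilinC, Fin.sum_univ_four, frameMetric, Matrix.mul_apply]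
  ring

theorem frameMetric_inv (hp : p 1 ∈ D.J) : (D.frameMetric p)⁻¹ =
    !![1 / (2 * D.P2 p), 0, 0, 0;
      0, 1 / (2 * D.P2 p), 0, 0;
      0, 0, 0, 1 / D.P2 p;
      0, 0, 1 / D.P2 p, 0] := by
  have := (P2_pos (D := D) hp).ne'
  apply Matrix.inv_eq_right_inv
  ext i j
  fin_cases i <;> fin_cases j <;>
    simp [frameMetric, Matrix.mul_apply, Fin.sum_univ_four, this] <;> field_simp

/-- The form `λ` is null, so `Φ λ²` has no trace. -/
theorem scalarCurvature_eq {g : Pt → Mat} (hg : EqOn g D.metric (tubeDomain D.J))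
    (h : ∀ y ∈ D.J, D.ode y = 0) (hp : p ∈ tubeDomain D.J) : scalarCurvature g p = 4 * D.Λ := by
  have hP := (P2_pos (D := D) hp.1).ne'
  rw [(isFrame hg).scalarCurvature_eq hp, frameMetric_inv hp.1,
    frameRicci_eq hp.1 (cos_half_pos hp).ne' (h _ hp.1) (ode1_eq_zero h hp.1)]
  simp only [Matrix.trace, Matrix.diag_apply, Fin.sum_univ_four, Matrix.mul_apply,
    Matrix.transpose_apply, Matrix.add_apply, Matrix.smul_apply, frameMetric]
  simp
  field_simp
  ring

/-- Frame components of the null vector `k = ∂/∂r`. -/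
def nullK : Fin 4 → ℂ := ![0, 0, 0, 1]

/-- Frame components of the null vector `l`. -/
def nullL (D : TubeJets) (p : Pt) : Fin 4 → ℂ := ![0, 0, ((-(D.P2 p)⁻¹ : ℝ) : ℂ), 0]

/-- Frame components of the null vector `m`. -/
def nullM (D : TubeJets) (p : Pt) : Fin 4 → ℂ :=
  ![(((2 * Real.sqrt (D.P2 p))⁻¹ : ℝ) : ℂ), (((2 * Real.sqrt (D.P2 p))⁻¹ : ℝ) : ℂ) * Complex.I,
    0, 0]

theorem star_nullM : star (nullM D p) = ![(((2 * Real.sqrt (D.P2 p))⁻¹ : ℝ) : ℂ),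
    -((((2 * Real.sqrt (D.P2 p))⁻¹ : ℝ) : ℂ) * Complex.I), 0, 0] := by
  ext i
  fin_cases i <;> simp [nullM]

theorem sq_nullM (hp : p 1 ∈ D.J) :
    (D.P2 p : ℂ) * (((2 * Real.sqrt (D.P2 p))⁻¹ : ℝ) : ℂ) ^ 2 = 1 / 4 := by
  have hP := P2_pos (D := D) hp
  have : D.P2 p * (2 * Real.sqrt (D.P2 p))⁻¹ ^ 2 = 1 / 4 := by
    rw [inv_pow, mul_pow, Real.sq_sqrt hP.le]
    field_simp
    norm_num
  have := congrArg Complex.ofReal this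
  push_cast at this ⊢
  exact this

theorem P2_mul_nullL (hp : p 1 ∈ D.J) : (D.P2 p : ℂ) * ((-(D.P2 p)⁻¹ : ℝ) : ℂ) = -1 := by
  have hP := (P2_pos (D := D) hp).ne'
  have : D.P2 p * -(D.P2 p)⁻¹ = -1 := by field_simp
  have := congrArg Complex.ofReal this
  push_cast at this ⊢
  exact this

theorem isNullTetrad {g : Pt → Mat} (hg : EqOn g D.metric (tubeDomain D.J))
    (hp : p ∈ tubeDomain D.J) : IsNullTetrad (g p) (frameVec (D.frame p) nullK)
      (frameVec (D.frame p) (nullL D p)) (frameVec (D.frame p) (nullM D p)) := by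
  have hΘE := (isFrame hg).dual' hp
  have h2 := P2_mul_nullL (D := D) hp.1
  have h3 := sq_nullM (D := D) hp.1
  have hbil : ∀ α β, bilinC (g p) (frameVec (D.frame p) α) (frameVec (D.frame p) β) =
      D.P2 p * (2 * (α 0 * β 0) + 2 * (α 1 * β 1) + α 2 * β 3 + α 3 * β 2) := by
    intro α β
    rw [(isFrame hg).metric p hp, bilinC_frameVec hΘE, bilinC_frameMetric]
  constructor
  · rw [star_frameVec]
    congr 1
    ext i
    fin_cases i <;> simp [nullK]
  · rw [star_frameVec]
    congr 1
    ext i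
    fin_cases i <;> simp [nullL]
  · simp [hbil, nullK]
  · simp [hbil, nullL]
  · rw [hbil, ← h2]
    simp [nullK, nullL]
  · simp [hbil, nullK, nullM]
  · simp [hbil, nullL, nullM]
  · rw [hbil]
    simp only [nullM, Matrix.cons_val]
    linear_combination (2 * D.P2 p * (((2 * Real.sqrt (D.P2 p))⁻¹ : ℝ) : ℂ) ^ 2) * Complex.I_sq
  · rw [star_frameVec, hbil, star_nullM]
    simp only [nullM, Matrix.cons_val]
    linear_combination 4 * h3 - (2 * D.P2 p * (((2 * Real.sqrt (D.P2 p))⁻¹ : ℝ) : ℂ) ^ 2)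
      * Complex.I_sq

theorem bilinC_frameRicci (hp : p ∈ tubeDomain D.J) (h : ∀ y ∈ D.J, D.ode y = 0)
    (α β : Fin 4 → ℂ) : bilinC (frameRicci D.frame D.conn p) α β =
      D.Λ * bilinC (D.frameMetric p) α β + frameRicci D.frame D.conn p 2 2 * (α 2 * β 2) := by
  rw [← bilinC_smul_single_add,
    ← frameRicci_eq hp.1 (cos_half_pos hp).ne' (h _ hp.1) (ode1_eq_zero h hp.1)]

section weyl

variable {g : Pt → Mat}

/-- The vectors `k` and `m` span a totally null plane annihilated by `λ`, so the metric and Ricci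
corrections in the Weyl tensor vanish and only vanishing curvature entries remain. -/
theorem psi0_eq_zero (hg : EqOn g D.metric (tubeDomain D.J)) (h : ∀ y ∈ D.J, D.ode y = 0)
    (hp : p ∈ tubeDomain D.J) :
    Psi0 g p (frameVec (D.frame p) nullK) (frameVec (D.frame p) (nullM D p)) = 0 := by
  have hc := (cos_half_pos hp).ne'
  rw [Psi0, (isFrame hg).weylC_frameVec hp]
  simp only [bilinC_frameRicci hp h, bilinC_frameMetric, nullK, bilinC_frameMetric_mul,
    Fin.sum_univ_four]
  simp [nullM, frameRiem_3_0_2_0 hc, frameRiem_3_0_2_1 hc, frameRiem_3_1_2_0 hp.1 hc,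
    frameRiem_3_1_2_1 hp.1 hc]

theorem psi1_eq_zero (hg : EqOn g D.metric (tubeDomain D.J)) (h : ∀ y ∈ D.J, D.ode y = 0)
    (hp : p ∈ tubeDomain D.J) :
    Psi1 g p (frameVec (D.frame p) nullK) (frameVec (D.frame p) (nullL D p))
      (frameVec (D.frame p) (nullM D p)) = 0 := by
  have hc := (cos_half_pos hp).ne'
  rw [Psi1, (isFrame hg).weylC_frameVec hp]
  simp only [bilinC_frameRicci hp h, bilinC_frameMetric, nullK, bilinC_frameMetric_mul,
    Fin.sum_univ_four]
  simp [nullM, nullL, frameRiem_3_0_2_2 hc, frameRiem_3_1_2_2 hp.1 hc]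

/-- The right-hand side is `-(i ν / 32) cos (r/2) exp (-3ir/2)` by the triple-angle formulas. The
`Λ` terms of the Riemann, Ricci and scalar parts cancel. -/
theorem P2_mul_psi2 (hg : EqOn g D.metric (tubeDomain D.J)) (h : ∀ y ∈ D.J, D.ode y = 0)
    (hp : p ∈ tubeDomain D.J) :
    D.P2 p * Psi2 g p (frameVec (D.frame p) nullK) (frameVec (D.frame p) (nullL D p))
      (frameVec (D.frame p) (nullM D p)) =
    ((-(D.ν (p 1) * cosSq p * tanHalf p * (4 * cosSq p - 1) / 32) : ℝ) : ℂ)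
      + ((D.ν (p 1) * cosSq p * (3 - 4 * cosSq p) / 32 : ℝ) : ℂ) * Complex.I := by
  have hc := (cos_half_pos hp).ne'
  have h2 := P2_mul_nullL (D := D) hp.1
  have h3 := sq_nullM (D := D) hp.1
  rw [Psi2, star_frameVec, (isFrame hg).weylC_frameVec hp, scalarCurvature_eq hg h hp]
  simp only [bilinC_frameRicci hp h, bilinC_frameMetric, nullK, bilinC_frameMetric_mul,
    Fin.sum_univ_four, star_nullM]
  simp only [nullM, nullL, Matrix.cons_val]
  -- The cosmological part is rewritten through `Λ P²`, the form in which the Ricci and scalar terms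
  -- contain it, so that it can cancel.
  have hA : (frameRiem D.frame D.conn 0 2 p 2 0 : ℂ) = ((-(D.Λ * D.P2 p) * (2 / 3)
      + D.ν (p 1) * cosSq p * tanHalf p * (4 * cosSq p - 1) / 16 : ℝ) : ℂ) := by
    rw [frameRiem_0_2_2_0 hc, h _ hp.1, P2, k]
    congr 1
    ring
  have hA' : (frameRiem D.frame D.conn 1 2 p 2 1 : ℂ) = ((-(D.Λ * D.P2 p) * (2 / 3)
      + D.ν (p 1) * cosSq p * tanHalf p * (4 * cosSq p - 1) / 16 : ℝ) : ℂ) := by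
    rw [frameRiem_1_2_2_1 hp.1 hc, h _ hp.1, P2, k]
    congr 1
    ring
  rw [hA, hA', frameRiem_1_2_2_0 hp.1 hc, frameRiem_0_2_2_1 hc, h _ hp.1]
  -- With the normalizations of `m` and `l` as opaque constants, what remains is a polynomial
  -- identity modulo `P t = -1`, `P s² = 1/4` and `I² = -1`.
  generalize (((2 * Real.sqrt (D.P2 p))⁻¹ : ℝ) : ℂ) = s at *
  generalize ((-(D.P2 p)⁻¹ : ℝ) : ℂ) = t at *
  push_cast
  simp only [zero_mul, mul_zero, add_zero, zero_add, zero_sub, one_mul]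
  have hI := Complex.I_sq
  generalize (D.P2 p : ℂ) = P at *
  generalize (D.ν (p 1) : ℂ) = n at *
  generalize (cosSq p : ℂ) = C at *
  generalize (tanHalf p : ℂ) = T at *
  generalize (D.Λ : ℂ) = c at *
  linear_combination
    (n * C * T * (4 * C - 1) / 16 * (1 - Complex.I ^ 2) - 2 * (n * C * (3 - 4 * C) / 16)
        * Complex.I)
      * (P * t) * h3
    + (n * C * T * (4 * C - 1) / 16 * (1 - Complex.I ^ 2)
      - 2 * (n * C * (3 - 4 * C) / 16) * Complex.I) / 4 * h2
    + n * C * T * (4 * C - 1) / 16 / 4 * hI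

/-- Once `Ψ₀ = Ψ₁ = 0 ≠ Ψ₂` in one tetrad, types II and D are separated only by a discriminant, so a
case distinction replaces the computation of `Ψ₃` and `Ψ₄`. -/
theorem petrov (hg : EqOn g D.metric (tubeDomain D.J)) (h : ∀ y ∈ D.J, D.ode y = 0)
    (hp : p ∈ tubeDomain D.J) : IsPetrovTypeII g p ∨ IsPetrovTypeD g p := by
  have hc := (cos_half_pos hp).ne'
  have h2 : Psi2 g p (frameVec (D.frame p) nullK) (frameVec (D.frame p) (nullL D p))
      (frameVec (D.frame p) (nullM D p)) ≠ 0 := by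
    intro h0
    have h1 := P2_mul_psi2 hg h hp
    rw [h0, mul_zero] at h1
    have hν := D.ν_ne _ hp.1
    have hC : cosSq p ≠ 0 := pow_ne_zero 2 hc
    have hre := congrArg Complex.re h1
    have him := congrArg Complex.im h1
    simp [hν, hC] at hre him
    -- If `Ψ₂` were zero, its imaginary part would force `cosSq = 3/4`; then the real part forces
    -- `tanHalf = 0`, hence `cosSq = 1`, a contradiction.
    have hC3 : 3 - 4 * cosSq p = 0 := by
      have h3 : D.ν (p 1) * cosSq p * (3 - 4 * cosSq p) = 0 := by linarith
      exact (mul_eq_zero.1 h3).resolve_left (mul_ne_zero hν hC)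
    have hT : tanHalf p = 0 := hre.resolve_right fun h4 => by linarith
    have hcs := cosSq_mul hc
    rw [hT] at hcs
    linarith
  by_cases hD : 2 * Psi3 g p (frameVec (D.frame p) nullK) (frameVec (D.frame p) (nullL D p))
      (frameVec (D.frame p) (nullM D p)) ^ 2 = 3 * Psi2 g p (frameVec (D.frame p) nullK)
        (frameVec (D.frame p) (nullL D p)) (frameVec (D.frame p) (nullM D p))
        * Psi4 g p (frameVec (D.frame p) (nullL D p)) (frameVec (D.frame p) (nullM D p))
  · exact Or.inr ⟨_, _, _, isNullTetrad hg hp, psi0_eq_zero hg h hp, psi1_eq_zero hg h hp, h2, hD⟩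
  · exact Or.inl ⟨_, _, _, isNullTetrad hg hp, psi0_eq_zero hg h hp, psi1_eq_zero hg h hp, h2, hD⟩

end weyl

end TubeJets

/-! ### Signature and shearfreeness -/

namespace TubeJets

variable {D : TubeJets} {p : Pt} {g : Pt → Mat}

theorem isLorentzianMetric (hg : EqOn g D.metric (tubeDomain D.J)) :
    IsLorentzianMetric g (tubeDomain D.J) := by
  have hF := isFrame hg
  refine ⟨fun i j => ?_, fun p hp => ?_, fun p hp => ?_⟩
  · exact ((((smooth_coframe (D := D)).transpose.mul smooth_frameMetric).mul smooth_coframe)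
      i j).congr fun p hp => by rw [hg hp]; rfl
  · have h := hF.symm p hp
    rw [hF.metric p hp, Matrix.IsSymm]
    simp only [Matrix.transpose_mul, Matrix.transpose_transpose, h.eq, Matrix.mul_assoc]
  · have hP := P2_pos (D := D) hp.1
    obtain ⟨s, hs⟩ : ∃ s : ℝ, 2 * D.P2 p * s ^ 2 = 1 := by
      refine ⟨(Real.sqrt (2 * D.P2 p))⁻¹, ?_⟩
      rw [inv_pow, Real.sq_sqrt (by positivity)]
      field_simp
    -- In the null plane `e_2 + e_3` is spacelike and `e_2 - e_3` timelike; `s` normalizes all four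
    -- vectors at once.
    let K : Mat := !![s, 0, 0, 0; 0, s, 0, 0; 0, 0, s, s; 0, 0, s, -s]
    have h1 : (D.frame p * K).transpose * g p * (D.frame p * K) =
        Matrix.diagonal ![1, 1, 1, -1] := by
      have h2 : (D.frame p * K).transpose * g p * (D.frame p * K) =
          K.transpose * ((D.coframe p * D.frame p).transpose * D.frameMetric p
            * (D.coframe p * D.frame p)) * K := by
        rw [hF.metric p hp]
        simp only [Matrix.transpose_mul, Matrix.mul_assoc]
      rw [h2, hF.dual' hp, Matrix.transpose_one, Matrix.one_mul, Matrix.mul_one]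
      ext i j
      fin_cases i <;> fin_cases j <;>
        simp [K, Matrix.mul_apply, Fin.sum_univ_four, frameMetric] <;> linarith
    refine ⟨D.frame p * K, ?_, h1⟩
    have h3 := congrArg Matrix.det h1
    rw [Matrix.det_mul, Matrix.det_diagonal, Fin.prod_univ_four] at h3
    rw [isUnit_iff_ne_zero]
    intro h0
    rw [h0] at h3
    simp at h3

theorem metric_apply (i j : Fin 4) : D.metric p i j = D.P2 p *
    (2 * (D.coframe p 0 i * D.coframe p 0 j + D.coframe p 1 i * D.coframe p 1 j)
      + (D.coframe p 2 i * D.coframe p 3 j + D.coframe p 3 i * D.coframe p 2 j)) := by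
  simp [metric, Matrix.mul_apply, Fin.sum_univ_four, frameMetric]
  ring

/-- The derivative of the last form of the coframe along `∂/∂r`. -/
def tauR (D : TubeJets) (p : Pt) (i : Fin 4) : ℝ := pd 3 (fun x => D.coframe x 3 i) p

theorem hasPD_coframe (hp : p 1 ∈ D.J) (hc : Real.cos (p 3 / 2) ≠ 0) (i : Fin 4) :
    (∃ t, HasPD (fun x => D.coframe x 2 i) t 0 p) ∧
      ∃ t, HasPD (fun x => D.coframe x 3 i) t (D.tauR p i) p := by
  have key : ∀ {f : Pt → ℝ} {s t : ℝ}, HasPD f s t p → HasPD f s (pd 3 f p) p := fun h =>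
    h.congr rfl h.pd_r
  have h20 : HasPD (fun x => D.coframe x 2 0) _ _ p :=
    ((hasPD_y (D.deriv_L _ hp)).mul (hasPD_y (D.deriv_f _ hp))).neg
  have h22 : HasPD (fun x => D.coframe x 2 2) _ _ p := hasPD_y (D.deriv_L _ hp)
  have h30 : HasPD (fun x => D.coframe x 3 0) _ _ p :=
    ((hasPD_const 2 p).mul (hasPD_a hp hc)).add ((hasPD_H hp hc).mul h20)
  have h31 : HasPD (fun x => D.coframe x 3 1) _ _ p :=
    ((hasPD_const 2 p).mul (hasPD_b hp hc)).neg
  have h32 : HasPD (fun x => D.coframe x 3 2) _ _ p := (hasPD_H hp hc).mul h22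
  fin_cases i
  · exact ⟨⟨_, h20.congr rfl (by ring)⟩, _, key h30⟩
  · exact ⟨⟨_, hasPD_const 0 p⟩, _, key h31⟩
  · exact ⟨⟨_, h22⟩, _, key h32⟩
  · exact ⟨⟨_, hasPD_const 0 p⟩, _, key (hasPD_const 1 p)⟩

/-- Among the ingredients of the metric only `P²` and `τ` depend on `r`. The first contributes a
multiple of the metric, the second a symmetric product with `λ`. -/
theorem pd_metric (hp : p 1 ∈ D.J) (hc : Real.cos (p 3 / 2) ≠ 0) (i j : Fin 4) :
    pd 3 (fun x => D.metric x i j) p = tanHalf p * D.metric p i j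
      + D.P2 p * (D.coframe p 2 i * D.tauR p j + D.tauR p i * D.coframe p 2 j) := by
  simp only [metric_apply]
  obtain ⟨⟨_, hi2⟩, _, hi3⟩ := hasPD_coframe hp hc i
  obtain ⟨⟨_, hj2⟩, _, hj3⟩ := hasPD_coframe hp hc j
  have h01 : ∃ r : ℝ, ∀ x : Pt, D.coframe x 0 i * D.coframe x 0 j
      + D.coframe x 1 i * D.coframe x 1 j = r := by
    refine ⟨D.coframe p 0 i * D.coframe p 0 j + D.coframe p 1 i * D.coframe p 1 j, fun x => ?_⟩
    fin_cases i <;> fin_cases j <;> simp [coframe]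
  obtain ⟨r, hr⟩ := h01
  simp only [hr]
  rw [((hasPD_P2 hp hc).mul ((hasPD_const (2 * r) p).add ((hi2.mul hj3).add (hi3.mul hj2)))).pd_r]
  ring

/-- Since `∂/∂r` has constant components, the Lie derivative is `∂g/∂r`, and `θ = P² λ`. So
`pd_metric` has the required form with `ρ = tan (r/2)` and `ψ = 2 ∂τ/∂r`; the factor `2` compensates
the one half in the symmetric product. -/
theorem isShearfree (hg : EqOn g D.metric (tubeDomain D.J)) :
    IsShearfree g (tubeDomain D.J) dr := by
  have hU := isOpen_tubeDomain D.isOpen_J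
  refine ⟨fun i => contDiffOn_const, fun p _ h => ?_, fun p hp => ?_, ?_⟩
  · simpa [dr] using congrFun h 3
  · rw [hg hp]
    simp [dr, Fin.sum_univ_four, metric_apply, coframe]
  · refine ⟨tanHalf, fun p i => 2 * D.tauR p i, contDiffOn_tanHalf _, fun i =>
      contDiffOn_const.mul (contDiffOn_pd hU (smooth_coframe 3 i) 3), fun p hp i j => ?_⟩
    have hflat : ∀ i, flat g dr p i = D.P2 p * D.coframe p 2 i := by
      intro i
      simp [flat, dr, hg hp, Fin.sum_univ_four, metric_apply, coframe]
    have hlie : lieDerivMetric dr g i j p = pd 3 (fun x => g x i j) p := by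
      have h0 : ∀ k l, pd k (fun x => dr x l) p = 0 := fun k l => pd_const k _ p
      simp only [lieDerivMetric, h0]
      simp [dr, Fin.sum_univ_four]
    rw [hlie, hflat, hflat, pd_congr hU (g := fun x => D.metric x i j) (fun x hx => by
      simp only [hg hx]) hp, pd_metric hp.1 (cos_half_pos hp).ne', hg hp]
    ring

end TubeJets

/-! ### From `F` and `q` to the abstract data -/

theorem contDiffOn_deriv {f : ℝ → ℝ} {J : Set ℝ} (hJ : IsOpen J) (hf : ContDiffOn ℝ ∞ f J) :
    ContDiffOn ℝ ∞ (deriv f) J :=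
  hf.deriv_of_isOpen hJ (by simp)

theorem hasDerivAt_of_contDiffOn {f : ℝ → ℝ} {J : Set ℝ} (hJ : IsOpen J)
    (hf : ContDiffOn ℝ ∞ f J) {y : ℝ} (hy : y ∈ J) : HasDerivAt f (deriv f y) y :=
  ((hf.differentiableOn (by simp)).differentiableAt (hJ.mem_nhds hy)).hasDerivAt

section

variable {F q : ℝ → ℝ} {J : Set ℝ}

/-- The functions of `y` that belong to `tubeMetric F Λ q`. -/
def tubeJets (Λ : ℝ) (hJ : IsOpen J) (hF : ContDiffOn ℝ ∞ F J) (hpsc : ∀ y ∈ J, Fyy F y ≠ 0)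
    (hq : ContDiffOn ℝ ∞ q J) (hq0 : ∀ y ∈ J, q y ≠ 0) : TubeJets :=
  have hφ : ContDiffOn ℝ ∞ (Fyy F) J := contDiffOn_deriv hJ (contDiffOn_deriv hJ hF)
  have hm : ContDiffOn ℝ ∞ (fun y => deriv (Fyy F) y / Fyy F y) J :=
    (contDiffOn_deriv hJ hφ).div hφ hpsc
  have hl : ContDiffOn ℝ ∞ (logD q) J := (contDiffOn_deriv hJ hq).div hq hq0
  { J := J
    Λ := Λ
    f := deriv F
    L := fun y => 2 / Fyy F y
    π := fun y => |Fyy F y| * q y ^ 2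
    ν := fun y => Fyy F y / q y ^ 4
    m := fun y => deriv (Fyy F) y / Fyy F y
    m1 := deriv fun y => deriv (Fyy F) y / Fyy F y
    m2 := deriv (deriv fun y => deriv (Fyy F) y / Fyy F y)
    l := logD q
    l1 := deriv (logD q)
    l2 := deriv (deriv (logD q))
    isOpen_J := hJ
    smooth_f := contDiffOn_deriv hJ hF
    smooth_L := contDiffOn_const.div hφ hpsc
    smooth_π := (hφ.abs hpsc).mul (hq.pow 2)
    smooth_ν := hφ.div (hq.pow 4) fun y hy => pow_ne_zero 4 (hq0 y hy)
    smooth_m := hm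
    smooth_m1 := contDiffOn_deriv hJ hm
    smooth_m2 := contDiffOn_deriv hJ (contDiffOn_deriv hJ hm)
    smooth_l := hl
    smooth_l1 := contDiffOn_deriv hJ hl
    smooth_l2 := contDiffOn_deriv hJ (contDiffOn_deriv hJ hl)
    L_ne := fun y hy => div_ne_zero two_ne_zero (hpsc y hy)
    π_pos := fun y hy => mul_pos (abs_pos.2 (hpsc y hy)) (sq_pos_of_ne_zero (hq0 y hy))
    ν_ne := fun y hy => div_ne_zero (hpsc y hy) (pow_ne_zero 4 (hq0 y hy))
    deriv_f := fun y hy => by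
      have := hpsc y hy
      refine (hasDerivAt_of_contDiffOn hJ (contDiffOn_deriv hJ hF) hy).congr_deriv ?_
      rw [div_div_cancel₀ two_ne_zero, Fyy]
    deriv_L := fun y hy => by
      have := hpsc y hy
      refine ((hasDerivAt_const y (2 : ℝ)).div (hasDerivAt_of_contDiffOn hJ hφ hy)
        this).congr_deriv ?_
      field_simp
      ring
    deriv_π := fun y hy => by
      have h1 := hpsc y hy
      have h2 := hq0 y hy
      have h3 := ((hasDerivAt_abs h1).comp y (hasDerivAt_of_contDiffOn hJ hφ hy)).mul
        ((hasDerivAt_of_contDiffOn hJ hq hy).pow 2)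
      refine h3.congr_deriv ?_
      -- Writing `|F_yy|` as sign times `F_yy` gives its logarithmic derivative for both signs at
      -- once.
      have h4 : (SignType.sign (Fyy F y) : ℝ) * Fyy F y = |Fyy F y| := sign_mul_self _
      simp only [Function.comp_apply, Pi.pow_apply, logD, ← h4]
      field_simp
      ring
    deriv_ν := fun y hy => by
      have h1 := hpsc y hy
      have h2 := hq0 y hy
      refine ((hasDerivAt_of_contDiffOn hJ hφ hy).div ((hasDerivAt_of_contDiffOn hJ hq hy).pow 4)
        (pow_ne_zero 4 h2)).congr_deriv ?_
      simp only [Pi.pow_apply, logD]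
      field_simp
      ring
    deriv_m := fun y hy => hasDerivAt_of_contDiffOn hJ hm hy
    deriv_m1 := fun y hy => hasDerivAt_of_contDiffOn hJ (contDiffOn_deriv hJ hm) hy
    deriv_l := fun y hy => hasDerivAt_of_contDiffOn hJ hl hy
    deriv_l1 := fun y hy => hasDerivAt_of_contDiffOn hJ (contDiffOn_deriv hJ hl) hy }

/-- The derivative of `log |F_yy|` is `F_yyy / F_yy` for either sign of `F_yy`, so `R` is `-m1 / 4`.
-/
theorem tubeR_eq (hJ : IsOpen J) (hF : ContDiffOn ℝ ∞ F J) (hpsc : ∀ y ∈ J, Fyy F y ≠ 0) {y : ℝ}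
    (hy : y ∈ J) : tubeR F y = -(deriv (fun y => deriv (Fyy F) y / Fyy F y) y) / 4 := by
  have hφ : ContDiffOn ℝ ∞ (Fyy F) J := contDiffOn_deriv hJ (contDiffOn_deriv hJ hF)
  have h1 : deriv (fun t => Real.log |Fyy F t|) =ᶠ[nhds y] fun t => deriv (Fyy F) t / Fyy F t := by
    filter_upwards [hJ.mem_nhds hy] with t ht
    simp only [Real.log_abs]
    exact ((hasDerivAt_of_contDiffOn hJ hφ ht).log (hpsc t ht)).deriv
  rw [tubeR, h1.deriv_eq]
  ring

theorem tubeP_sq {p : Pt} (hc : Real.cos (p 3 / 2) ≠ 0) :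
    tubeP F q p ^ 2 = 4 * (|Fyy F (p 1)| * q (p 1) ^ 2) * (1 + tanHalf p ^ 2) := by
  rw [tubeP, div_pow, mul_pow, mul_pow, Real.sq_sqrt (abs_nonneg _), tanHalf,
    Real.tan_eq_sin_div_cos]
  have := Real.sin_sq_add_cos_sq (p 3 / 2)
  field_simp
  rw [add_comm, this]
  ring

/-- This and the next formula are the half-angle substitutions carrying `W` and `H` to polynomials
in `cosSq` and `tanHalf`. -/
theorem one_add_cos (p : Pt) : 1 + Real.cos (p 3) = 2 * cosSq p := by
  have := Real.cos_sq (p 3 / 2)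
  rw [mul_div_cancel₀ _ two_ne_zero] at this
  rw [cosSq]
  linarith

theorem sin_eq {p : Pt} (hc : Real.cos (p 3 / 2) ≠ 0) :
    Real.sin (p 3) = 2 * (cosSq p * tanHalf p) := by
  have := Real.sin_two_mul (p 3 / 2)
  rw [mul_div_cancel₀ _ two_ne_zero] at this
  rw [cosSq, tanHalf, Real.tan_eq_sin_div_cos, this]
  field_simp

theorem tubeW_eq {p : Pt} (hc : Real.cos (p 3 / 2) ≠ 0) :
    tubeW q p = ((2 * logD q (p 1) * cosSq p : ℝ) : ℂ)
      + (((-2) * logD q (p 1) * cosSq p * tanHalf p : ℝ) : ℂ) * Complex.I := by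
  have h : -(Complex.I * (p 3 : ℂ)) = ((-p 3 : ℝ) : ℂ) * Complex.I := by push_cast; ring
  rw [tubeW, h, Complex.exp_mul_I, ← Complex.ofReal_cos, ← Complex.ofReal_sin, Real.cos_neg,
    Real.sin_neg, sin_eq hc, eq_sub_iff_add_eq'.2 (one_add_cos p)]
  push_cast
  ring

variable {Λ : ℝ}

theorem tubeH_eq (hJ : IsOpen J) (hF : ContDiffOn ℝ ∞ F J) (hpsc : ∀ y ∈ J, Fyy F y ≠ 0)
    (hq : ContDiffOn ℝ ∞ q J) (hq0 : ∀ y ∈ J, q y ≠ 0)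
    {p : Pt} (hp : p ∈ tubeDomain J) :
    tubeH F Λ q p = (tubeJets Λ hJ hF hpsc hq hq0).H p := by
  have hc := (cos_half_pos hp).ne'
  have hs : Real.sin (2 * p 3) + 2 * Real.sin (p 3) = 8 * (cosSq p ^ 2 * tanHalf p) := by
    have h1 : Real.sin (2 * p 3) + 2 * Real.sin (p 3) =
      2 * Real.sin (p 3) * (1 + Real.cos (p 3)) := by rw [Real.sin_two_mul]; ring
    rw [h1, one_add_cos, sin_eq hc]
    ring
  rw [tubeH, hs, one_add_cos, tubeB, tubeR_eq hJ hF hpsc hp.1]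
  simp only [TubeJets.H, TubeJets.k, tubeJets]
  have := hq0 _ hp.1
  field_simp
  ring

theorem tubeLam_eq (hJ : IsOpen J) (hF : ContDiffOn ℝ ∞ F J) (hpsc : ∀ y ∈ J, Fyy F y ≠ 0)
    (hq : ContDiffOn ℝ ∞ q J) (hq0 : ∀ y ∈ J, q y ≠ 0)
    (p : Pt) : tubeLam F p = (tubeJets Λ hJ hF hpsc hq hq0).coframe p 2 := by
  ext i
  fin_cases i <;> simp [tubeLam, tubeContact, TubeJets.coframe, tubeJets]

/-- The metric involves `P` only through its square, so the sign of `q` is immaterial and `π =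
|F_yy| q²` is the right datum. -/
theorem tubeMetric_eqOn (hJ : IsOpen J) (hF : ContDiffOn ℝ ∞ F J) (hpsc : ∀ y ∈ J, Fyy F y ≠ 0)
    (hq : ContDiffOn ℝ ∞ q J) (hq0 : ∀ y ∈ J, q y ≠ 0) :
    EqOn (tubeMetric F Λ q) (tubeJets Λ hJ hF hpsc hq hq0).metric (tubeDomain J) := by
  intro p hp
  have hc := (cos_half_pos hp).ne'
  ext i j
  rw [TubeJets.metric_apply, tubeMetric, liftMetric, Matrix.of_apply, tubeP_sq hc,
    tubeW_eq hc, tubeH_eq hJ hF hpsc hq hq0 hp, ← tubeLam_eq (Λ := Λ) hJ hF hpsc hq hq0]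
  set D := tubeJets Λ hJ hF hpsc hq hq0
  have hP : D.P2 p = 4 * (|Fyy F (p 1)| * q (p 1) ^ 2) * (1 + tanHalf p ^ 2) := rfl
  have hτ : ∀ i, (if i = 3 then 1 else 0) + 2 * ((((2 * logD q (p 1) * cosSq p : ℝ) : ℂ)
      + (((-2) * logD q (p 1) * cosSq p * tanHalf p : ℝ) : ℂ) * Complex.I) * tubeMu p i).re
      + D.H p * tubeLam F p i = D.coframe p 3 i := by
    intro i
    have ha : 2 * logD q (p 1) * cosSq p = D.a p := rfl
    have hb : (-2) * logD q (p 1) * cosSq p * tanHalf p = D.b p := rfl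
    rw [ha, hb, tubeLam_eq (Λ := Λ) hJ hF hpsc hq hq0]
    fin_cases i <;> simp [tubeMu, TubeJets.coframe, D]
  have hμ : ∀ i j, (tubeMu p i * star (tubeMu p j)).re = D.coframe p 0 i * D.coframe p 0 j
      + D.coframe p 1 i * D.coframe p 1 j := by
    intro i j
    fin_cases i <;> fin_cases j <;> simp [tubeMu, TubeJets.coframe]
  simp only [hτ, hP, hμ]

theorem isLift_tubeMetric (hJ : IsOpen J) (hF : ContDiffOn ℝ ∞ F J) (hpsc : ∀ y ∈ J, Fyy F y ≠ 0)
    (hq : ContDiffOn ℝ ∞ q J) (hq0 : ∀ y ∈ J, q y ≠ 0) : IsLift tubeMu (tubeLam F)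
        (tubeMetric F Λ q) (tubeDomain J) := by
  have hφ : ContDiffOn ℝ ∞ (Fyy F) J := contDiffOn_deriv hJ (contDiffOn_deriv hJ hF)
  obtain ⟨ha, hb, -, hH, -⟩ := TubeJets.smooth_fields (D := tubeJets Λ hJ hF hpsc hq hq0)
  refine ⟨tubeP F q, tubeW q, tubeH F Λ q, ?_, ?_, ?_, fun p hp => ?_, fun p _ => rfl⟩
  · refine ContDiffOn.div ?_ ?_ fun p hp => (cos_half_pos hp).ne'
    · exact contDiffOn_comp_y ((contDiffOn_const.mul
        ((hφ.abs hpsc).sqrt fun y hy => (abs_pos.2 (hpsc y hy)).ne')).mul hq)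
    · fun_prop
  · exact ((Complex.ofRealCLM.contDiff.comp_contDiffOn ha).add
      ((Complex.ofRealCLM.contDiff.comp_contDiffOn hb).mul contDiffOn_const)).congr
      fun p hp => tubeW_eq (cos_half_pos hp).ne'
  · exact hH.congr fun p hp => tubeH_eq hJ hF hpsc hq hq0 hp
  · have h1 := (cos_half_pos hp).ne'
    have h2 := (Real.sqrt_pos.2 (abs_pos.2 (hpsc _ hp.1))).ne'
    have h3 := hq0 _ hp.1
    rw [tubeP]
    positivity

/-- The logarithmic derivative `l` of `q` satisfies `l' + l² = q'' / q`, so dividing the equation by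
`q` turns it into the Riccati form `ode = 0`. -/
theorem solvesTubeODE_iff (hJ : IsOpen J) (hF : ContDiffOn ℝ ∞ F J) (hpsc : ∀ y ∈ J, Fyy F y ≠ 0)
    (hq : ContDiffOn ℝ ∞ q J) (hq0 : ∀ y ∈ J, q y ≠ 0) :
    SolvesTubeODE F Λ q J ↔ ∀ y ∈ J, (tubeJets Λ hJ hF hpsc hq hq0).ode y = 0 := by
  refine forall₂_congr fun y hy => ?_
  have h0 := hq0 y hy
  have h1 : deriv (logD q) y = (deriv (deriv q) y * q y - deriv q y * deriv q y) / q y ^ 2 :=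
    ((hasDerivAt_of_contDiffOn hJ (contDiffOn_deriv hJ hq) hy).div
      (hasDerivAt_of_contDiffOn hJ hq hy) h0).deriv
  have h2 : deriv (deriv q) y + tubeR F y * q y - 16 / 3 * Λ * |Fyy F y| * q y ^ 3 =
      q y * (tubeJets Λ hJ hF hpsc hq hq0).ode y := by
    rw [tubeR_eq hJ hF hpsc hy]
    simp only [TubeJets.ode, TubeJets.k, tubeJets, h1, logD]
    field_simp
    ring
  rw [← sub_eq_zero, h2, mul_eq_zero, or_iff_right h0]

end

/-! ### Smooth local solutions of the ODE -/

/-- Solutions of `q' = v`, `v' = A q³ - R q` with smooth coefficients are smooth. -/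
theorem contDiffOn_of_ode {A R q v : ℝ → ℝ} {U : Set ℝ} (hU : IsOpen U) (hA : ContDiffOn ℝ ∞ A U)
    (hR : ContDiffOn ℝ ∞ R U) (hq : ∀ y ∈ U, HasDerivAt q (v y) y)
    (hv : ∀ y ∈ U, HasDerivAt v (A y * q y ^ 3 - R y * q y) y) : ContDiffOn ℝ ∞ q U := by
  -- The induction carries `q` and `v` together: the derivative of each is a smooth expression in
  -- the other functions, so both gain one order.
  have key : ∀ n : ℕ, ContDiffOn ℝ n q U ∧ ContDiffOn ℝ n v U := by
    intro n
    induction n with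
    | zero =>
      simp only [Nat.cast_zero, contDiffOn_zero]
      exact ⟨fun y hy => (hq y hy).continuousAt.continuousWithinAt,
        fun y hy => (hv y hy).continuousAt.continuousWithinAt⟩
    | succ n ih =>
      obtain ⟨h1, h2⟩ := ih
      have hA' := hA.of_le (m := n) (by exact_mod_cast le_top)
      have hR' := hR.of_le (m := n) (by exact_mod_cast le_top)
      simp only [Nat.cast_add, Nat.cast_one, contDiffOn_succ_iff_deriv_of_isOpen hU]
      exact ⟨⟨fun y hy => (hq y hy).differentiableAt.differentiableWithinAt, by simp,
        h2.congr fun y hy => (hq y hy).deriv⟩,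
        fun y hy => (hv y hy).differentiableAt.differentiableWithinAt, by simp,
        ((hA'.mul (h1.pow 3)).sub (hR'.mul h1)).congr fun y hy => (hv y hy).deriv⟩
  exact contDiffOn_infty.2 fun n => (key n).1

/-- The initial value problem for `q'' + R q = A q³`, near a point with `q ≠ 0`. -/
theorem exists_solution {A R : ℝ → ℝ} {U : Set ℝ} (hU : IsOpen U) (hA : ContDiffOn ℝ ∞ A U)
    (hR : ContDiffOn ℝ ∞ R U) {y₀ : ℝ} (hy₀ : y₀ ∈ U) {q₀ : ℝ} (hq₀ : q₀ ≠ 0) (q₁ : ℝ) :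
    ∃ ε > 0, Ioo (y₀ - ε) (y₀ + ε) ⊆ U ∧ ∃ q : ℝ → ℝ, ContDiffOn ℝ ∞ q (Ioo (y₀ - ε) (y₀ + ε)) ∧
      (∀ y ∈ Ioo (y₀ - ε) (y₀ + ε), q y ≠ 0) ∧ q y₀ = q₀ ∧ deriv q y₀ = q₁ ∧
      ∀ y ∈ Ioo (y₀ - ε) (y₀ + ε), deriv (deriv q) y + R y * q y = A y * q y ^ 3 := by
  -- The non-autonomous second-order equation as an autonomous field in `(y, q, q')`, to which
  -- Picard–Lindelöf for a `C¹` field applies.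
  let f : ℝ × ℝ × ℝ → ℝ × ℝ × ℝ := fun x => (1, x.2.2, A x.1 * x.2.1 ^ 3 - R x.1 * x.2.1)
  have hf : ContDiffAt ℝ 1 f (y₀, q₀, q₁) := by
    have hA1 : ContDiffAt ℝ 1 (fun x : ℝ × ℝ × ℝ => A x.1) (y₀, q₀, q₁) :=
      ContDiffAt.comp (y₀, q₀, q₁) ((hA.contDiffAt (hU.mem_nhds hy₀)).of_le (by simp))
        contDiffAt_fst
    have hR1 : ContDiffAt ℝ 1 (fun x : ℝ × ℝ × ℝ => R x.1) (y₀, q₀, q₁) :=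
      ContDiffAt.comp (y₀, q₀, q₁) ((hR.contDiffAt (hU.mem_nhds hy₀)).of_le (by simp))
        contDiffAt_fst
    exact contDiffAt_const.prodMk (contDiffAt_snd.snd.prodMk
      ((hA1.mul (contDiffAt_snd.fst.pow 3)).sub (hR1.mul contDiffAt_snd.fst)))
  obtain ⟨α, h0, ε, hε, hα⟩ :=
    hf.exists_forall_mem_closedBall_exists_eq_forall_mem_Ioo_hasDerivAt₀ y₀
  have hy : y₀ ∈ Ioo (y₀ - ε) (y₀ + ε) := ⟨by linarith, by linarith⟩
  have hα1 : ∀ t ∈ Ioo (y₀ - ε) (y₀ + ε), HasDerivAt (fun t => (α t).1) 1 t :=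
    fun t ht => (hα t ht).fst
  have hq : ∀ t ∈ Ioo (y₀ - ε) (y₀ + ε), HasDerivAt (fun t => (α t).2.1) (α t).2.2 t :=
    fun t ht => (hα t ht).snd.fst
  have hv : ∀ t ∈ Ioo (y₀ - ε) (y₀ + ε), HasDerivAt (fun t => (α t).2.2)
      (A (α t).1 * (α t).2.1 ^ 3 - R (α t).1 * (α t).2.1) t := fun t ht => (hα t ht).snd.snd
  -- The first component has derivative `1` and starts at `y₀`, so it is the time variable itself.
  have hid : ∀ t ∈ Ioo (y₀ - ε) (y₀ + ε), (α t).1 = t := by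
    intro t ht
    have h1 := isOpen_Ioo.eqOn_of_deriv_eq (isPreconnected_Ioo (a := y₀ - ε) (b := y₀ + ε))
      (fun t ht => (hα1 t ht).differentiableAt.differentiableWithinAt) differentiableOn_id
      (fun t ht => by rw [(hα1 t ht).deriv, deriv_id]) hy (by simp [h0])
    exact h1 ht
  have hne : ∀ᶠ t in nhds y₀, (α t).2.1 ≠ 0 :=
    (hq y₀ hy).continuousAt.eventually_ne (by simpa [h0] using hq₀)
  -- One radius is chosen so that `q` is nonzero, the coefficients are smooth and the solution
  -- exists.
  obtain ⟨δ, hδ, hsub⟩ := Metric.mem_nhds_iff.1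
    (Filter.inter_mem (Filter.inter_mem hne (hU.mem_nhds hy₀)) (isOpen_Ioo.mem_nhds hy))
  rw [Real.ball_eq_Ioo] at hsub
  refine ⟨δ, hδ, fun t ht => (hsub ht).1.2, fun t => (α t).2.1, ?_, fun t ht => (hsub ht).1.1,
    by simp [h0], by rw [(hq y₀ hy).deriv, h0], fun t ht => ?_⟩
  · refine contDiffOn_of_ode isOpen_Ioo (hA.mono fun t ht => (hsub ht).1.2)
      (hR.mono fun t ht => (hsub ht).1.2) (fun t ht => hq t (hsub ht).2) fun t ht => ?_
    have := hv t (hsub ht).2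
    rwa [hid t (hsub ht).2] at this
  · have h1 : deriv (fun t => (α t).2.1) =ᶠ[nhds t] fun t => (α t).2.2 := by
      filter_upwards [isOpen_Ioo.mem_nhds ht] with s hs using (hq s (hsub hs).2).deriv
    rw [h1.deriv_eq, (hv t (hsub ht).2).deriv, hid t (hsub ht).2]
    ring

theorem exists_solvesTubeODE {F : ℝ → ℝ} {I : Set ℝ} (hI : IsOpen I) (hF : ContDiffOn ℝ ∞ F I)
    (hpsc : ∀ y ∈ I, Fyy F y ≠ 0) (Λ : ℝ) {y₀ : ℝ} (hy₀ : y₀ ∈ I) {q₀ : ℝ} (hq₀ : q₀ ≠ 0)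
    (q₁ : ℝ) :
    ∃ ε > 0, Ioo (y₀ - ε) (y₀ + ε) ⊆ I ∧ ∃ q : ℝ → ℝ,
      ContDiffOn ℝ ∞ q (Ioo (y₀ - ε) (y₀ + ε)) ∧ (∀ y ∈ Ioo (y₀ - ε) (y₀ + ε), q y ≠ 0) ∧
      q y₀ = q₀ ∧ deriv q y₀ = q₁ ∧ SolvesTubeODE F Λ q (Ioo (y₀ - ε) (y₀ + ε)) := by
  have hφ : ContDiffOn ℝ ∞ (Fyy F) I := contDiffOn_deriv hI (contDiffOn_deriv hI hF)
  have hR : ContDiffOn ℝ ∞ (tubeR F) I := by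
    refine (((contDiffOn_deriv hI ((contDiffOn_deriv hI hφ).div hφ hpsc)).neg).div_const 4).congr
      fun y hy => tubeR_eq hI hF hpsc hy
  exact exists_solution hI (A := fun y => 16 / 3 * Λ * |Fyy F y|)
    (contDiffOn_const.mul (hφ.abs hpsc)) hR hy₀ hq₀ q₁

theorem tubeMetric_properties {F q : ℝ → ℝ} {J : Set ℝ} (Λ : ℝ) (hJ : IsOpen J)
    (hF : ContDiffOn ℝ ∞ F J) (hpsc : ∀ y ∈ J, Fyy F y ≠ 0) (hq : ContDiffOn ℝ ∞ q J)
    (hq0 : ∀ y ∈ J, q y ≠ 0) :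
    IsLift tubeMu (tubeLam F) (tubeMetric F Λ q) (tubeDomain J) ∧
      IsLorentzianMetric (tubeMetric F Λ q) (tubeDomain J) ∧
      IsShearfree (tubeMetric F Λ q) (tubeDomain J) dr ∧
      (IsQuasiEinstein (tubeMetric F Λ q) (tubeLam F) Λ (tubeDomain J) ↔ SolvesTubeODE F Λ q J) ∧
      (SolvesTubeODE F Λ q J → ∀ p ∈ tubeDomain J,
        IsPetrovTypeII (tubeMetric F Λ q) p ∨ IsPetrovTypeD (tubeMetric F Λ q) p) := by
  have hg := tubeMetric_eqOn (Λ := Λ) hJ hF hpsc hq hq0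
  have hode := solvesTubeODE_iff (Λ := Λ) hJ hF hpsc hq hq0
  exact ⟨isLift_tubeMetric hJ hF hpsc hq hq0, TubeJets.isLorentzianMetric hg,
    TubeJets.isShearfree hg,
    (TubeJets.isQuasiEinstein_iff hg fun p _ => tubeLam_eq hJ hF hpsc hq hq0 p).trans hode.symm,
    fun h p hp => TubeJets.petrov hg (hode.1 h) hp⟩

end Shearfree

end

/-- Let `v = F(y)`, `y ∈ I`, be a smooth strictly pseudoconvex tubular hypersurface and `Λ` real.
Near every point there is a shearfree lift of Petrov type II or D with `Ric(g) = Λ g + Φ λ²`; for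
the lifts `tubeMetric F Λ q` the field equation is equivalent to an ODE for `q`, and this ODE has
local solutions for arbitrary initial data. -/
theorem mainTheorem2 (F : ℝ → ℝ) (I : Set ℝ) (hI : IsOpen I) (hF : ContDiffOn ℝ ∞ F I)
    (hpsc : ∀ y ∈ I, Fyy F y ≠ 0) (Λ : ℝ) :
    (∀ y₀ ∈ I, ∃ ε > 0, Ioo (y₀ - ε) (y₀ + ε) ⊆ I ∧ ∃ g : Pt → Mat,
      IsLift tubeMu (tubeLam F) g (tubeDomain (Ioo (y₀ - ε) (y₀ + ε))) ∧
      IsLorentzianMetric g (tubeDomain (Ioo (y₀ - ε) (y₀ + ε))) ∧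
      IsShearfree g (tubeDomain (Ioo (y₀ - ε) (y₀ + ε))) dr ∧
      IsQuasiEinstein g (tubeLam F) Λ (tubeDomain (Ioo (y₀ - ε) (y₀ + ε))) ∧
      ∀ p ∈ tubeDomain (Ioo (y₀ - ε) (y₀ + ε)), IsPetrovTypeII g p ∨ IsPetrovTypeD g p) ∧
    (∀ (J : Set ℝ) (q : ℝ → ℝ), IsOpen J → J ⊆ I → ContDiffOn ℝ ∞ q J → (∀ y ∈ J, q y ≠ 0) →
      IsLift tubeMu (tubeLam F) (tubeMetric F Λ q) (tubeDomain J) ∧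
      IsLorentzianMetric (tubeMetric F Λ q) (tubeDomain J) ∧
      IsShearfree (tubeMetric F Λ q) (tubeDomain J) dr ∧
      (IsQuasiEinstein (tubeMetric F Λ q) (tubeLam F) Λ (tubeDomain J) ↔ SolvesTubeODE F Λ q J) ∧
      (SolvesTubeODE F Λ q J → ∀ p ∈ tubeDomain J,
        IsPetrovTypeII (tubeMetric F Λ q) p ∨ IsPetrovTypeD (tubeMetric F Λ q) p)) ∧
    (∀ y₀ ∈ I, ∀ q₀ q₁ : ℝ, q₀ ≠ 0 → ∃ ε > 0, Ioo (y₀ - ε) (y₀ + ε) ⊆ I ∧ ∃ q : ℝ → ℝ,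
      ContDiffOn ℝ ∞ q (Ioo (y₀ - ε) (y₀ + ε)) ∧ (∀ y ∈ Ioo (y₀ - ε) (y₀ + ε), q y ≠ 0) ∧
      q y₀ = q₀ ∧ deriv q y₀ = q₁ ∧ SolvesTubeODE F Λ q (Ioo (y₀ - ε) (y₀ + ε))) := by
  have h3 := fun (y₀ : ℝ) (hy₀ : y₀ ∈ I) (q₀ q₁ : ℝ) (hq₀ : q₀ ≠ 0) =>
    exists_solvesTubeODE hI hF hpsc Λ hy₀ hq₀ q₁
  refine ⟨fun y₀ hy₀ => ?_, fun J q hJ hJI hq hq0 => tubeMetric_properties Λ hJ (hF.mono hJI)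
    (fun y hy => hpsc y (hJI hy)) hq hq0, h3⟩
  -- Existence needs just one solution; the initial data `1, 0` are an arbitrary admissible choice.
  obtain ⟨ε, hε, hJI, q, hq, hq0, -, -, hode⟩ := h3 y₀ hy₀ 1 0 one_ne_zero
  obtain ⟨h1, h2, h3, h4, h5⟩ := tubeMetric_properties Λ isOpen_Ioo (hF.mono hJI)
    (fun y hy => hpsc y (hJI hy)) hq hq0
  exact ⟨ε, hε, hJI, tubeMetric F Λ q, h1, h2, h3, h4.2 hode, h5 hode⟩
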